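/- Let $D\ge 4$ be an integer, $\mu>0$, $a\in\mathbb R$; indices $j,k,l,p,q$ run over $1,\dots,D-2$ and repeated transverse indices are summed. **Space.** Let $\mathcal H^{[\mu]}=L^2(\mathbb R_+\times\mathbb R^{D-2},\,dp^+d\tilde p/(2p^+))$ with dense subspace $\mathcal D^{[\mu]}=C_c^\infty(\mathbb R_+\times\mathbb R^{D-2})$. Let $\mathcal F^{(R)}$ be the Fock space, with vacuum $\Omega$, of Bose oscillators $\alpha^j_m$ ($m\in\mathbb Z\setminus\{0\}$) and Fermi oscillators $d^j_m$ ($m\in\mathbb Z$) with $$[\alpha^j_m,\alpha^k_n]=m\,\delta_{jk}\delta_{m+n,0},\quad \{d^j_m,d^k_n\}=\delta_{jk}\delta_{m+n,0},\quad [\alpha^j_m,d^k_n]=0,\quad (\alpha^j_m)^+=\alpha^j_{-m},\ (d^j_m)^+=d^j_{-m},$$ and $\alpha^j_m\Omega=d^j_m\Omega=0$ for $m>0$, where $d^j_0=(b^j_0+(b^j_0)^+)/\sqrt2$ with $b^j_0$ Fermi annihilation operators of additional modes ($\{b^j_0,(b^k_0)^+\}=\delta_{jk}$, $\{b_0^j,b_0^k\}=0$,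 anticommuting with all $d^l_m$, $m\neq0$), $b^j_0\Omega=0$. Let $\mathcal D_0\subset\mathcal F^{(R)}$ be the dense subspace of finite linear combinations of occupation number states, $\mathcal D=\mathcal D^{[\mu]}\otimes\mathcal D_0$ and $\mathcal H^{(R)}=\mathcal H^{[\mu]}\otimes\mathcal F^{(R)}$. Put $\alpha^j_0=p^j$ and let $:\ :$ denote the Wick product. **Operators on $\mathcal D$.** $$L_m=\tfrac12\sum_{n\in\mathbb Z}:\alpha^j_{m-n}\alpha^j_n:+\tfrac12\sum_{n\in\mathbb Z}n:d^j_{-n}d^j_{m+n}:+\Big(\tfrac D{16}-a\Big)\delta_{m,0},\qquad K^{jk}_m=\tfrac12\sum_{n\in\mathbb Z}\big(:d^j_{-n}d^k_{m+n}:-:d^k_{-n}d^j_{m+n}:\big),$$ $$E^j=-i\sum_{m>0}\tfrac1m(\alpha^j_{-m}L_m-L_{-m}\alpha^j_m),\qquad F^j=-i\sum_{m>0}(\alpha^l_{-m}K^{jl}_m+K^{jl}_{-m}\alpha^l_m)-iK^{jl}_0\alpha^l_0,\qquad K^j=E^j+F^j,$$ $$J^{(R)jk}=-i\sum_{m>0}\tfrac1m(\alpha^j_{-m}\alpha^k_m-\alpha^k_{-m}\alpha^j_m)-iK^{jk}_0,\qquad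 H=\sum_{m>0}\alpha^j_{-m}\alpha^j_m+\sum_{m>0}m\,d^j_{-m}d^j_m .$$ All the sums are finite on each vector of $\mathcal D$. With $p^-=(\tilde p^2+\mu^2)/(2p^+)$, $\partial_j=\partial/\partial p^j$, $\partial_+=\partial/\partial p^+$, set $$P^\pm=p^\pm,\quad P^j=p^j,\quad J^{kl}=-i(p^k\partial_l-p^l\partial_k)+J^{(R)kl},\quad J^{k+}=ip^+\partial_k,$$ $$J^{k-}=i(p^-\partial_k+p^k\partial_+)+\tfrac1{p^+}K^k,\quad J^{+-}=-ip^+\partial_+ .$$ **Poincaré algebra.** We say that these operators represent the Poincaré algebra on a subspace $S\subseteq\mathcal D$ if they map $S$ into $S$ and if on $S$, for all transverse indices and all signs $\epsilon,\epsilon_1,\epsilon_2=\pm1$, $J^{jk}=-J^{kj}$ and $$[P^{\epsilon_1},P^{\epsilon_2}]=[P^\epsilon,P^j]=[P^j,P^k]=[P^\epsilon,J^{jk}]=[P^j,J^{+-}]=[J^{+-},J^{jk}]=0,$$ $$[P^\epsilon,J^{+-}]=i\epsilon P^\epsilon,\quad [P^{\epsilon_1},J^{j\epsilon_2}]=-\tfrac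 i2(1-\epsilon_1\epsilon_2)P^j,\quad [P^j,J^{k\epsilon}]=-i\delta_{jk}P^\epsilon,$$ $$[P^j,J^{kl}]=-i\delta_{jk}P^l+i\delta_{jl}P^k,\quad [J^{+-},J^{j\epsilon}]=-i\epsilon J^{j\epsilon},\quad [J^{j\epsilon},J^{kl}]=-i\delta_{jk}J^{l\epsilon}+i\delta_{jl}J^{k\epsilon},$$ $$[J^{j\epsilon_1},J^{k\epsilon_2}]=\tfrac i2(-1+\epsilon_1\epsilon_2)J^{jk}+\tfrac i2(\epsilon_2-\epsilon_1)\delta_{jk}J^{+-},$$ $$[J^{kl},J^{pq}]=-i\delta_{lp}J^{kq}+i\delta_{kp}J^{lq}+i\delta_{lq}J^{kp}-i\delta_{kq}J^{lp}.$$ **Theorem.** For $\ell\in\mathbb R$ let $\mathcal H_\ell=\{\Psi\in\mathcal H^{(R)}: H\Psi=\ell\Psi\}$ ($H$ being the self-adjoint closure), and let $\mathcal H_{phys}=\mathcal H_{\mu^2/2}$ be the physical Hilbert space. 1. If $D=10$, the operators represent the Poincaré algebra on $\mathcal D\cap\mathcal H_{phys}$. 2. If $\mu^2/2\in\mathbb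 N=\{0,1,2,\dots\}$ (the values of $\ell$ in $\mathbb N$ being the spectrum of $H$), the operators represent the Poincaré algebra on $\mathcal D\cap\mathcal H_{phys}$ if and only if $D=10$. 3. For every $N\in\mathbb N$, the operators represent the Poincaré algebra on $\mathcal D\cap\mathcal H_N$ if and only if $D=10$ and $N=\mu^2/2$. 4. The operators never represent the Poincaré algebra on the whole of $\mathcal D$. -/

import Mathlib

open scoped TensorProduct ContDiff

noncomputable section

namespace RamondString

/-! ### One-particle space of mass `μ` in light-cone coordinates

`D` is the space-time dimension; transverse indices are elements of `Fin (D - 2)`.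
A momentum is `p = (p⁺, p̃)`. -/

/-- Light-cone momenta `(p⁺, p̃) ∈ ℝ × ℝ^(D-2)`. -/
abbrev Mom (D : ℕ) : Type := ℝ × (Fin (D - 2) → ℝ)

/-- The open half space `p⁺ > 0`, i.e. `ℝ₊ × ℝ^(D-2)`. -/
def halfSpace (D : ℕ) : TopologicalSpace.Opens (Mom D) :=
  ⟨{p | 0 < p.1}, isOpen_lt continuous_const continuous_fst⟩

/-- The domain of the one-particle operators: smooth complex functions with compact support in
`ℝ₊ × ℝ^(D-2)`. -/
abbrev TestFn (D : ℕ) : Type := TestFunction (halfSpace D) ℂ ⊤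

/-- The invariant measure `dp⁺ dp̃ / (2 p⁺)` on `ℝ₊ × ℝ^(D-2)`. -/
def lcMeasure (D : ℕ) : MeasureTheory.Measure (Mom D) :=
  (MeasureTheory.volume.restrict {p : Mom D | 0 < p.1}).withDensity
    (fun p => ENNReal.ofReal (1 / (2 * p.1)))

/-- The one-particle Hilbert space `L²(ℝ₊ × ℝ^(D-2), dp⁺ dp̃ / (2 p⁺))`. -/
abbrev OneParticle (D : ℕ) : Type := MeasureTheory.Lp ℂ 2 (lcMeasure D)

theorem lcMeasure_lt_top {D : ℕ} {K : Set (Mom D)} (hK : IsCompact K)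
    (hpos : K ⊆ {p | 0 < p.1}) : lcMeasure D K < ⊤ := by
  have hc : ContinuousOn (fun p : Mom D => 1 / (2 * p.1)) K := by
    refine ContinuousOn.div continuousOn_const (by fun_prop) ?_
    intro p hp
    have : 0 < p.1 := hpos hp
    positivity
  obtain ⟨C, hC⟩ := hK.exists_bound_of_continuousOn hc
  rw [lcMeasure, MeasureTheory.withDensity_apply _ hK.measurableSet]
  calc _ ≤ ∫⁻ _ in K, ENNReal.ofReal C ∂(MeasureTheory.volume.restrict {p : Mom D | 0 < p.1}) := by
        refine MeasureTheory.setLIntegral_mono measurable_const ?_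
        intro p hp
        exact ENNReal.ofReal_le_ofReal ((le_abs_self _).trans (hC p hp))
    _ ≤ ENNReal.ofReal C * MeasureTheory.volume K := by
        rw [MeasureTheory.setLIntegral_const]
        gcongr
        exact MeasureTheory.Measure.restrict_le_self
    _ < ⊤ := ENNReal.mul_lt_top ENNReal.ofReal_lt_top hK.measure_lt_top

theorem TestFn.memLp {D : ℕ} (f : TestFn D) : MeasureTheory.MemLp f 2 (lcMeasure D) := by
  set K := tsupport f
  have hK : IsCompact K := f.hasCompactSupport
  have hfin : lcMeasure D K < ⊤ := lcMeasure_lt_top hK f.tsupport_subset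
  obtain ⟨C, hC⟩ := f.continuous.bounded_above_of_compact_support f.hasCompactSupport
  have h1 : MeasureTheory.MemLp f 2 ((lcMeasure D).restrict K) := by
    have : MeasureTheory.IsFiniteMeasure ((lcMeasure D).restrict K) :=
      ⟨by simpa using hfin⟩
    exact MeasureTheory.MemLp.of_bound f.continuous.aestronglyMeasurable C
      (Filter.Eventually.of_forall hC)
  have h2 := (MeasureTheory.memLp_indicator_iff_restrict (f := f) (p := 2) (μ := lcMeasure D)
    hK.measurableSet).2 h1
  have h3 : K.indicator f = f := by
    rw [Set.indicator_eq_self]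
    exact subset_tsupport f
  rwa [h3] at h2

/-- The inclusion of the test functions into the one-particle Hilbert space. -/
def TestFn.toL2 (D : ℕ) : TestFn D →ₗ[ℂ] OneParticle D where
  toFun f := f.memLp.toLp f
  map_add' _ _ := rfl
  map_smul' _ _ := rfl

/-- Multiplication of test functions by a function that is smooth on the half space `p⁺ > 0`. -/
def mulOp {D : ℕ} (g : Mom D → ℂ) (hg : ContDiffOn ℝ ∞ g {p | 0 < p.1}) :
    Module.End ℂ (TestFn D) where
  toFun f :=
    { toFun := fun p => g p * f p
      contDiff' := by
        rw [contDiff_iff_contDiffAt]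
        intro p
        by_cases hp : 0 < p.1
        · exact (hg.contDiffAt ((halfSpace D).isOpen.mem_nhds hp)).mul f.contDiff.contDiffAt
        · have hn : p ∉ tsupport f := fun h => hp (f.tsupport_subset h)
          have h0 : (fun q => g q * f q) =ᶠ[nhds p] fun _ => 0 := by
            filter_upwards [notMem_tsupport_iff_eventuallyEq.1 hn] with q hq
            rw [hq]; simp
          exact contDiffAt_const.congr_of_eventuallyEq h0
      hasCompactSupport' := f.hasCompactSupport.mul_left
      tsupport_subset' := (tsupport_mul_subset_right).trans f.tsupport_subset }
  map_add' f h := by ext p; exact mul_add _ _ _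
  map_smul' c f := by ext p; exact mul_left_comm _ _ _

/-- The derivative of test functions along a fixed direction `v` of momentum space. -/
def derivOp {D : ℕ} (v : Mom D) : Module.End ℂ (TestFn D) where
  toFun f :=
    { toFun := fun p => fderiv ℝ f p v
      contDiff' := (f.contDiff.fderiv_right (m := ∞) (by simp)).clm_apply contDiff_const
      hasCompactSupport' := f.hasCompactSupport.fderiv_apply ℝ v
      tsupport_subset' := (tsupport_fderiv_apply_subset ℝ v).trans f.tsupport_subset }
  map_add' f h := by
    ext p
    change fderiv ℝ (⇑f + ⇑h) p v = _
    rw [fderiv_add (f.contDiff.differentiable (by simp) p) (h.contDiff.differentiable (by simp) p)]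
    rfl
  map_smul' c f := by
    ext p
    change fderiv ℝ (c • ⇑f) p v = _
    rw [fderiv_const_smul (f.contDiff.differentiable (by simp) p)]
    rfl

/-- The energy function `p⁻ = (p̃² + μ²) / (2 p⁺)`. -/
def pMinusFun (D : ℕ) (μ : ℝ) (p : Mom D) : ℝ := (∑ j, p.2 j ^ 2 + μ ^ 2) / (2 * p.1)

theorem contDiffOn_pMinus (D : ℕ) (μ : ℝ) :
    ContDiffOn ℝ ∞ (fun p : Mom D => ((pMinusFun D μ p : ℝ) : ℂ)) {p | 0 < p.1} := by
  refine Complex.ofRealCLM.contDiff.comp_contDiffOn (ContDiffOn.div ?_ ?_ ?_)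
  · exact ContDiff.contDiffOn (by fun_prop)
  · exact ContDiff.contDiffOn (by fun_prop)
  · intro p hp
    have : 0 < p.1 := hp
    positivity

theorem contDiffOn_inv (D : ℕ) :
    ContDiffOn ℝ ∞ (fun p : Mom D => ((p.1⁻¹ : ℝ) : ℂ)) {p | 0 < p.1} := by
  refine Complex.ofRealCLM.contDiff.comp_contDiffOn (ContDiffOn.inv ?_ ?_)
  · exact ContDiff.contDiffOn (by fun_prop)
  · intro p hp
    exact ne_of_gt hp

/-- Multiplication by `p⁺`. -/
def pPlus (D : ℕ) : Module.End ℂ (TestFn D) :=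
  mulOp (fun p => ((p.1 : ℝ) : ℂ)) (Complex.ofRealCLM.contDiff.comp contDiff_fst).contDiffOn

/-- Multiplication by `1 / p⁺`. -/
def pPlusInv (D : ℕ) : Module.End ℂ (TestFn D) :=
  mulOp (fun p => ((p.1⁻¹ : ℝ) : ℂ)) (contDiffOn_inv D)

/-- Multiplication by `p⁻`. -/
def pMinus (D : ℕ) (μ : ℝ) : Module.End ℂ (TestFn D) :=
  mulOp (fun p => ((pMinusFun D μ p : ℝ) : ℂ)) (contDiffOn_pMinus D μ)

/-- Multiplication by the transverse momentum `p^j`. -/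
def pTr (D : ℕ) (j : Fin (D - 2)) : Module.End ℂ (TestFn D) :=
  mulOp (fun p => ((p.2 j : ℝ) : ℂ))
    (Complex.ofRealCLM.contDiff.comp (g := Complex.ofRealCLM) (f := fun p : Mom D => p.2 j)
      (by fun_prop)).contDiffOn

/-- `∂ / ∂p⁺`. -/
def dPlus (D : ℕ) : Module.End ℂ (TestFn D) := derivOp (1, 0)

/-- `∂ / ∂p^j`. -/
def dTr (D : ℕ) (j : Fin (D - 2)) : Module.End ℂ (TestFn D) := derivOp (0, Pi.single j 1)

/-- `L^{jk} = -i (p^j ∂_k - p^k ∂_j)`. -/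
def orbTr (D : ℕ) (j k : Fin (D - 2)) : Module.End ℂ (TestFn D) :=
  (-Complex.I) • (pTr D j * dTr D k - pTr D k * dTr D j)

/-- `L^{j+} = i p⁺ ∂_j`. -/
def orbPlus (D : ℕ) (j : Fin (D - 2)) : Module.End ℂ (TestFn D) :=
  Complex.I • (pPlus D * dTr D j)

/-- `L^{j-} = i (p⁻ ∂_j + p^j ∂_+)`. -/
def orbMinus (D : ℕ) (μ : ℝ) (j : Fin (D - 2)) : Module.End ℂ (TestFn D) :=
  Complex.I • (pMinus D μ * dTr D j + pTr D j * dPlus D)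

/-- `L^{+-} = -i p⁺ ∂_+`. -/
def orbPM (D : ℕ) : Module.End ℂ (TestFn D) := (-Complex.I) • (pPlus D * dPlus D)

/-! ### The Fock space of the Ramond system -/

/-- Occupation numbers. The Bose oscillators are `a^j_m` with `m ≥ 1`; the pair `(k, j)` stands for
`m = k + 1`. The Fermi oscillators are `b^j_m` with `m ≥ 0`, and each is empty or occupied once; the
modes are ordered lexicographically. -/
abbrev FockIndex (D : ℕ) : Type :=
  ((ℕ × Fin (D - 2)) →₀ ℕ) × Finset (ℕ ×ₗ Fin (D - 2))

/-- The algebraic Fock space: finite linear combinations of occupation number states, which form an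
orthonormal basis of the Hilbert space. The vacuum is the state `(0, ∅)`. -/
abbrev Fock (D : ℕ) : Type := FockIndex D →₀ ℂ

/-- The Bose annihilation operator `a^j_{k+1}`. -/
def boseAnn (D k : ℕ) (j : Fin (D - 2)) : Module.End ℂ (Fock D) :=
  Finsupp.linearCombination ℂ fun s : FockIndex D =>
    Finsupp.single (s.1 - Finsupp.single (k, j) 1, s.2) ((Real.sqrt (s.1 (k, j)) : ℝ) : ℂ)

/-- The Bose creation operator `(a^j_{k+1})⁺`. -/
def boseCre (D k : ℕ) (j : Fin (D - 2)) : Module.End ℂ (Fock D) :=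
  Finsupp.linearCombination ℂ fun s : FockIndex D =>
    Finsupp.single (s.1 + Finsupp.single (k, j) 1, s.2) ((Real.sqrt (s.1 (k, j) + 1) : ℝ) : ℂ)

/-- The sign `(-1)^{number of occupied Fermi modes before i}`. -/
def fermiSign {D : ℕ} (S : Finset (ℕ ×ₗ Fin (D - 2))) (i : ℕ ×ₗ Fin (D - 2)) : ℂ :=
  (-1) ^ (S.filter (· < i)).card

/-- The Fermi annihilation operator `b^j_m`, `m ≥ 0`. -/
def fermiAnn (D m : ℕ) (j : Fin (D - 2)) : Module.End ℂ (Fock D) :=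
  Finsupp.linearCombination ℂ fun s : FockIndex D =>
    if toLex (m, j) ∈ s.2 then
      Finsupp.single (s.1, s.2.erase (toLex (m, j))) (fermiSign s.2 (toLex (m, j)))
    else 0

/-- The Fermi creation operator `(b^j_m)⁺`, `m ≥ 0`. -/
def fermiCre (D m : ℕ) (j : Fin (D - 2)) : Module.End ℂ (Fock D) :=
  Finsupp.linearCombination ℂ fun s : FockIndex D =>
    if toLex (m, j) ∈ s.2 then 0
    else Finsupp.single (s.1, insert (toLex (m, j)) s.2) (fermiSign s.2 (toLex (m, j)))

/-! ### The state space and the oscillators -/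

/-- The domain `𝒟^{[μ]} ⊗ 𝒟₀` on which all operators act. -/
abbrev Dom (D : ℕ) : Type := TestFn D ⊗[ℂ] Fock D

/-- `A ⊗ 1`. -/
def onMom {D : ℕ} (A : Module.End ℂ (TestFn D)) : Module.End ℂ (Dom D) :=
  LinearMap.rTensor (Fock D) A

/-- `1 ⊗ B`. -/
def onFock {D : ℕ} (B : Module.End ℂ (Fock D)) : Module.End ℂ (Dom D) :=
  LinearMap.lTensor (TestFn D) B

/-- `α^j_m`: it is `√m a^j_m` for `m > 0`, `√(-m) (a^j_{-m})⁺` for `m < 0`, and `p^j` for `m = 0`. -/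
def alpha (D : ℕ) (m : ℤ) (j : Fin (D - 2)) : Module.End ℂ (Dom D) :=
  match m with
  | Int.ofNat 0 => onMom (pTr D j)
  | Int.ofNat (k + 1) => onFock (((Real.sqrt (k + 1) : ℝ) : ℂ) • boseAnn D k j)
  | Int.negSucc k => onFock (((Real.sqrt (k + 1) : ℝ) : ℂ) • boseCre D k j)

/-- `d^j_m`: it is `b^j_m` for `m > 0`, `(b^j_{-m})⁺` for `m < 0`, and `(b^j_0 + (b^j_0)⁺)/√2` for
`m = 0`. -/
def dOsc (D : ℕ) (m : ℤ) (j : Fin (D - 2)) : Module.End ℂ (Dom D) :=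
  match m with
  | Int.ofNat 0 => onFock (((1 / Real.sqrt 2 : ℝ) : ℂ) • (fermiAnn D 0 j + fermiCre D 0 j))
  | Int.ofNat (k + 1) => onFock (fermiAnn D (k + 1) j)
  | Int.negSucc k => onFock (fermiCre D (k + 1) j)

/-- The Wick product `:α^j_m α^k_n:`. -/
def wickA (D : ℕ) (m n : ℤ) (j k : Fin (D - 2)) : Module.End ℂ (Dom D) :=
  if m ≤ n then alpha D m j * alpha D n k else alpha D n k * alpha D m j

/-- The Wick product `:d^j_m d^k_n:`, i.e. `d^j_m d^k_n` minus its vacuum expectation value. The last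
case only matters for `m = n = 0`, where that value is `δ_{jk} / 2`. -/
def wickD (D : ℕ) (m n : ℤ) (j k : Fin (D - 2)) : Module.End ℂ (Dom D) :=
  if m < n then dOsc D m j * dOsc D n k
  else if n < m then -(dOsc D n k * dOsc D m j)
  else (1 / 2 : ℂ) • (dOsc D m j * dOsc D n k - dOsc D n k * dOsc D m j)

/-! ### Infinite sums of operators that are finite on every vector -/

/-- The sum of a family of operators of which only finitely many are non-zero on any given vector. -/
def locSum {ι V : Type*} [AddCommGroup V] [Module ℂ V] (T : ι → Module.End ℂ V)
    (hT : ∀ v, {i | T i v ≠ 0}.Finite) : Module.End ℂ V where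
  toFun v := ∑ᶠ i, T i v
  map_add' v w := by
    simp only [map_add]
    exact finsum_add_distrib (hT v) (hT w)
  map_smul' c v := by
    simp only [map_smul, RingHom.id_apply]
    exact (smul_finsum' c (hT v)).symm

theorem locSum_eq_zero {ι V : Type*} [AddCommGroup V] [Module ℂ V] (T : ι → Module.End ℂ V)
    (hT : ∀ v, {i | T i v ≠ 0}.Finite) (v : V) (h : ∀ i, T i v = 0) : locSum T hT v = 0 := by
  change ∑ᶠ i, T i v = 0
  simp [h]

theorem onFock_vanish {D : ℕ} (B : ℕ → Module.End ℂ (Fock D))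
    (hB : ∀ s : FockIndex D, ∃ N, ∀ m ≥ N, B m (Finsupp.single s 1) = 0) (Ψ : Dom D) :
    ∃ N, ∀ m ≥ N, onFock (B m) Ψ = 0 := by
  induction Ψ using TensorProduct.induction_on with
  | zero => exact ⟨0, fun m _ => map_zero _⟩
  | add x y hx hy =>
    obtain ⟨N, hN⟩ := hx
    obtain ⟨M, hM⟩ := hy
    refine ⟨max N M, fun m hm => ?_⟩
    rw [map_add, hN m (le_trans (le_max_left _ _) hm), hM m (le_trans (le_max_right _ _) hm),
      add_zero]
  | tmul f φ =>
    have key : ∃ N, ∀ m ≥ N, B m φ = 0 := by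
      induction φ using Finsupp.induction_linear with
      | zero => exact ⟨0, fun m _ => map_zero _⟩
      | add x y hx hy =>
        obtain ⟨N, hN⟩ := hx
        obtain ⟨M, hM⟩ := hy
        refine ⟨max N M, fun m hm => ?_⟩
        rw [map_add, hN m (le_trans (le_max_left _ _) hm), hM m (le_trans (le_max_right _ _) hm),
          add_zero]
      | single s c =>
        obtain ⟨N, hN⟩ := hB s
        refine ⟨N, fun m hm => ?_⟩
        have : (Finsupp.single s c : Fock D) = c • Finsupp.single s 1 := by simp
        rw [this, map_smul, hN m hm, smul_zero]
    obtain ⟨N, hN⟩ := key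
    refine ⟨N, fun m hm => ?_⟩
    simp [onFock, hN m hm]

theorem boseAnn_vanish {D : ℕ} (j : Fin (D - 2)) (s : FockIndex D) :
    ∃ N, ∀ k ≥ N, boseAnn D k j (Finsupp.single s 1) = 0 := by
  refine ⟨s.1.support.sup Prod.fst + 1, fun k hk => ?_⟩
  have h0 : s.1 (k, j) = 0 := by
    by_contra h
    have h1 : (k, j) ∈ s.1.support := Finsupp.mem_support_iff.2 h
    have h2 := Finset.le_sup (f := Prod.fst) h1
    simp only at h2
    omega
  simp [boseAnn, h0]

theorem fermiAnn_vanish {D : ℕ} (j : Fin (D - 2)) (s : FockIndex D) :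
    ∃ N, ∀ m ≥ N, fermiAnn D m j (Finsupp.single s 1) = 0 := by
  refine ⟨s.2.sup (fun i => (ofLex i).1) + 1, fun m hm => ?_⟩
  have h0 : toLex (m, j) ∉ s.2 := by
    intro h1
    have h2 := Finset.le_sup (f := fun i : ℕ ×ₗ Fin (D - 2) => (ofLex i).1) h1
    simp only [ofLex_toLex] at h2
    omega
  simp [fermiAnn, h0]

/-- `Ψ` is annihilated by all `α^j_m`, `d^j_m` with `m ≥ N`. -/
def AnnFrom {D : ℕ} (N : ℕ) (Ψ : Dom D) : Prop :=
  ∀ m : ℤ, (N : ℤ) ≤ m → ∀ j, alpha D m j Ψ = 0 ∧ dOsc D m j Ψ = 0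

theorem exists_annFrom {D : ℕ} (Ψ : Dom D) : ∃ N, AnnFrom N Ψ := by
  have hA : ∀ j : Fin (D - 2), ∃ N, ∀ k ≥ N, onFock (boseAnn D k j) Ψ = 0 := fun j =>
    onFock_vanish _ (boseAnn_vanish j) Ψ
  have hF : ∀ j : Fin (D - 2), ∃ N, ∀ k ≥ N, onFock (fermiAnn D k j) Ψ = 0 := fun j =>
    onFock_vanish _ (fermiAnn_vanish j) Ψ
  choose NA hNA using hA
  choose NF hNF using hF
  refine ⟨Finset.univ.sup NA + Finset.univ.sup NF + 1, fun m hm j => ?_⟩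
  have h1 := Finset.le_sup (f := NA) (Finset.mem_univ j)
  have h2 := Finset.le_sup (f := NF) (Finset.mem_univ j)
  match m with
  | Int.ofNat 0 => simp only [Int.ofNat_eq_natCast] at hm; omega
  | Int.ofNat (k + 1) =>
    simp only [Int.ofNat_eq_natCast] at hm
    constructor
    · have h3 : onFock (boseAnn D k j) Ψ = 0 := hNA j k (by omega)
      simp only [alpha, onFock, LinearMap.lTensor_smul, LinearMap.smul_apply]
      simp only [onFock] at h3
      rw [h3, smul_zero]
    · exact hNF j (k + 1) (by omega)
  | Int.negSucc k => omega

theorem wickA_eq_zero {D : ℕ} {N : ℕ} {Ψ : Dom D} (h : AnnFrom N Ψ) {m n : ℤ}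
    (hmn : (N : ℤ) ≤ m ∨ (N : ℤ) ≤ n) (j k : Fin (D - 2)) : wickA D m n j k Ψ = 0 := by
  unfold wickA
  split_ifs with h1
  · simp [(h n (by omega) k).1]
  · simp [(h m (by omega) j).1]

theorem wickD_eq_zero {D : ℕ} {N : ℕ} {Ψ : Dom D} (h : AnnFrom N Ψ) {m n : ℤ}
    (hmn : (N : ℤ) ≤ m ∨ (N : ℤ) ≤ n) (j k : Fin (D - 2)) : wickD D m n j k Ψ = 0 := by
  unfold wickD
  split_ifs with h1 h2
  · simp [(h n (by omega) k).2]
  · simp [(h m (by omega) j).2]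
  · simp [(h n (by omega) k).2, (h m (by omega) j).2]

/-! ### Virasoro and Kac-Moody operators -/

/-- The summand `∑_j :α^j_{m-n} α^j_n:`. -/
def virATerm (D : ℕ) (m n : ℤ) : Module.End ℂ (Dom D) := ∑ j, wickA D (m - n) n j j

/-- The summand `n ∑_j :d^j_{-n} d^j_{m+n}:`. -/
def virDTerm (D : ℕ) (m n : ℤ) : Module.End ℂ (Dom D) :=
  (n : ℂ) • ∑ j, wickD D (-n) (m + n) j j

/-- The summand `(E_{jk})_{pq} :d^p_{-n} d^q_{m+n}:`, where `E_{jk}` is the standard generator of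
`so(D-2)`, `(E_{jk})_{pq} = δ_{jp} δ_{kq} - δ_{jq} δ_{kp}`. -/
def kacTerm (D : ℕ) (m : ℤ) (j k : Fin (D - 2)) (n : ℤ) : Module.End ℂ (Dom D) :=
  wickD D (-n) (m + n) j k - wickD D (-n) (m + n) k j

theorem virATerm_eq_zero {D N : ℕ} {Ψ : Dom D} (h : AnnFrom N Ψ) {m n : ℤ}
    (hmn : (N : ℤ) ≤ m - n ∨ (N : ℤ) ≤ n) : virATerm D m n Ψ = 0 := by
  simp [virATerm, LinearMap.sum_apply, wickA_eq_zero h hmn]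

theorem virDTerm_eq_zero {D N : ℕ} {Ψ : Dom D} (h : AnnFrom N Ψ) {m n : ℤ}
    (hmn : (N : ℤ) ≤ -n ∨ (N : ℤ) ≤ m + n) : virDTerm D m n Ψ = 0 := by
  simp [virDTerm, LinearMap.sum_apply, wickD_eq_zero h hmn]

theorem kacTerm_eq_zero {D N : ℕ} {Ψ : Dom D} (h : AnnFrom N Ψ) {m n : ℤ}
    (hmn : (N : ℤ) ≤ -n ∨ (N : ℤ) ≤ m + n) (j k : Fin (D - 2)) : kacTerm D m j k n Ψ = 0 := by
  simp [kacTerm, wickD_eq_zero h hmn]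

theorem virATerm_finite (D : ℕ) (m : ℤ) (Ψ : Dom D) : {n | virATerm D m n Ψ ≠ 0}.Finite := by
  obtain ⟨N, h⟩ := exists_annFrom Ψ
  refine (Set.finite_Icc (m - N) N).subset fun n hn => ?_
  by_contra hc
  simp only [Set.mem_Icc, not_and_or, not_le] at hc
  exact hn (virATerm_eq_zero h (by omega))

theorem virDTerm_finite (D : ℕ) (m : ℤ) (Ψ : Dom D) : {n | virDTerm D m n Ψ ≠ 0}.Finite := by
  obtain ⟨N, h⟩ := exists_annFrom Ψ
  refine (Set.finite_Icc (-N : ℤ) (N - m)).subset fun n hn => ?_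
  by_contra hc
  simp only [Set.mem_Icc, not_and_or, not_le] at hc
  exact hn (virDTerm_eq_zero h (by omega))

theorem kacTerm_finite (D : ℕ) (m : ℤ) (j k : Fin (D - 2)) (Ψ : Dom D) :
    {n | kacTerm D m j k n Ψ ≠ 0}.Finite := by
  obtain ⟨N, h⟩ := exists_annFrom Ψ
  refine (Set.finite_Icc (-N : ℤ) (N - m)).subset fun n hn => ?_
  by_contra hc
  simp only [Set.mem_Icc, not_and_or, not_le] at hc
  exact hn (kacTerm_eq_zero h (by omega) j k)

/-- `L_m = ½ ∑_n :α^j_{m-n} α^j_n: + ½ ∑_n n :d^j_{-n} d^j_{m+n}: + (D/16 - a) δ_{m,0}`. -/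
def virasoro (D : ℕ) (a : ℝ) (m : ℤ) : Module.End ℂ (Dom D) :=
  (1 / 2 : ℂ) • locSum (virATerm D m) (virATerm_finite D m)
    + (1 / 2 : ℂ) • locSum (virDTerm D m) (virDTerm_finite D m)
    + if m = 0 then (((D : ℝ) / 16 - a : ℝ) : ℂ) • (1 : Module.End ℂ (Dom D)) else 0

/-- `K^{jk}_m = ½ (E_{jk})_{pq} ∑_n :d^p_{-n} d^q_{m+n}:`. -/
def kac (D : ℕ) (m : ℤ) (j k : Fin (D - 2)) : Module.End ℂ (Dom D) :=
  (1 / 2 : ℂ) • locSum (kacTerm D m j k) (kacTerm_finite D m j k)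

theorem virasoro_eq_zero {D N : ℕ} {Ψ : Dom D} (h : AnnFrom N Ψ) (a : ℝ) {m : ℤ}
    (h0 : 0 < m) (hm : 2 * (N : ℤ) ≤ m) : virasoro D a m Ψ = 0 := by
  have h1 := locSum_eq_zero (virATerm D m) (virATerm_finite D m) Ψ
    fun n => virATerm_eq_zero h (by omega)
  have h2 := locSum_eq_zero (virDTerm D m) (virDTerm_finite D m) Ψ
    fun n => virDTerm_eq_zero h (by omega)
  simp [virasoro, h1, h2, h0.ne']

theorem kac_eq_zero {D N : ℕ} {Ψ : Dom D} (h : AnnFrom N Ψ) {m : ℤ} (hm : 2 * (N : ℤ) ≤ m)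
    (j k : Fin (D - 2)) : kac D m j k Ψ = 0 := by
  have h1 := locSum_eq_zero (kacTerm D m j k) (kacTerm_finite D m j k) Ψ
    fun n => kacTerm_eq_zero h (by omega) j k
  simp [kac, h1]

/-! ### The operators `E^j`, `F^j`, `K^j`, the rotations and the Hamiltonian

In these sums the natural number `r` stands for `m = r + 1 > 0`. -/

/-- The summand `(1/m) (α^j_{-m} L_m - L_{-m} α^j_m)`, `m = r + 1`. -/
def eTerm (D : ℕ) (a : ℝ) (j : Fin (D - 2)) (r : ℕ) : Module.End ℂ (Dom D) :=
  (1 / ((r : ℂ) + 1)) • (alpha D (-((r : ℤ) + 1)) j * virasoro D a ((r : ℤ) + 1)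
    - virasoro D a (-((r : ℤ) + 1)) * alpha D ((r : ℤ) + 1) j)

/-- The summand `α^l_{-m} K^{jl}_m + K^{jl}_{-m} α^l_m`, `m = r + 1`. -/
def fTerm (D : ℕ) (j : Fin (D - 2)) (r : ℕ) : Module.End ℂ (Dom D) :=
  ∑ l, (alpha D (-((r : ℤ) + 1)) l * kac D ((r : ℤ) + 1) j l
    + kac D (-((r : ℤ) + 1)) j l * alpha D ((r : ℤ) + 1) l)

/-- The summand `(1/m) (α^j_{-m} α^k_m - α^k_{-m} α^j_m)`, `m = r + 1`. -/
def rotTerm (D : ℕ) (j k : Fin (D - 2)) (r : ℕ) : Module.End ℂ (Dom D) :=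
  (1 / ((r : ℂ) + 1)) • (alpha D (-((r : ℤ) + 1)) j * alpha D ((r : ℤ) + 1) k
    - alpha D (-((r : ℤ) + 1)) k * alpha D ((r : ℤ) + 1) j)

/-- The summand `α^j_{-m} α^j_m + m d^j_{-m} d^j_m`, `m = r + 1`. -/
def hamTerm (D : ℕ) (r : ℕ) : Module.End ℂ (Dom D) :=
  ∑ j, (alpha D (-((r : ℤ) + 1)) j * alpha D ((r : ℤ) + 1) j
    + ((r : ℂ) + 1) • (dOsc D (-((r : ℤ) + 1)) j * dOsc D ((r : ℤ) + 1) j))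

theorem eTerm_finite (D : ℕ) (a : ℝ) (j : Fin (D - 2)) (Ψ : Dom D) :
    {r | eTerm D a j r Ψ ≠ 0}.Finite := by
  obtain ⟨N, h⟩ := exists_annFrom Ψ
  refine (Set.finite_Iio (2 * N)).subset fun r hr => ?_
  by_contra hc
  simp only [Set.mem_Iio, not_lt] at hc
  apply hr
  simp [eTerm, virasoro_eq_zero h a (m := (r : ℤ) + 1) (by omega) (by omega),
    (h ((r : ℤ) + 1) (by omega) j).1]

theorem fTerm_finite (D : ℕ) (j : Fin (D - 2)) (Ψ : Dom D) :
    {r | fTerm D j r Ψ ≠ 0}.Finite := by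
  obtain ⟨N, h⟩ := exists_annFrom Ψ
  refine (Set.finite_Iio (2 * N)).subset fun r hr => ?_
  by_contra hc
  simp only [Set.mem_Iio, not_lt] at hc
  apply hr
  simp [fTerm, LinearMap.sum_apply, kac_eq_zero h (m := (r : ℤ) + 1) (by omega),
    fun l => (h ((r : ℤ) + 1) (by omega) l).1]

theorem rotTerm_finite (D : ℕ) (j k : Fin (D - 2)) (Ψ : Dom D) :
    {r | rotTerm D j k r Ψ ≠ 0}.Finite := by
  obtain ⟨N, h⟩ := exists_annFrom Ψ
  refine (Set.finite_Iio N).subset fun r hr => ?_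
  by_contra hc
  simp only [Set.mem_Iio, not_lt] at hc
  apply hr
  simp [rotTerm, fun l => (h ((r : ℤ) + 1) (by omega) l).1]

theorem hamTerm_finite (D : ℕ) (Ψ : Dom D) : {r | hamTerm D r Ψ ≠ 0}.Finite := by
  obtain ⟨N, h⟩ := exists_annFrom Ψ
  refine (Set.finite_Iio N).subset fun r hr => ?_
  by_contra hc
  simp only [Set.mem_Iio, not_lt] at hc
  apply hr
  simp [hamTerm, LinearMap.sum_apply, fun l => (h ((r : ℤ) + 1) (by omega) l)]

/-- `E^j = -i ∑_{m>0} (1/m) (α^j_{-m} L_m - L_{-m} α^j_m)`. -/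
def opE (D : ℕ) (a : ℝ) (j : Fin (D - 2)) : Module.End ℂ (Dom D) :=
  (-Complex.I) • locSum (eTerm D a j) (eTerm_finite D a j)

/-- `F^j = -i ∑_{m>0} (α^l_{-m} K^{jl}_m + K^{jl}_{-m} α^l_m) - i K^{jl}_0 α^l_0`. -/
def opF (D : ℕ) (j : Fin (D - 2)) : Module.End ℂ (Dom D) :=
  (-Complex.I) • locSum (fTerm D j) (fTerm_finite D j)
    + (-Complex.I) • ∑ l, kac D 0 j l * alpha D 0 l

/-- `K^j = E^j + F^j`. -/
def opK (D : ℕ) (a : ℝ) (j : Fin (D - 2)) : Module.End ℂ (Dom D) := opE D a j + opF D j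

/-- The rotation generators `J^{(R)jk} = J^{(α)jk} + J^{(d)jk}` of the Fock space, where
`J^{(α)jk} = -i ∑_{m>0} (1/m) (α^j_{-m} α^k_m - α^k_{-m} α^j_m)` and `J^{(d)jk} = -i K^{jk}_0`, that is
`J^{(d)jk} = -i ∑_{m>0} (d^j_{-m} d^k_m - d^k_{-m} d^j_m) - (i/2) (d^j_0 d^k_0 - d^k_0 d^j_0)`. -/
def rotR (D : ℕ) (j k : Fin (D - 2)) : Module.End ℂ (Dom D) :=
  (-Complex.I) • locSum (rotTerm D j k) (rotTerm_finite D j k) + (-Complex.I) • kac D 0 j k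

/-- The Hamiltonian `H = ∑_{m>0} α^j_{-m} α^j_m + ∑_{m>0} m d^j_{-m} d^j_m`. -/
def ham (D : ℕ) : Module.End ℂ (Dom D) := locSum (hamTerm D) (hamTerm_finite D)

/-! ### The Poincaré algebra in light-cone coordinates -/

/-- A family of operators indexed like the light-cone basis
`P^±, P^j, J^{+-}, J^{j±}, J^{jk}` of the Poincaré algebra in `D` dimensions. The sign is an element
of `ℤˣ = {1, -1}`. -/
structure LightConeFamily (D : ℕ) (V : Type*) [AddCommGroup V] [Module ℂ V] where
  Ppm : ℤˣ → Module.End ℂ V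
  P : Fin (D - 2) → Module.End ℂ V
  J : Fin (D - 2) → Fin (D - 2) → Module.End ℂ V
  Jpm : Fin (D - 2) → ℤˣ → Module.End ℂ V
  JPM : Module.End ℂ V

/-- The Kronecker symbol. -/
def kron {n : ℕ} (j k : Fin n) : ℂ := if j = k then 1 else 0

/-- The operators leave the subspace `S` invariant. -/
structure LightConeFamily.Preserves {D : ℕ} {V : Type*} [AddCommGroup V] [Module ℂ V]
    (G : LightConeFamily D V) (S : Submodule ℂ V) : Prop where
  Ppm : ∀ e, ∀ Ψ ∈ S, G.Ppm e Ψ ∈ S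
  P : ∀ j, ∀ Ψ ∈ S, G.P j Ψ ∈ S
  J : ∀ j k, ∀ Ψ ∈ S, G.J j k Ψ ∈ S
  Jpm : ∀ j e, ∀ Ψ ∈ S, G.Jpm j e Ψ ∈ S
  JPM : ∀ Ψ ∈ S, G.JPM Ψ ∈ S

/-- On every vector of `S` the operators satisfy the Lie brackets of the Poincaré algebra in
light-cone coordinates. -/
structure LightConeFamily.BracketsOn {D : ℕ} {V : Type*} [AddCommGroup V] [Module ℂ V]
    (G : LightConeFamily D V) (S : Submodule ℂ V) : Prop where
  J_antisymm : ∀ j k, ∀ Ψ ∈ S, G.J j k Ψ = -G.J k j Ψ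
  Ppm_Ppm : ∀ e f, ∀ Ψ ∈ S, ⁅G.Ppm e, G.Ppm f⁆ Ψ = 0
  Ppm_P : ∀ e j, ∀ Ψ ∈ S, ⁅G.Ppm e, G.P j⁆ Ψ = 0
  P_P : ∀ j k, ∀ Ψ ∈ S, ⁅G.P j, G.P k⁆ Ψ = 0
  Ppm_J : ∀ e j k, ∀ Ψ ∈ S, ⁅G.Ppm e, G.J j k⁆ Ψ = 0
  P_JPM : ∀ j, ∀ Ψ ∈ S, ⁅G.P j, G.JPM⁆ Ψ = 0
  Ppm_JPM : ∀ e : ℤˣ, ∀ Ψ ∈ S, ⁅G.Ppm e, G.JPM⁆ Ψ = (Complex.I * ((e : ℤ) : ℂ)) • G.Ppm e Ψ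
  Ppm_Jpm : ∀ (e : ℤˣ) (j : Fin (D - 2)) (f : ℤˣ), ∀ Ψ ∈ S, ⁅G.Ppm e, G.Jpm j f⁆ Ψ =
    (-(Complex.I / 2) * (1 - ((e : ℤ) : ℂ) * ((f : ℤ) : ℂ))) • G.P j Ψ
  P_J : ∀ j k l, ∀ Ψ ∈ S, ⁅G.P j, G.J k l⁆ Ψ =
    (-Complex.I * kron j k) • G.P l Ψ + (Complex.I * kron j l) • G.P k Ψ
  P_Jpm : ∀ j k e, ∀ Ψ ∈ S, ⁅G.P j, G.Jpm k e⁆ Ψ = (-Complex.I * kron j k) • G.Ppm e Ψ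
  JPM_J : ∀ j k, ∀ Ψ ∈ S, ⁅G.JPM, G.J j k⁆ Ψ = 0
  JPM_Jpm : ∀ (j : Fin (D - 2)) (e : ℤˣ), ∀ Ψ ∈ S, ⁅G.JPM, G.Jpm j e⁆ Ψ =
    (-Complex.I * ((e : ℤ) : ℂ)) • G.Jpm j e Ψ
  Jpm_Jpm : ∀ (j : Fin (D - 2)) (e : ℤˣ) (k : Fin (D - 2)) (f : ℤˣ), ∀ Ψ ∈ S,
    ⁅G.Jpm j e, G.Jpm k f⁆ Ψ =
      (Complex.I / 2 * (-1 + ((e : ℤ) : ℂ) * ((f : ℤ) : ℂ))) • G.J j k Ψ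
      + (Complex.I / 2 * (((f : ℤ) : ℂ) - ((e : ℤ) : ℂ)) * kron j k) • G.JPM Ψ
  Jpm_J : ∀ j e k l, ∀ Ψ ∈ S, ⁅G.Jpm j e, G.J k l⁆ Ψ =
    (-Complex.I * kron j k) • G.Jpm l e Ψ + (Complex.I * kron j l) • G.Jpm k e Ψ
  J_J : ∀ k l p q, ∀ Ψ ∈ S, ⁅G.J k l, G.J p q⁆ Ψ =
    (-Complex.I * kron l p) • G.J k q Ψ + (Complex.I * kron k p) • G.J l q Ψ
    + (Complex.I * kron l q) • G.J k p Ψ - (Complex.I * kron k q) • G.J l p Ψ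

/-- The operators restrict to a representation of the Poincaré algebra on `S`. -/
def LightConeFamily.RepresentsOn {D : ℕ} {V : Type*} [AddCommGroup V] [Module ℂ V]
    (G : LightConeFamily D V) (S : Submodule ℂ V) : Prop :=
  G.Preserves S ∧ G.BracketsOn S

/-- The light-cone generators of the Ramond system of mass `μ`. -/
def ramond (D : ℕ) (μ a : ℝ) : LightConeFamily D (Dom D) where
  Ppm e := if e = 1 then onMom (pPlus D) else onMom (pMinus D μ)
  P j := onMom (pTr D j)
  J k l := onMom (orbTr D k l) + rotR D k l
  Jpm k e := if e = 1 then onMom (orbPlus D k)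
    else onMom (orbMinus D μ k) + onMom (pPlusInv D) * opK D a k
  JPM := onMom (orbPM D)

/-! ### The Hilbert space and the physical states -/

/-- The Hilbert space `𝓗^{[μ]} ⊗ 𝓕^{(R)}`: square summable families of elements of
`L²(ℝ₊ × ℝ^(D-2), dp⁺ dp̃ / (2 p⁺))` indexed by the orthonormal occupation number basis of the Fock
space. -/
abbrev HilbertR (D : ℕ) : Type := lp (fun _ : FockIndex D => OneParticle D) 2

/-- The inclusion of the domain `𝒟^{[μ]} ⊗ 𝒟₀` into the Hilbert space. -/
def toHilbert (D : ℕ) : Dom D →ₗ[ℂ] HilbertR D :=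
  TensorProduct.lift (LinearMap.flip (Finsupp.lsum ℂ fun s : FockIndex D =>
    LinearMap.toSpanSingleton ℂ (TestFn D →ₗ[ℂ] HilbertR D)
      ((lp.lsingle (𝕜 := ℂ) (E := fun _ : FockIndex D => OneParticle D) 2 s).comp
        (TestFn.toL2 D))))

/-- The eigenspace of the Hamiltonian in the Hilbert space for the real number `ℓ`. The Hamiltonian is
essentially self-adjoint on the domain, so its closure is its adjoint, and `H Ψ = ℓ Ψ` means that
`⟨H Φ, Ψ⟩ = ℓ ⟨Φ, Ψ⟩` for all `Φ` in the domain. -/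
def energySpace (D : ℕ) (ℓ : ℝ) : Submodule ℂ (HilbertR D) where
  carrier := {Ψ | ∀ Φ : Dom D,
    inner ℂ (toHilbert D (ham D Φ)) Ψ = (ℓ : ℂ) * inner ℂ (toHilbert D Φ) Ψ}
  zero_mem' := fun Φ => by simp
  add_mem' := fun {x y} hx hy Φ => by
    rw [inner_add_right, inner_add_right, hx Φ, hy Φ, mul_add]
  smul_mem' := fun c x hx Φ => by
    rw [inner_smul_right, inner_smul_right, hx Φ]; ring

/-- The physical Hilbert space `{Ψ | H Ψ = (μ²/2) Ψ}`. -/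
def physSpace (D : ℕ) (μ : ℝ) : Submodule ℂ (HilbertR D) := energySpace D (μ ^ 2 / 2)

/-- The states of the domain `𝒟^{[μ]} ⊗ 𝒟₀` that lie in a given subspace of the Hilbert space. -/
def statesIn {D : ℕ} (S : Submodule ℂ (HilbertR D)) : Submodule ℂ (Dom D) :=
  S.comap (toHilbert D)

end RamondString

end

noncomputable section

namespace RamondString

/-! ### Canonical (anti)commutation relations on the algebraic Fock space -/

/-! Write K^j = -i Y^j and J^{(R)jk} = -i R^{jk} (`opY`, `opR`). Every bracket except [J^{j-},
J^{k-}] holds on the whole domain, in every dimension and for every mass (`bracketsOn_iff`): it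
follows from the Heisenberg relations on momentum space, from Y being a vector under rotations
(`gcomm_opT_opY`) and from [∂_j, Y^k] = R^{kj} (`gcomm_dTr_opY`). For j ≠ k the exceptional bracket
is, up to a factor, (1/p⁺)² (X^{jk} + (μ² - 2H) R^{jk}) with the defect X^{jk} = [Y^j, Y^k] + p^j
Y^k - p^k Y^j + 2 (H + p²/2) R^{jk} (`opX`, `gcomm_opC_opC`). So the algebra is represented on {H =
ℓ} exactly when X^{jk} = (2ℓ - μ²) R^{jk} there (`representsOn_energySpace_iff`). The constant a
plays no role, since E^j contains L_m for m ≠ 0 only.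

The defect is never computed by multiplying out the infinite sums. The vacuum is cyclic for the
creation operators and the Fermi zero modes, so an operator is determined by its action on ground
states and its graded commutators with the oscillators (`eq_zero_of_gcomm`, `eq_zero_of_dcomm`).
Since Y is cubic, its double commutator with two oscillators is linear in the oscillators
(`dcomm_opY`). Hence triple commutators of X are linear as well, and they vanish in every dimension
by rational identities between the coefficients (`tcomm_opX`).

A double commutator of X with φ_p and φ_q therefore graded-commutes with all oscillators other than
the momentum α_0, maps ground states to ground states and lowers the energy by p + q. On ground
states it vanishes unless p + q = 0. For opposite nonzero modes ∓m the only hard term is [Y^j,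
φ_m][Y^k, φ_{-m}] g. The inner vector has energy m, so it equals 1/m times H applied to it, and
writing out H turns the term into finitely many products of two double commutators
(`gcomm_opY_mul_ground`). The outcome is proportional to D - 10, with a factor m³ for two Bose and
m² for two Fermi oscillators, and zero in the mixed case (`dcomm_opX_bose`, `dcomm_opX_fermi`,
`dcomm_opX_mixed`). Clifford algebra of the zero modes shows that X kills ground states
(`opX_ground`). Hence X = 0 for D = 10, which gives sufficiency.

For necessity, a ground state g satisfies X g = 0 and R g ≠ 0, so μ > 0 excludes N = 0 and the whole
domain. For N = M + 1 the condition is tested on the states α_{-N} g: one matrix element forces 2N =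
μ² and another then forces D = 10 (`dimension_and_mass`). The eigenspaces defined weakly in the
Hilbert space are reduced to algebraic ones because H is diagonal in the occupation number basis
(`mem_statesIn_energySpace`). -/

@[simp] theorem boseAnn_single (D k : ℕ) (j : Fin (D - 2)) (s : FockIndex D) (c : ℂ) :
    boseAnn D k j (Finsupp.single s c) =
      Finsupp.single (s.1 - Finsupp.single (k, j) 1, s.2)
        (c * ((Real.sqrt (s.1 (k, j)) : ℝ) : ℂ)) := by
  simp [boseAnn]

@[simp] theorem boseCre_single (D k : ℕ) (j : Fin (D - 2)) (s : FockIndex D) (c : ℂ) :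
    boseCre D k j (Finsupp.single s c) =
      Finsupp.single (s.1 + Finsupp.single (k, j) 1, s.2)
        (c * ((Real.sqrt (s.1 (k, j) + 1) : ℝ) : ℂ)) := by
  simp [boseCre]

@[simp] theorem fermiAnn_single (D k : ℕ) (j : Fin (D - 2)) (s : FockIndex D) (c : ℂ) :
    fermiAnn D k j (Finsupp.single s c) =
      if toLex (k, j) ∈ s.2 then
        Finsupp.single (s.1, s.2.erase (toLex (k, j))) (c * fermiSign s.2 (toLex (k, j)))
      else 0 := by
  simp [fermiAnn]

@[simp] theorem fermiCre_single (D k : ℕ) (j : Fin (D - 2)) (s : FockIndex D) (c : ℂ) :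
    fermiCre D k j (Finsupp.single s c) =
      if toLex (k, j) ∈ s.2 then 0
      else Finsupp.single (s.1, insert (toLex (k, j)) s.2)
        (c * fermiSign s.2 (toLex (k, j))) := by
  simp [fermiCre]

theorem fock_hom_ext {D : ℕ} {A B : Module.End ℂ (Fock D)}
    (h : ∀ s, A (Finsupp.single s 1) = B (Finsupp.single s 1)) : A = B := by
  apply Finsupp.lhom_ext'
  intro s
  apply LinearMap.ext_ring
  exact h s

theorem boseAnn_boseCre (D : ℕ) (k l : ℕ) (i j : Fin (D - 2)) :
    boseAnn D k i * boseCre D l j - boseCre D l j * boseAnn D k i =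
      if (k, i) = (l, j) then 1 else 0 := by
  apply fock_hom_ext
  rintro ⟨n, S⟩
  simp only [LinearMap.sub_apply, Module.End.mul_apply, boseAnn_single, boseCre_single, one_mul]
  split_ifs with h
  · rw [h]
    have h1 : n + Finsupp.single (l, j) 1 - Finsupp.single (l, j) 1 = n := by simp
    rw [h1]
    -- The subtraction of occupation numbers is truncated at 0. In an empty mode this is harmless
    -- because the coefficient √0 kills the term.
    rcases Nat.eq_zero_or_pos (n (l, j)) with h0 | h0
    · simp [h0]
    · have h2 : n - Finsupp.single (l, j) 1 + Finsupp.single (l, j) 1 = n := by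
        apply tsub_add_cancel_of_le
        rw [Finsupp.single_le_iff]; exact h0
      rw [h2, ← Finsupp.single_sub]
      congr 1
      simp only [Finsupp.coe_add, Pi.add_apply, Finsupp.single_eq_same, Finsupp.coe_tsub,
        Pi.sub_apply]
      rw [← Complex.ofReal_mul, ← Complex.ofReal_mul, ← Complex.ofReal_sub]
      rw [Nat.cast_add, Nat.cast_sub h0, Nat.cast_one, sub_add_cancel,
        Real.mul_self_sqrt (by positivity), Real.mul_self_sqrt (by positivity)]
      simp
  · have h1 : n + Finsupp.single (l, j) 1 - Finsupp.single (k, i) 1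
        = n - Finsupp.single (k, i) 1 + Finsupp.single (l, j) 1 := by
      ext x
      simp only [Finsupp.coe_add, Finsupp.coe_tsub, Pi.add_apply, Pi.sub_apply,
        Finsupp.single_apply]
      split_ifs <;> first | omega | (exfalso; simp_all)
    have h' : ¬ (l, j) = (k, i) := fun e => h e.symm
    rw [h1, ← Finsupp.single_sub]
    simp only [Finsupp.coe_add, Pi.add_apply, Finsupp.single_apply, Finsupp.coe_tsub,
        Pi.sub_apply, h, h', if_false]
    simp [mul_comm]

theorem boseAnn_comm (D : ℕ) (k l : ℕ) (i j : Fin (D - 2)) :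
    boseAnn D k i * boseAnn D l j = boseAnn D l j * boseAnn D k i := by
  by_cases h : (k, i) = (l, j)
  · simp only [Prod.mk.injEq] at h
    rw [h.1, h.2]
  have h' : ¬ (l, j) = (k, i) := fun e => h e.symm
  apply fock_hom_ext
  rintro ⟨n, S⟩
  simp only [Module.End.mul_apply, boseAnn_single]
  simp [h, h', mul_comm, tsub_right_comm]

theorem boseCre_comm (D : ℕ) (k l : ℕ) (i j : Fin (D - 2)) :
    boseCre D k i * boseCre D l j = boseCre D l j * boseCre D k i := by
  by_cases h : (k, i) = (l, j)
  · simp only [Prod.mk.injEq] at h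
    rw [h.1, h.2]
  have h' : ¬ (l, j) = (k, i) := fun e => h e.symm
  apply fock_hom_ext
  rintro ⟨n, S⟩
  simp only [Module.End.mul_apply, boseCre_single]
  simp [h, h', mul_comm, add_right_comm]

theorem fermiSign_insert {D : ℕ} {S : Finset (ℕ ×ₗ Fin (D - 2))} {x y : ℕ ×ₗ Fin (D - 2)}
    (h : x ∉ S) : fermiSign (insert x S) y = (if x < y then -1 else 1) * fermiSign S y := by
  unfold fermiSign
  rw [Finset.filter_insert]
  split_ifs with hxy
  · rw [Finset.card_insert_of_notMem (by simp [h]), pow_succ]; ring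
  · simp

theorem fermiSign_erase {D : ℕ} {S : Finset (ℕ ×ₗ Fin (D - 2))} {x y : ℕ ×ₗ Fin (D - 2)}
    (h : x ∈ S) : fermiSign (S.erase x) y = (if x < y then -1 else 1) * fermiSign S y := by
  conv_rhs => rw [← Finset.insert_erase h, fermiSign_insert (Finset.notMem_erase x S)]
  split_ifs <;> simp

theorem fermiSign_mul_self {D : ℕ} (S : Finset (ℕ ×ₗ Fin (D - 2))) (x : ℕ ×ₗ Fin (D - 2)) :
    fermiSign S x * fermiSign S x = 1 := by
  unfold fermiSign
  rw [← mul_pow]; simp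

/-- Of two distinct modes exactly one precedes the other, so exactly one of the two orders picks up
an additional minus sign. This is the source of all anticommutation relations between different
modes. -/
theorem fermiSign_swap {D : ℕ} (S T : Finset (ℕ ×ₗ Fin (D - 2))) {x y : ℕ ×ₗ Fin (D - 2)}
    (h : x ≠ y) : fermiSign S y * ((if y < x then -1 else 1) * fermiSign T x) +
      fermiSign T x * ((if x < y then -1 else 1) * fermiSign S y) = 0 := by
  rcases lt_or_gt_of_ne h with h1 | h1
  · simp [h1, not_lt.2 h1.le, mul_comm]
  · simp [h1, not_lt.2 h1.le, mul_comm]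

theorem fermiAnn_fermiCre (D : ℕ) (k l : ℕ) (i j : Fin (D - 2)) :
    fermiAnn D k i * fermiCre D l j + fermiCre D l j * fermiAnn D k i =
      if (k, i) = (l, j) then 1 else 0 := by
  apply fock_hom_ext
  rintro ⟨n, S⟩
  by_cases h : (k, i) = (l, j)
  · simp only [Prod.mk.injEq] at h
    obtain ⟨rfl, rfl⟩ := h
    by_cases h1 : toLex (k, i) ∈ S
    · simp [h1, Finset.insert_erase h1, fermiSign_erase h1, fermiSign_mul_self]
    · simp [h1, Finset.erase_insert h1, fermiSign_insert h1, fermiSign_mul_self]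
  · have h' : toLex (k, i) ≠ toLex (l, j) := h
    rw [if_neg h]
    by_cases h1 : toLex (k, i) ∈ S <;> by_cases h2 : toLex (l, j) ∈ S
    · simp [h1, h2, h'.symm]
    · simp only [LinearMap.add_apply, Module.End.mul_apply, fermiAnn_single, fermiCre_single, h1,
        h2, if_true, if_false, Finset.mem_insert, or_true, Finset.mem_erase, and_false,
        Finset.erase_insert_of_ne h'.symm, ← Finsupp.single_add, one_mul, fermiSign_insert h2,
        fermiSign_erase h1, fermiSign_swap _ _ h', Finsupp.single_zero, LinearMap.zero_apply]
    · simp [h1, h2]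
    · simp [h1, h2, h']

theorem fermiAnn_anticomm (D : ℕ) (k l : ℕ) (i j : Fin (D - 2)) :
    fermiAnn D k i * fermiAnn D l j + fermiAnn D l j * fermiAnn D k i = 0 := by
  apply fock_hom_ext
  rintro ⟨n, S⟩
  by_cases h : (k, i) = (l, j)
  · simp only [Prod.mk.injEq] at h
    obtain ⟨rfl, rfl⟩ := h
    by_cases h1 : toLex (k, i) ∈ S <;> simp [h1]
  · have h' : toLex (k, i) ≠ toLex (l, j) := h
    by_cases h1 : toLex (k, i) ∈ S <;> by_cases h2 : toLex (l, j) ∈ S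
    · simp only [LinearMap.add_apply, Module.End.mul_apply, fermiAnn_single, h1,
        h2, if_true, ne_eq, h', h'.symm, not_false_eq_true, true_and, Finset.mem_erase,
        Finset.erase_right_comm (a := toLex (k, i)), ← Finsupp.single_add, one_mul,
        fermiSign_erase h2,
        fermiSign_erase h1, fermiSign_swap _ _ h', Finsupp.single_zero, LinearMap.zero_apply]
    · simp [h1, h2]
    · simp [h1, h2]
    · simp [h1, h2]

theorem fermiCre_anticomm (D : ℕ) (k l : ℕ) (i j : Fin (D - 2)) :
    fermiCre D k i * fermiCre D l j + fermiCre D l j * fermiCre D k i = 0 := by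
  apply fock_hom_ext
  rintro ⟨n, S⟩
  by_cases h : (k, i) = (l, j)
  · simp only [Prod.mk.injEq] at h
    obtain ⟨rfl, rfl⟩ := h
    by_cases h1 : toLex (k, i) ∈ S <;> simp [h1]
  · have h' : toLex (k, i) ≠ toLex (l, j) := h
    by_cases h1 : toLex (k, i) ∈ S <;> by_cases h2 : toLex (l, j) ∈ S
    · simp [h1, h2]
    · simp [h1, h2]
    · simp [h1, h2]
    · simp only [LinearMap.add_apply, Module.End.mul_apply, fermiCre_single, h1,
        h2, if_false, h', h'.symm, or_false, Finset.mem_insert,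
        Finset.insert_comm (toLex (k, i)), ← Finsupp.single_add, one_mul,
        fermiSign_insert h2,
        fermiSign_insert h1, fermiSign_swap _ _ h', Finsupp.single_zero, LinearMap.zero_apply]

/-! ### Operators on the tensor product -/

theorem onMom_mul {D : ℕ} (A B : Module.End ℂ (TestFn D)) :
    onMom (A * B) = onMom A * onMom B := LinearMap.rTensor_mul _ _ _
theorem onMom_add {D : ℕ} (A B : Module.End ℂ (TestFn D)) :
    onMom (A + B) = onMom A + onMom B := LinearMap.rTensor_add _ _ _
theorem onMom_sub {D : ℕ} (A B : Module.End ℂ (TestFn D)) :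
    onMom (A - B) = onMom A - onMom B := LinearMap.rTensor_sub _ _
theorem onMom_smul {D : ℕ} (c : ℂ) (A : Module.End ℂ (TestFn D)) :
    onMom (c • A) = c • onMom A := LinearMap.rTensor_smul _ _ _
theorem onMom_zero {D : ℕ} : onMom (0 : Module.End ℂ (TestFn D)) = 0 :=
  LinearMap.rTensor_zero _
theorem onMom_one {D : ℕ} : onMom (1 : Module.End ℂ (TestFn D)) = 1 :=
  LinearMap.rTensor_id _ _
theorem onFock_mul {D : ℕ} (A B : Module.End ℂ (Fock D)) :
    onFock (A * B) = onFock A * onFock B := LinearMap.lTensor_mul _ _ _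
theorem onFock_add {D : ℕ} (A B : Module.End ℂ (Fock D)) :
    onFock (A + B) = onFock A + onFock B := LinearMap.lTensor_add _ _ _
theorem onFock_sub {D : ℕ} (A B : Module.End ℂ (Fock D)) :
    onFock (A - B) = onFock A - onFock B := LinearMap.lTensor_sub _ _
theorem onFock_smul {D : ℕ} (c : ℂ) (A : Module.End ℂ (Fock D)) :
    onFock (c • A) = c • onFock A := LinearMap.lTensor_smul _ _ _
theorem onFock_zero {D : ℕ} : onFock (0 : Module.End ℂ (Fock D)) = 0 :=
  LinearMap.lTensor_zero _
theorem onFock_one {D : ℕ} : onFock (1 : Module.End ℂ (Fock D)) = 1 :=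
  LinearMap.lTensor_id _ _
theorem onMom_onFock {D : ℕ} (A : Module.End ℂ (TestFn D)) (B : Module.End ℂ (Fock D)) :
    onMom A * onFock B = onFock B * onMom A := by
  apply TensorProduct.ext'
  intro f g
  simp [onMom, onFock]

/-! ### The oscillators -/

/-- The graded commutator `x y - s y x`. -/
def gcomm {A : Type*} [Ring A] [Module ℂ A] (s : ℂ) (x y : A) : A := x * y - s • (y * x)

/-- The oscillators of Bose (`false`) and Fermi (`true`) type. -/
def osc (D : ℕ) : Bool → ℤ → Fin (D - 2) → Module.End ℂ (Dom D)
  | false => alpha D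
  | true => dOsc D

/-- The sign of the exchange of two oscillators. -/
def exSign : Bool → Bool → ℂ
  | true, true => -1
  | _, _ => 1

/-- The value of the graded commutator of `φ_m` and `φ_{-m}`. -/
def oscNorm : Bool → ℤ → ℂ
  | false, m => m
  | true, _ => 1

theorem alpha_zero (D : ℕ) (j : Fin (D - 2)) : alpha D 0 j = onMom (pTr D j) := rfl
theorem alpha_pos (D k : ℕ) (j : Fin (D - 2)) :
    alpha D (Int.ofNat (k + 1)) j = onFock (((Real.sqrt (k + 1) : ℝ) : ℂ) • boseAnn D k j) := rfl
theorem alpha_neg (D k : ℕ) (j : Fin (D - 2)) :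
    alpha D (Int.negSucc k) j = onFock (((Real.sqrt (k + 1) : ℝ) : ℂ) • boseCre D k j) := rfl
theorem dOsc_zero (D : ℕ) (j : Fin (D - 2)) : dOsc D 0 j =
    onFock (((1 / Real.sqrt 2 : ℝ) : ℂ) • (fermiAnn D 0 j + fermiCre D 0 j)) := rfl
theorem dOsc_pos (D k : ℕ) (j : Fin (D - 2)) :
    dOsc D (Int.ofNat (k + 1)) j = onFock (fermiAnn D (k + 1) j) := rfl
theorem dOsc_neg (D k : ℕ) (j : Fin (D - 2)) :
    dOsc D (Int.negSucc k) j = onFock (fermiCre D (k + 1) j) := rfl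

theorem int_cases (m : ℤ) : m = 0 ∨ (∃ k : ℕ, m = Int.ofNat (k + 1)) ∨ ∃ k, m = Int.negSucc k := by
  match m with
  | Int.ofNat 0 => exact Or.inl rfl
  | Int.ofNat (k + 1) => exact Or.inr (Or.inl ⟨k, rfl⟩)
  | Int.negSucc k => exact Or.inr (Or.inr ⟨k, rfl⟩)

theorem mulOp_comm {D : ℕ} (g h : Mom D → ℂ) (hg hh) : mulOp g hg * mulOp h hh
    = mulOp h hh * mulOp g hg := by
  ext f p
  change g p * (h p * f p) = h p * (g p * f p)
  ring

theorem pTr_comm {D : ℕ} (i j : Fin (D - 2)) : pTr D i * pTr D j = pTr D j * pTr D i :=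
  mulOp_comm _ _ _ _

theorem onFock_commute {D : ℕ} {A B : Module.End ℂ (Fock D)} (h : Commute A B) :
    Commute (onFock A) (onFock B) := by
  rw [Commute, SemiconjBy, ← onFock_mul, h.eq, onFock_mul]

theorem alpha_commute_onFock {D : ℕ} {j : Fin (D - 2)} {B : Module.End ℂ (Fock D)}
    (h1 : ∀ k, Commute (boseAnn D k j) B) (h2 : ∀ k, Commute (boseCre D k j) B) (m : ℤ) :
    Commute (alpha D m j) (onFock B) := by
  rcases int_cases m with rfl | ⟨k, rfl⟩ | ⟨k, rfl⟩
  · exact onMom_onFock _ _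
  · exact onFock_commute ((h1 k).smul_left _)
  · exact onFock_commute ((h2 k).smul_left _)

theorem alpha_fermiAnn {D : ℕ} (i j : Fin (D - 2)) (m : ℤ) (l : ℕ) :
    Commute (alpha D m i) (onFock (fermiAnn D l j)) := by
  apply alpha_commute_onFock <;> intro k <;> apply fock_hom_ext <;> rintro ⟨n, S⟩ <;>
  by_cases h : toLex (l, j) ∈ S <;> simp [h, mul_comm]

theorem alpha_fermiCre {D : ℕ} (i j : Fin (D - 2)) (m : ℤ) (l : ℕ) :
    Commute (alpha D m i) (onFock (fermiCre D l j)) := by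
  apply alpha_commute_onFock <;> intro k <;> apply fock_hom_ext <;> rintro ⟨n, S⟩ <;>
  by_cases h : toLex (l, j) ∈ S <;> simp [h, mul_comm]

theorem alpha_dOsc (D : ℕ) (m n : ℤ) (i j : Fin (D - 2)) :
    Commute (alpha D m i) (dOsc D n j) := by
  rcases int_cases n with rfl | ⟨l, rfl⟩ | ⟨l, rfl⟩
  · rw [dOsc_zero, onFock_smul, onFock_add]
    exact ((alpha_fermiAnn _ _ _ _).add_right (alpha_fermiCre _ _ _ _)).smul_right _
  · exact alpha_fermiAnn _ _ _ _
  · exact alpha_fermiCre _ _ _ _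

theorem sqrt_mul_self_succ (k : ℕ) :
    ((Real.sqrt (k + 1) : ℝ) : ℂ) * ((Real.sqrt (k + 1) : ℝ) : ℂ) = (k : ℂ) + 1 := by
  rw [← Complex.ofReal_mul, Real.mul_self_sqrt (by positivity)]
  push_cast; rfl

theorem onFock_smul_comm {D : ℕ} (c d : ℂ) (A B : Module.End ℂ (Fock D)) :
    onFock (c • A) * onFock (d • B) - onFock (d • B) * onFock (c • A) =
      (c * d) • onFock (A * B - B * A) := by
  rw [onFock_smul, onFock_smul, onFock_sub, onFock_mul, onFock_mul, smul_mul_smul_comm,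
    smul_mul_smul_comm, mul_comm d c, smul_sub]

theorem alpha_comm (D : ℕ) (m n : ℤ) (i j : Fin (D - 2)) :
    alpha D m i * alpha D n j - alpha D n j * alpha D m i =
      if i = j ∧ m + n = 0 then (m : ℂ) • (1 : Module.End ℂ (Dom D)) else 0 := by
  rcases int_cases m with rfl | ⟨k, rfl⟩ | ⟨k, rfl⟩
  · have : Commute (alpha D 0 i) (alpha D n j) := by
      rcases int_cases n with rfl | ⟨l, rfl⟩ | ⟨l, rfl⟩
      · rw [alpha_zero, alpha_zero, Commute, SemiconjBy, ← onMom_mul, pTr_comm, onMom_mul]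
      · exact onMom_onFock _ _
      · exact onMom_onFock _ _
    rw [this.eq, sub_self]
    simp
  · rcases int_cases n with rfl | ⟨l, rfl⟩ | ⟨l, rfl⟩
    · rw [alpha_zero, alpha_pos, onMom_onFock, sub_self, if_neg]
      simp only [Int.ofNat_eq_natCast]; omega
    · have h : Commute (boseAnn D k i) (boseAnn D l j) := boseAnn_comm D k l i j
      rw [alpha_pos, alpha_pos, (onFock_commute ((h.smul_left _).smul_right _)).eq, sub_self,
        if_neg]
      simp only [Int.ofNat_eq_natCast]; omega
    · rw [alpha_pos, alpha_neg, onFock_smul_comm, boseAnn_boseCre]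
      by_cases h : (k, i) = (l, j)
      · simp only [Prod.mk.injEq] at h
        obtain ⟨rfl, rfl⟩ := h
        rw [if_pos rfl, sqrt_mul_self_succ, onFock_one, if_pos ⟨rfl, by
          simp only [Int.ofNat_eq_natCast]; omega⟩]
        simp
      · rw [if_neg h, if_neg, onFock_zero, smul_zero]
        rintro ⟨h1, h2⟩
        apply h
        simp only [Int.ofNat_eq_natCast] at h2
        rw [h1, show k = l by omega]
  · rcases int_cases n with rfl | ⟨l, rfl⟩ | ⟨l, rfl⟩
    · rw [alpha_zero, alpha_neg, onMom_onFock, sub_self, if_neg]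
      omega
    · rw [alpha_pos, alpha_neg, ← neg_sub, onFock_smul_comm, boseAnn_boseCre]
      by_cases h : (l, j) = (k, i)
      · simp only [Prod.mk.injEq] at h
        obtain ⟨rfl, rfl⟩ := h
        rw [if_pos rfl, sqrt_mul_self_succ, onFock_one, if_pos ⟨rfl, by
          simp only [Int.ofNat_eq_natCast]; omega⟩]
        refine (neg_smul _ _).symm.trans ?_
        congr 1
        push_cast [Int.negSucc_eq]
        ring
      · rw [if_neg h, if_neg, onFock_zero, smul_zero, neg_zero]
        rintro ⟨h1, h2⟩
        apply h
        simp only [Int.ofNat_eq_natCast] at h2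
        rw [h1, show k = l by omega]
    · have h : Commute (boseCre D k i) (boseCre D l j) := boseCre_comm D k l i j
      rw [alpha_neg, alpha_neg, (onFock_commute ((h.smul_left _).smul_right _)).eq, sub_self,
        if_neg]
      omega

theorem inv_sqrt_two_mul_self :
    ((1 / Real.sqrt 2 : ℝ) : ℂ) * ((1 / Real.sqrt 2 : ℝ) : ℂ) = 1 / 2 := by
  rw [← Complex.ofReal_mul]
  have : (1 / Real.sqrt 2) * (1 / Real.sqrt 2) = 1 / 2 := by
    rw [div_mul_div_comm, Real.mul_self_sqrt (by norm_num)]; norm_num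
  rw [this]; norm_num

theorem fermiAnn_fermiCre' (D : ℕ) (k l : ℕ) (i j : Fin (D - 2)) :
    fermiCre D k i * fermiAnn D l j + fermiAnn D l j * fermiCre D k i =
      if (k, i) = (l, j) then 1 else 0 := by
  rw [add_comm, fermiAnn_fermiCre]
  simp only [Prod.mk.injEq, eq_comm]

/-- The two scalars are kept separate since B may be `b_0` or its adjoint, in which case only one of
the halves of `d_0` contributes. -/
theorem dOsc_zero_anticomm (D : ℕ) (i : Fin (D - 2)) (B : Module.End ℂ (Fock D)) (x y : ℂ)
    (h1 : fermiAnn D 0 i * B + B * fermiAnn D 0 i = x • 1)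
    (h2 : fermiCre D 0 i * B + B * fermiCre D 0 i = y • 1) :
    dOsc D 0 i * onFock B + onFock B * dOsc D 0 i =
      (((1 / Real.sqrt 2 : ℝ) : ℂ) * (x + y)) • 1 := by
  rw [dOsc_zero, onFock_smul, onFock_add, smul_mul_assoc, mul_smul_comm, ← smul_add, add_mul,
    mul_add, ← onFock_mul, ← onFock_mul, ← onFock_mul, ← onFock_mul, add_add_add_comm,
    ← onFock_add, ← onFock_add, h1, h2, onFock_smul, onFock_smul, ← add_smul, smul_smul, onFock_one]

theorem dOsc_anticomm_of_ne (D : ℕ) (m : ℤ) {n : ℤ} (hn : n ≠ 0) (i j : Fin (D - 2)) :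
    dOsc D m i * dOsc D n j + dOsc D n j * dOsc D m i =
      if i = j ∧ m + n = 0 then 1 else 0 := by
  rcases int_cases n with rfl | ⟨l, rfl⟩ | ⟨l, rfl⟩
  · exact absurd rfl hn
  · rcases int_cases m with rfl | ⟨k, rfl⟩ | ⟨k, rfl⟩
    · rw [dOsc_pos, dOsc_zero_anticomm D i _ 0 0, if_neg]
      · simp
      · simp only [Int.ofNat_eq_natCast]; omega
      · rw [fermiAnn_anticomm]; simp
      · rw [fermiAnn_fermiCre']; simp
    · rw [dOsc_pos, dOsc_pos, ← onFock_mul, ← onFock_mul, ← onFock_add, fermiAnn_anticomm,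
        onFock_zero, if_neg]
      simp only [Int.ofNat_eq_natCast]; omega
    · rw [dOsc_pos, dOsc_neg, ← onFock_mul, ← onFock_mul, ← onFock_add, fermiAnn_fermiCre']
      have : (k + 1, i) = (l + 1, j) ↔ i = j ∧ Int.negSucc k + Int.ofNat (l + 1) = 0 := by
        simp only [Int.ofNat_eq_natCast, Prod.mk.injEq]; omega
      simp only [this]
      split_ifs
      · exact onFock_one
      · exact onFock_zero
  · rcases int_cases m with rfl | ⟨k, rfl⟩ | ⟨k, rfl⟩
    · rw [dOsc_neg, dOsc_zero_anticomm D i _ 0 0, if_neg]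
      · simp
      · omega
      · rw [fermiAnn_fermiCre]; simp
      · rw [fermiCre_anticomm]; simp
    · rw [dOsc_pos, dOsc_neg, ← onFock_mul, ← onFock_mul, ← onFock_add, fermiAnn_fermiCre]
      have : (k + 1, i) = (l + 1, j) ↔ i = j ∧ Int.ofNat (k + 1) + Int.negSucc l = 0 := by
        simp only [Int.ofNat_eq_natCast, Prod.mk.injEq]; omega
      simp only [this]
      split_ifs
      · exact onFock_one
      · exact onFock_zero
    · rw [dOsc_neg, dOsc_neg, ← onFock_mul, ← onFock_mul, ← onFock_add, fermiCre_anticomm,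
        onFock_zero, if_neg]
      omega

theorem dOsc_anticomm (D : ℕ) (m n : ℤ) (i j : Fin (D - 2)) :
    dOsc D m i * dOsc D n j + dOsc D n j * dOsc D m i =
      if i = j ∧ m + n = 0 then 1 else 0 := by
  by_cases hn : n = 0
  · by_cases hm : m = 0
    · subst hn hm
      rw [dOsc_zero D j, onFock_smul, onFock_add, mul_smul_comm, smul_mul_assoc, ← smul_add,
        mul_add, add_mul, add_add_add_comm,
        dOsc_zero_anticomm D i (fermiAnn D 0 j) 0 (if i = j then 1 else 0),
        dOsc_zero_anticomm D i (fermiCre D 0 j) (if i = j then 1 else 0) 0, ← add_smul,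
        smul_smul]
      · split_ifs with h1 h2 h2
        -- Each of the two pairings of b_0 with its adjoint contributes (1/√2)² = 1/2.
        · rw [zero_add, add_zero, mul_one, ← two_mul, mul_left_comm, inv_sqrt_two_mul_self]
          norm_num
        · simp [h1] at h2
        · exact absurd h2.1 h1
        · simp
      · rw [fermiAnn_fermiCre]; simp
      · rw [fermiCre_anticomm]; simp
      · rw [fermiAnn_anticomm]; simp
      · rw [fermiAnn_fermiCre']; simp
    · rw [add_comm, dOsc_anticomm_of_ne D n hm]
      simp only [eq_comm (a := j), add_comm n]
  · exact dOsc_anticomm_of_ne D m hn i j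

theorem osc_gcomm (D : ℕ) (t u : Bool) (m n : ℤ) (i j : Fin (D - 2)) :
    gcomm (exSign t u) (osc D t m i) (osc D u n j) =
      (if t = u ∧ i = j ∧ m + n = 0 then oscNorm t m else 0) • (1 : Module.End ℂ (Dom D)) := by
  cases t <;> cases u <;> simp only [gcomm, osc, exSign, oscNorm, one_smul]
  · rw [alpha_comm]; split_ifs <;> simp_all
  · rw [alpha_dOsc]; simp
  · rw [alpha_dOsc]; simp
  · rw [neg_smul, one_smul, sub_neg_eq_add, dOsc_anticomm]; split_ifs <;> simp_all

/-! ### Graded commutators and locally finite sums -/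

section Abstract

variable {V : Type*} [AddCommGroup V] [Module ℂ V]

theorem gcomm_add_left (s : ℂ) (x y z : Module.End ℂ V) :
    gcomm s (x + y) z = gcomm s x z + gcomm s y z := by
  simp only [gcomm, add_mul, mul_add, smul_add]; abel

theorem gcomm_sub_left (s : ℂ) (x y z : Module.End ℂ V) :
    gcomm s (x - y) z = gcomm s x z - gcomm s y z := by
  simp only [gcomm, sub_mul, mul_sub, smul_sub]; abel

theorem gcomm_smul_left (s c : ℂ) (x z : Module.End ℂ V) :
    gcomm s (c • x) z = c • gcomm s x z := by
  simp only [gcomm, smul_mul_assoc, mul_smul_comm, smul_sub, smul_comm s c]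

theorem gcomm_zero_left (s : ℂ) (z : Module.End ℂ V) : gcomm s 0 z = 0 := by
  simp [gcomm]

theorem gcomm_sum_left {κ : Type*} (S : Finset κ) (s : ℂ) (x : κ → Module.End ℂ V)
    (z : Module.End ℂ V) : gcomm s (∑ i ∈ S, x i) z = ∑ i ∈ S, gcomm s (x i) z := by
  simp only [gcomm, Finset.sum_mul, Finset.mul_sum, Finset.smul_sum, Finset.sum_sub_distrib]

theorem gcomm_smul_one_left (c : ℂ) (z : Module.End ℂ V) : gcomm 1 (c • 1) z = 0 := by
  simp [gcomm]

theorem gcomm_add_right (s : ℂ) (x y z : Module.End ℂ V) :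
    gcomm s z (x + y) = gcomm s z x + gcomm s z y := by
  simp only [gcomm, add_mul, mul_add, smul_add]; abel

theorem gcomm_sub_right (s : ℂ) (x y z : Module.End ℂ V) :
    gcomm s z (x - y) = gcomm s z x - gcomm s z y := by
  simp only [gcomm, sub_mul, mul_sub, smul_sub]; abel

theorem gcomm_smul_right (s c : ℂ) (x z : Module.End ℂ V) :
    gcomm s z (c • x) = c • gcomm s z x := by
  simp only [gcomm, smul_mul_assoc, mul_smul_comm, smul_sub, smul_comm s c]

theorem gcomm_zero_right (s : ℂ) (z : Module.End ℂ V) : gcomm s z 0 = 0 := by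
  simp [gcomm]

/-- The commutator is a derivation in its first argument. -/
theorem gcomm_mul_left (s : ℂ) (x y z : Module.End ℂ V) (t : ℂ) :
    gcomm (t * s) (x * y) z = x * gcomm t y z + t • (gcomm s x z * y) := by
  simp only [gcomm, mul_sub, sub_mul, mul_smul_comm, smul_mul_assoc, smul_sub, mul_assoc, mul_smul]
  abel

theorem gcomm_locSum_finite {ι : Type*} (s : ℂ) (T : ι → Module.End ℂ V)
    (hT : ∀ v, {i | T i v ≠ 0}.Finite) (z : Module.End ℂ V) (v : V) :
    {i | gcomm s (T i) z v ≠ 0}.Finite := by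
  refine ((hT v).union (hT (z v))).subset fun i hi => ?_
  by_contra hc
  simp only [Set.mem_union, Set.mem_ofPred_eq, not_or, not_not] at hc
  exact hi (by simp [gcomm, hc.1, hc.2])

theorem gcomm_locSum {ι : Type*} (s : ℂ) (T : ι → Module.End ℂ V)
    (hT : ∀ v, {i | T i v ≠ 0}.Finite) (z : Module.End ℂ V) :
    gcomm s (locSum T hT) z = locSum (fun i => gcomm s (T i) z) (gcomm_locSum_finite s T hT z) := by
  ext v
  change ∑ᶠ i, T i (z v) - s • z (∑ᶠ i, T i v) = ∑ᶠ i, (T i (z v) - s • z (T i v))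
  rw [finsum_sub_distrib (hT (z v)), ← smul_finsum', ← map_finsum _ (hT v)]
  · refine (hT v).subset fun i hi => ?_
    intro h
    exact hi (by simp [h])
  · refine (hT v).subset fun i hi => ?_
    intro h
    exact hi (by simp [h])

theorem locSum_apply {ι : Type*} (T : ι → Module.End ℂ V)
    (hT : ∀ v, {i | T i v ≠ 0}.Finite) (v : V) : locSum T hT v = ∑ᶠ i, T i v := rfl

theorem locSum_zero {ι : Type*} (T : ι → Module.End ℂ V)
    (hT : ∀ v, {i | T i v ≠ 0}.Finite) (h : ∀ i, T i = 0) : locSum T hT = 0 := by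
  ext v
  simp [locSum_apply, h]

theorem locSum_add {ι : Type*} {T S W : ι → Module.End ℂ V}
    (hT : ∀ v, {i | T i v ≠ 0}.Finite) (hS : ∀ v, {i | S i v ≠ 0}.Finite)
    (hW : ∀ v, {i | W i v ≠ 0}.Finite) (h : ∀ i, W i = T i + S i) :
    locSum W hW = locSum T hT + locSum S hS := by
  ext v
  simp only [locSum_apply, h, LinearMap.add_apply]
  exact finsum_add_distrib (hT v) (hS v)

theorem locSum_smul {ι : Type*} {T W : ι → Module.End ℂ V} (c : ℂ)
    (hT : ∀ v, {i | T i v ≠ 0}.Finite)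
    (hW : ∀ v, {i | W i v ≠ 0}.Finite) (h : ∀ i, W i = c • T i) :
    locSum W hW = c • locSum T hT := by
  ext v
  simp only [locSum_apply, h, LinearMap.smul_apply]
  exact (smul_finsum' c (hT v)).symm

theorem ite_family_finite {ι : Type*} [DecidableEq ι] (a : ι) (U : Module.End ℂ V) (v : V) :
    {i | (if i = a then U else 0 : Module.End ℂ V) v ≠ 0}.Finite := by
  refine (Set.finite_singleton a).subset fun i hi => ?_
  by_contra h
  exact hi (by simp [show i ≠ a from h])

theorem locSum_single {ι : Type*} [DecidableEq ι] (a : ι) (U : Module.End ℂ V) :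
    locSum (fun i => if i = a then U else 0) (ite_family_finite a U) = U := by
  ext v
  rw [locSum_apply, finsum_eq_single _ a]
  · simp
  · intro i hi; simp [hi]

/-- The indices a and b may coincide, and then both contributions count. This happens in the
commutators of L_m and K_m with an oscillator. -/
theorem locSum_pair {ι : Type*} [DecidableEq ι] (T : ι → Module.End ℂ V)
    (hT : ∀ v, {i | T i v ≠ 0}.Finite) (a b : ι) (U W : Module.End ℂ V)
    (h : ∀ i, T i = (if i = a then U else 0) + (if i = b then W else 0)) :
    locSum T hT = U + W := by
  rw [locSum_add (ite_family_finite a U) (ite_family_finite b W) hT h, locSum_single, locSum_single]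

theorem signed_family_finite (f : ℤ → Module.End ℂ V) (hf : ∀ v, {m | f m v ≠ 0}.Finite) (v : V) :
    {r : ℕ | (f ((r : ℤ) + 1) + f (-((r : ℤ) + 1))) v ≠ 0}.Finite := by
  have h1 : Set.InjOn (fun r : ℕ => (r : ℤ) + 1) ((fun r : ℕ => (r : ℤ) + 1) ⁻¹' {m | f m v ≠ 0}) :=
    fun a _ b _ h => by simpa using h
  have h2 : Set.InjOn (fun r : ℕ => -((r : ℤ) + 1))
      ((fun r : ℕ => -((r : ℤ) + 1)) ⁻¹' {m | f m v ≠ 0}) :=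
    fun a _ b _ h => by simpa using h
  refine (((hf v).preimage h1).union ((hf v).preimage h2)).subset fun r hr => ?_
  by_contra hc
  simp only [Set.mem_union, Set.mem_preimage, Set.mem_ofPred_eq, not_or, not_not] at hc
  exact hr (by simp only [LinearMap.add_apply, hc.1, hc.2, add_zero])

/-- A sum over `r ≥ 0` of the values at `± (r + 1)` of a family supported at one integer. -/
theorem locSum_signed_single (a : ℤ) (U : Module.End ℂ V) :
    locSum (fun r : ℕ => (if ((r : ℤ) + 1) = a then U else 0) + (if -((r : ℤ) + 1) = a then U else 0))
      (signed_family_finite (fun m => if m = a then U else 0) (ite_family_finite a U)) =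
      if a = 0 then 0 else U := by
  rcases lt_trichotomy a 0 with h | h | h
  · rw [if_neg h.ne]
    obtain ⟨n, rfl⟩ := Int.eq_negSucc_of_lt_zero h
    ext v
    rw [locSum_apply, finsum_eq_single _ n]
    · rw [if_neg (by omega), if_pos (by omega)]; simp
    · intro i hi; rw [if_neg (by omega), if_neg (by omega)]; simp
  · subst h
    rw [if_pos rfl]
    apply locSum_zero
    intro i
    rw [if_neg (by omega), if_neg (by omega), add_zero]
  · rw [if_neg h.ne']
    obtain ⟨n, rfl⟩ := Int.eq_succ_of_zero_lt h
    ext v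
    rw [locSum_apply, finsum_eq_single _ n]
    · rw [if_pos (by omega), if_neg (by omega)]; simp
    · intro i hi; rw [if_neg (by omega), if_neg (by omega)]; simp

end Abstract

/-! ### Commutators of the Virasoro and Kac-Moody operators with the oscillators -/

theorem exSign_comm (t u : Bool) : exSign t u = exSign u t := by
  cases t <;> cases u <;> rfl

theorem exSign_mul_self (t u : Bool) : exSign t u * exSign t u = 1 := by
  cases t <;> cases u <;> simp [exSign]

/-- Wick ordering changes a product only by a scalar, which drops out of every commutator. The value
of the scalar is never needed for the brackets with oscillators. -/
theorem wickA_eq (D : ℕ) (m n : ℤ) (j k : Fin (D - 2)) :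
    ∃ c : ℂ, wickA D m n j k = alpha D m j * alpha D n k - c • 1 := by
  unfold wickA
  split_ifs
  · exact ⟨0, by simp⟩
  · have h := alpha_comm D m n j k
    rw [sub_eq_iff_eq_add] at h
    rw [h]
    split_ifs
    · exact ⟨m, by simp⟩
    · exact ⟨0, by simp⟩

theorem wickD_eq (D : ℕ) (m n : ℤ) (j k : Fin (D - 2)) :
    ∃ c : ℂ, wickD D m n j k = dOsc D m j * dOsc D n k - c • 1 := by
  have h := dOsc_anticomm D m n j k
  obtain ⟨c, hc⟩ : ∃ c : ℂ, (if j = k ∧ m + n = 0 then 1 else 0 : Module.End ℂ (Dom D)) = c • 1 := by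
    split_ifs
    · exact ⟨1, by simp⟩
    · exact ⟨0, by simp⟩
  rw [hc, ← eq_sub_iff_add_eq'] at h
  unfold wickD
  split_ifs
  · exact ⟨0, by simp⟩
  · refine ⟨c, ?_⟩
    rw [h]; abel
  · refine ⟨c / 2, ?_⟩
    rw [h]
    module

theorem gcomm_osc (D : ℕ) (t u : Bool) (m n : ℤ) (i j : Fin (D - 2)) {s : ℂ}
    (hs : exSign t u = s) :
    gcomm s (osc D t m i) (osc D u n j) =
      (if t = u ∧ i = j ∧ m + n = 0 then oscNorm t m else 0) • (1 : Module.End ℂ (Dom D)) := by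
  rw [← hs, osc_gcomm]

theorem gcomm_osc_mul (D : ℕ) (t u : Bool) (m n p : ℤ) (i j k : Fin (D - 2)) :
    gcomm 1 (osc D t m i * osc D t n j) (osc D u p k) =
      (if t = u ∧ j = k ∧ n + p = 0 then oscNorm t n else 0) • osc D t m i
      + (if t = u ∧ i = k ∧ m + p = 0 then exSign t u * oscNorm t m else 0) • osc D t n j := by
  rw [← exSign_mul_self t u, gcomm_mul_left, osc_gcomm, osc_gcomm]
  simp only [mul_smul_comm, smul_mul_assoc, mul_one, one_mul, smul_smul]
  congr 2
  split_ifs <;> simp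

theorem gcomm_wickA (D : ℕ) (u : Bool) (m n p : ℤ) (i j k : Fin (D - 2)) :
    gcomm 1 (wickA D m n i j) (osc D u p k) =
      gcomm 1 (osc D false m i * osc D false n j) (osc D u p k) := by
  obtain ⟨c, hc⟩ := wickA_eq D m n i j
  rw [hc, gcomm_sub_left, gcomm_smul_one_left, sub_zero]
  rfl

theorem gcomm_wickD (D : ℕ) (u : Bool) (m n p : ℤ) (i j k : Fin (D - 2)) :
    gcomm 1 (wickD D m n i j) (osc D u p k) =
      gcomm 1 (osc D true m i * osc D true n j) (osc D u p k) := by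
  obtain ⟨c, hc⟩ := wickD_eq D m n i j
  rw [hc, gcomm_sub_left, gcomm_smul_one_left, sub_zero]
  rfl

/-- The coefficient in `[L_m, φ_n] = - virCoeff φ_{m+n}`. -/
def virCoeff : Bool → ℤ → ℤ → ℂ
  | false, _, n => n
  | true, m, n => n + m / 2

theorem gcomm_virATerm_alpha (D : ℕ) (m p n : ℤ) (k : Fin (D - 2)) :
    gcomm 1 (virATerm D m n) (osc D false p k) =
      (if n = -p then (-(p : ℂ)) • osc D false (m + p) k else 0)
      + (if n = m + p then (-(p : ℂ)) • osc D false (m + p) k else 0) := by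
  simp only [virATerm, gcomm_sum_left, gcomm_wickA, gcomm_osc_mul, true_and, exSign, one_mul, oscNorm,
    Finset.sum_add_distrib, ite_smul, zero_smul, ite_and, Finset.sum_ite_eq', Finset.mem_univ, if_true]
  congr 1
  · by_cases h : n = -p
    · rw [if_pos (by omega), if_pos h, h]; push_cast; rw [sub_neg_eq_add]
    · rw [if_neg (by omega), if_neg h]
  · by_cases h : n = m + p
    · rw [if_pos (by omega), if_pos h, h]
      congr 1
      push_cast; ring
    · rw [if_neg (by omega), if_neg h]

/-- The oscillator contracts with either factor, at n = -(m + p) or at n = p, with weights -(m + p)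
and -p. The prefactor 1/2 of L_m averages them to -(p + m/2), the value recorded in `virCoeff`. -/
theorem gcomm_virDTerm_dOsc (D : ℕ) (m p n : ℤ) (k : Fin (D - 2)) :
    gcomm 1 (virDTerm D m n) (osc D true p k) =
      (if n = -(m + p) then (-((m : ℂ) + p)) • osc D true (m + p) k else 0)
      + (if n = p then (-(p : ℂ)) • osc D true (m + p) k else 0) := by
  simp only [virDTerm, gcomm_smul_left, gcomm_sum_left, gcomm_wickD, gcomm_osc_mul, true_and, exSign,
    oscNorm, mul_one, Finset.sum_add_distrib, ite_smul, zero_smul, ite_and, Finset.sum_ite_eq',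
    Finset.mem_univ, if_true, smul_add, smul_ite, smul_zero]
  congr 1
  · by_cases h : n = -(m + p)
    · rw [if_pos (by omega), if_pos h, h]; push_cast; rw [neg_neg, one_smul]
    · rw [if_neg (by omega), if_neg h]
  · by_cases h : n = p
    · rw [if_pos (by omega), if_pos h, h, smul_smul]; ring_nf
    · rw [if_neg (by omega), if_neg h]

theorem gcomm_virATerm_dOsc (D : ℕ) (m p n : ℤ) (k : Fin (D - 2)) :
    gcomm 1 (virATerm D m n) (osc D true p k) = 0 := by
  simp [virATerm, gcomm_sum_left, gcomm_wickA, gcomm_osc_mul]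

theorem gcomm_virDTerm_alpha (D : ℕ) (m p n : ℤ) (k : Fin (D - 2)) :
    gcomm 1 (virDTerm D m n) (osc D false p k) = 0 := by
  simp [virDTerm, gcomm_smul_left, gcomm_sum_left, gcomm_wickD, gcomm_osc_mul]

theorem gcomm_virasoro (D : ℕ) (a : ℝ) (m p : ℤ) (t : Bool) (k : Fin (D - 2)) :
    gcomm 1 (virasoro D a m) (osc D t p k) = (-virCoeff t m p) • osc D t (m + p) k := by
  -- The normal ordering constant D/16 - a is a scalar, hence invisible here.
  have h0 : gcomm 1 (if m = 0 then (((D : ℝ) / 16 - a : ℝ) : ℂ) • (1 : Module.End ℂ (Dom D)) else 0)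
      (osc D t p k) = 0 := by
    split_ifs
    · exact gcomm_smul_one_left _ _
    · exact gcomm_zero_left _ _
  rw [virasoro, gcomm_add_left, gcomm_add_left, h0, gcomm_smul_left, gcomm_smul_left, gcomm_locSum,
    gcomm_locSum, add_zero]
  cases t
  · rw [locSum_pair _ _ _ _ _ _ (gcomm_virATerm_alpha D m p · k),
      locSum_zero _ _ (gcomm_virDTerm_alpha D m p · k), virCoeff]
    module
  · rw [locSum_pair _ _ _ _ _ _ (gcomm_virDTerm_dOsc D m p · k),
      locSum_zero _ _ (gcomm_virATerm_dOsc D m p · k), virCoeff]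
    module

theorem gcomm_kacTerm_dOsc (D : ℕ) (m p n : ℤ) (i j k : Fin (D - 2)) :
    gcomm 1 (kacTerm D m i j n) (osc D true p k) =
      (if n = -(m + p) then kron j k • osc D true (m + p) i - kron i k • osc D true (m + p) j else 0)
      + (if n = p then kron j k • osc D true (m + p) i - kron i k • osc D true (m + p) j else 0) := by
  simp only [kacTerm, gcomm_sub_left, gcomm_wickD, gcomm_osc_mul, true_and, exSign,
    oscNorm, mul_one, kron]
  by_cases h1 : n = -(m + p)
  · have h1' : m + n + p = 0 := by omega
    by_cases h2 : n = p
    · have h2' : -n + p = 0 := by omega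
      simp only [h1', h2', if_pos h1, if_pos h2, and_true]
      rw [show -n = m + p by omega, show m + n = m + p by omega]
      split_ifs <;> module
    · have h2' : ¬ (-n + p = 0) := by omega
      simp only [h1', h2', if_pos h1, if_neg h2, and_true, and_false, if_false]
      rw [show -n = m + p by omega]
      split_ifs <;> module
  · have h1' : ¬ (m + n + p = 0) := by omega
    by_cases h2 : n = p
    · have h2' : -n + p = 0 := by omega
      simp only [h1', h2', if_neg h1, if_pos h2, and_true, and_false, if_false]
      rw [show m + n = m + p by omega]
      split_ifs <;> module
    · have h2' : ¬ (-n + p = 0) := by omega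
      simp only [h1', h2', if_neg h1, if_neg h2, and_false, if_false]
      module

theorem gcomm_kacTerm_alpha (D : ℕ) (m p n : ℤ) (i j k : Fin (D - 2)) :
    gcomm 1 (kacTerm D m i j n) (osc D false p k) = 0 := by
  simp [kacTerm, gcomm_sub_left, gcomm_wickD, gcomm_osc_mul]

theorem gcomm_kac_alpha (D : ℕ) (m p : ℤ) (i j k : Fin (D - 2)) :
    gcomm 1 (kac D m i j) (osc D false p k) = 0 := by
  rw [kac, gcomm_smul_left, gcomm_locSum, locSum_zero _ _ (gcomm_kacTerm_alpha D m p · i j k),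
    smul_zero]

theorem gcomm_kac_dOsc (D : ℕ) (m p : ℤ) (i j k : Fin (D - 2)) :
    gcomm 1 (kac D m i j) (osc D true p k) =
      kron j k • osc D true (m + p) i - kron i k • osc D true (m + p) j := by
  rw [kac, gcomm_smul_left, gcomm_locSum,
    locSum_pair _ _ _ _ _ _ (gcomm_kacTerm_dOsc D m p · i j k)]
  module

section Abstract

variable {V : Type*} [AddCommGroup V] [Module ℂ V]

/-- A sum over r of terms at r + 1 and -(r + 1) is a sum over the nonzero integers. When it is
supported at three integers, which may coincide, it collapses to three values, and a support point
at 0 is lost because m = 0 is absent. -/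
theorem locSum_signed_three (T : ℕ → Module.End ℂ V) (hT : ∀ v, {i | T i v ≠ 0}.Finite)
    (f : ℤ → Module.End ℂ V) (a b c : ℤ) (U W Z : Module.End ℂ V)
    (hf : ∀ m, m ≠ 0 → f m = (if m = a then U else 0) + (if m = b then W else 0)
      + (if m = c then Z else 0))
    (h : ∀ r : ℕ, T r = f ((r : ℤ) + 1) + f (-((r : ℤ) + 1))) :
    locSum T hT = (if a = 0 then 0 else U) + (if b = 0 then 0 else W) + (if c = 0 then 0 else Z) := by
  have hfin : ∀ (a : ℤ) (U : Module.End ℂ V) (v : V), {r : ℕ |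
      ((if ((r : ℤ) + 1) = a then U else 0) + (if -((r : ℤ) + 1) = a then U else 0) :
        Module.End ℂ V) v ≠ 0}.Finite := fun a U =>
    signed_family_finite (fun m => if m = a then U else 0) (ite_family_finite a U)
  have hfin2 : ∀ v, {r : ℕ | (((if ((r : ℤ) + 1) = a then U else 0) +
      (if -((r : ℤ) + 1) = a then U else 0)) + ((if ((r : ℤ) + 1) = b then W else 0)
        + (if -((r : ℤ) + 1) = b then W else 0)) :
        Module.End ℂ V) v ≠ 0}.Finite := fun v => by
    refine ((hfin a U v).union (hfin b W v)).subset fun i hi => ?_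
    by_contra hc
    simp only [Set.mem_union, Set.mem_ofPred_eq, not_or, not_not] at hc
    exact hi (by rw [LinearMap.add_apply, hc.1, hc.2, add_zero])
  rw [locSum_add hfin2 (hfin c Z) hT, locSum_add (hfin a U) (hfin b W) hfin2 (fun _ => rfl),
    locSum_signed_single, locSum_signed_single, locSum_signed_single]
  intro r
  rw [h, hf _ (by omega), hf _ (by omega)]
  abel

end Abstract

theorem end_sub_smul {D : ℕ} (a b : ℂ) (x : Module.End ℂ (Dom D)) :
    (a - b) • x = a • x - b • x := sub_smul a b x

/-! ### The operators `Y^j = i K^j` and `R^{jk} = i J^{(R)jk}` -/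

/-- `F^j` up to the factor `-i`. -/
def opYF (D : ℕ) (j : Fin (D - 2)) : Module.End ℂ (Dom D) :=
  locSum (fTerm D j) (fTerm_finite D j) + ∑ l, kac D 0 j l * alpha D 0 l

/-- `K^j` up to the factor `-i`. -/
def opY (D : ℕ) (a : ℝ) (j : Fin (D - 2)) : Module.End ℂ (Dom D) :=
  locSum (eTerm D a j) (eTerm_finite D a j) + opYF D j

theorem opK_eq (D : ℕ) (a : ℝ) (j : Fin (D - 2)) : opK D a j = (-Complex.I) • opY D a j := by
  rw [opK, opE, opF, opY, opYF, smul_add, smul_add]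

/-- `J^{(R)jk}` up to the factor `-i`. -/
def opR (D : ℕ) (j k : Fin (D - 2)) : Module.End ℂ (Dom D) :=
  locSum (rotTerm D j k) (rotTerm_finite D j k) + kac D 0 j k

theorem rotR_eq (D : ℕ) (j k : Fin (D - 2)) : rotR D j k = (-Complex.I) • opR D j k := by
  rw [rotR, opR, smul_add]

/-- The coefficient of `δ_{ja} φ^b` in the double commutator of `Y^j` with `φ^a_m`, `φ^b_n`. -/
def oscU : Bool → ℤ → Bool → ℤ → ℂ
  | false, m, u, n => if m = 0 then 0 else virCoeff u m n
  | true, _, false, n => n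
  | true, _, true, _ => -1

/-- The coefficient of `δ_{ab} φ^j` in the double commutator of `Y^j` with `φ^a_m`, `φ^b_n`. -/
def oscW : Bool → ℤ → Bool → ℤ → ℂ
  | false, m, false, n => -(m * n) / (m + n)
  | false, m, true, _ => -m
  | true, _, false, n => -n
  | true, m, true, n => (m - n) / (2 * (m + n))

/-- The double commutator of `x` with two oscillators. -/
def dcomm (D : ℕ) (x : Module.End ℂ (Dom D)) (t : Bool) (p : ℤ) (i : Fin (D - 2))
    (u : Bool) (q : ℤ) (k : Fin (D - 2)) : Module.End ℂ (Dom D) :=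
  gcomm (exSign t u) (gcomm 1 x (osc D t p i)) (osc D u q k)

section dcomm
variable (D : ℕ) (t u : Bool) (p q : ℤ) (i k : Fin (D - 2))

theorem dcomm_add (x y : Module.End ℂ (Dom D)) :
    dcomm D (x + y) t p i u q k = dcomm D x t p i u q k + dcomm D y t p i u q k := by
  simp only [dcomm, gcomm_add_left]

theorem dcomm_sub (x y : Module.End ℂ (Dom D)) :
    dcomm D (x - y) t p i u q k = dcomm D x t p i u q k - dcomm D y t p i u q k := by
  simp only [dcomm, gcomm_sub_left]

theorem dcomm_smul (c : ℂ) (x : Module.End ℂ (Dom D)) :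
    dcomm D (c • x) t p i u q k = c • dcomm D x t p i u q k := by
  simp only [dcomm, gcomm_smul_left]

theorem dcomm_sum {κ : Type*} (S : Finset κ) (x : κ → Module.End ℂ (Dom D)) :
    dcomm D (∑ l ∈ S, x l) t p i u q k = ∑ l ∈ S, dcomm D (x l) t p i u q k := by
  simp only [dcomm, gcomm_sum_left]

theorem dcomm_locSum {ι : Type*} (T : ι → Module.End ℂ (Dom D))
    (hT : ∀ v, {i | T i v ≠ 0}.Finite) :
    ∃ h, dcomm D (locSum T hT) t p i u q k = locSum (fun r => dcomm D (T r) t p i u q k) h := by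
  refine ⟨?_, ?_⟩
  · exact gcomm_locSum_finite _ _ (gcomm_locSum_finite _ _ hT _) _
  · rw [dcomm, gcomm_locSum, gcomm_locSum]; rfl

theorem gcomm_one_mul_left (x y z : Module.End ℂ (Dom D)) :
    gcomm 1 (x * y) z = x * gcomm 1 y z + gcomm 1 x z * y := by
  have h := gcomm_mul_left 1 x y z 1
  rwa [mul_one, one_smul] at h

theorem gcomm_alpha (m : ℤ) (j : Fin (D - 2)) : gcomm 1 (alpha D m j) (osc D u q k) =
    (if u = false ∧ j = k ∧ m + q = 0 then (m : ℂ) else 0) • 1 := by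
  have h := gcomm_osc D false u m q j k rfl
  simp only [eq_comm (a := false)] at h
  cases u <;> exact h

/-- Either oscillator may contract with the factor α_{-m}, or both may hit L_m; these are the three
terms on the right. -/
theorem dcomm_alpha_vir (a : ℝ) (m : ℤ) (j : Fin (D - 2)) :
    dcomm D (alpha D (-m) j * virasoro D a m) t p i u q k =
      (if t = false ∧ j = i ∧ m = p then ((m : ℂ) * virCoeff u m q) • osc D u (m + q) k else 0)
      + (if u = false ∧ j = k ∧ m = q then ((m : ℂ) * virCoeff t m p) • osc D t (m + p) i else 0)
      - (if t = u ∧ i = k ∧ m + p + q = 0 then (virCoeff t m p * oscNorm t (m + p)) • alpha D (-m) j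
        else 0) := by
  have e1 : -m + p = 0 ↔ m = p := by omega
  have e2 : -m + q = 0 ↔ m = q := by omega
  have h1 : gcomm 1 (alpha D (-m) j * virasoro D a m) (osc D t p i) =
      (-virCoeff t m p) • (alpha D (-m) j * osc D t (m + p) i)
      + (if t = false ∧ j = i ∧ m = p then -(m : ℂ) else 0) • virasoro D a m := by
    rw [gcomm_one_mul_left, gcomm_virasoro, gcomm_alpha, mul_smul_comm, smul_mul_assoc, one_mul]
    push_cast
    simp only [e1]
  have h2 : gcomm (exSign t u) (alpha D (-m) j * osc D t (m + p) i) (osc D u q k) =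
      (if t = u ∧ i = k ∧ m + p + q = 0 then oscNorm t (m + p) else 0) • alpha D (-m) j
      + (if u = false ∧ j = k ∧ m = q then -(m : ℂ) else 0) • osc D t (m + p) i := by
    have h := gcomm_mul_left 1 (alpha D (-m) j) (osc D t (m + p) i) (osc D u q k) (exSign t u)
    rw [mul_one, osc_gcomm, gcomm_alpha] at h
    rw [h, mul_smul_comm, smul_mul_assoc, one_mul, mul_one, smul_smul]
    simp only [e2]
    push_cast
    congr 2
    cases u <;> cases t <;> simp [exSign]
  rw [dcomm, h1, gcomm_add_left, gcomm_smul_left, gcomm_smul_left, h2]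
  have h3 : (if t = false ∧ j = i ∧ m = p then -(m : ℂ) else 0) •
      gcomm (exSign t u) (virasoro D a m) (osc D u q k) =
      (if t = false ∧ j = i ∧ m = p then ((m : ℂ) * virCoeff u m q) • osc D u (m + q) k else 0) := by
    by_cases h : t = false ∧ j = i ∧ m = p
    · rw [if_pos h, if_pos h]
      have : exSign t u = 1 := by rw [h.1]; cases u <;> rfl
      rw [this, gcomm_virasoro, smul_smul]
      ring_nf
    · rw [if_neg h, if_neg h, zero_smul]
  rw [h3]
  split_ifs <;> module

/-- The two orderings differ by m α_0, and α_0 commutes with every oscillator. So the ordering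
prescription in E^j does not affect double commutators, and E^j can be treated as a sum of (1/m)
α_{-m} L_m over all m ≠ 0. -/
theorem dcomm_vir_alpha (a : ℝ) (m : ℤ) (j : Fin (D - 2)) :
    dcomm D (virasoro D a m * alpha D (-m) j) t p i u q k =
      dcomm D (alpha D (-m) j * virasoro D a m) t p i u q k := by
  have h : virasoro D a m * alpha D (-m) j = alpha D (-m) j * virasoro D a m
      + (m : ℂ) • alpha D 0 j := by
    have h := gcomm_virasoro D a m (-m) false j
    rw [gcomm, one_smul, sub_eq_iff_eq_add'] at h
    change virasoro D a m * alpha D (-m) j = alpha D (-m) j * virasoro D a m + _ at h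
    rw [h, virCoeff, add_neg_cancel]
    push_cast
    rw [neg_neg]
    rfl
  rw [h, dcomm_add, dcomm_smul]
  have h0 : gcomm 1 (alpha D 0 j) (osc D t p i) = 0 := by
    rw [gcomm_alpha]
    split_ifs with h
    · simp
    · simp
  rw [dcomm, dcomm, h0, gcomm_zero_left, smul_zero, add_zero]

/-- Only m = p, m = q and m = -(p + q) contribute to the sum over m ≠ 0. The conditions p ≠ 0 and q
≠ 0 reflect the missing term m = 0. -/
theorem dcomm_eSum (a : ℝ) (j : Fin (D - 2)) :
    dcomm D (locSum (eTerm D a j) (eTerm_finite D a j)) t p i u q k =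
      (if t = false ∧ p ≠ 0 then kron j i * virCoeff u p q else 0) • osc D u (p + q) k
      + (if u = false ∧ q ≠ 0 then kron j k * virCoeff t q p else 0) • osc D t (p + q) i
      + (if t = u then kron i k * (virCoeff t (-(p + q)) p * oscNorm t (-q) / (p + q)) else 0) •
        osc D false (p + q) j := by
  obtain ⟨hf, h⟩ := dcomm_locSum D t u p q i k (eTerm D a j) (eTerm_finite D a j)
  rw [h, locSum_signed_three _ hf
    (fun m => (1 / (m : ℂ)) • dcomm D (alpha D (-m) j * virasoro D a m) t p i u q k) p q (-(p + q))
    (if t = false then (kron j i * virCoeff u p q) • osc D u (p + q) k else 0)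
    (if u = false then (kron j k * virCoeff t q p) • osc D t (p + q) i else 0)
    (if t = u then (kron i k * (virCoeff t (-(p + q)) p * oscNorm t (-q) / (p + q))) •
        osc D false (p + q) j else 0)]
  · congr 1
    · congr 1
      · by_cases h1 : t = false <;> by_cases h2 : p = 0 <;> simp [h1, h2]
      · by_cases h1 : u = false <;> by_cases h2 : q = 0 <;> simp [h1, h2]
    · by_cases h1 : t = u <;> by_cases h2 : -(p + q) = 0 <;> simp only [h1, h2, if_true, if_false]
      -- Here the third contribution would sit at the absent index m = 0. The right-hand side agrees
      -- because a quotient by zero is zero.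
      · have : (p : ℂ) + q = 0 := by
          have : p + q = 0 := by omega
          exact_mod_cast this
        simp [this]
      · simp
      · simp
  · intro m hm
    have hm' : (m : ℂ) ≠ 0 := by exact_mod_cast hm
    rw [dcomm_alpha_vir, smul_sub, smul_add, sub_eq_add_neg]
    congr 1
    · congr 1
      · by_cases h1 : m = p
        · subst h1
          by_cases h2 : t = false <;> by_cases h3 : j = i <;> simp [h2, h3, kron, smul_smul, hm']
        · simp [h1]
      · by_cases h1 : m = q
        · subst h1
          by_cases h2 : u = false <;> by_cases h3 : j = k <;>
            simp [h2, h3, kron, smul_smul, hm', add_comm]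
        · simp [h1]
    · by_cases h1 : m = -(p + q)
      · subst h1
        have e : -(p + q) + p + q = 0 := by omega
        have e2 : -(p + q) + p = -q := by omega
        by_cases h2 : t = u <;> by_cases h3 : i = k
        · rw [if_pos ⟨h2, h3, e⟩, if_pos rfl, if_pos h2, e2, neg_neg, smul_smul, ← neg_smul]
          change _ • osc D false (p + q) j = _
          congr 1
          rw [h3, kron, if_pos rfl]
          push_cast at hm' ⊢
          have hm'' : (p : ℂ) + q ≠ 0 := by
            intro h; apply hm'; linear_combination -h
          field_simp
        · simp [h2, h3, kron]
        · simp [h2, h3]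
        · simp [h2, h3]
      · have e : ¬ (m + p + q = 0) := by omega
        rw [if_neg (fun h => e h.2.2), if_neg h1]
        simp
  · intro r
    rw [eTerm, dcomm_smul, dcomm_sub]
    have h2 := dcomm_vir_alpha D t u p q i k a (-((r : ℤ) + 1)) j
    rw [neg_neg] at h2
    rw [h2, neg_neg, smul_sub, sub_eq_add_neg, ← smul_neg]
    push_cast
    congr 1
    rw [smul_neg, ← neg_smul]
    congr 1
    rw [div_neg]

theorem alpha_commute_kac (m n : ℤ) (j l k : Fin (D - 2)) :
    Commute (alpha D n k) (kac D m j l) := by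
  have h := gcomm_kac_alpha D m n j l k
  rw [gcomm, one_smul, sub_eq_zero] at h
  exact h.symm

theorem dcomm_alpha_kac (m : ℤ) (j l : Fin (D - 2)) :
    dcomm D (alpha D (-m) l * kac D m j l) t p i u q k =
      match t, u with
      | false, false => 0
      | false, true => if l = i ∧ m = p then
          (-m : ℂ) • (kron l k • osc D true (m + q) j - kron j k • osc D true (m + q) l) else 0
      | true, false => if l = k ∧ m = q then
          (-m : ℂ) • (kron l i • osc D true (m + p) j - kron j i • osc D true (m + p) l) else 0
      | true, true => if m + p + q = 0 then
          (kron l i * kron j k - kron j i * kron l k) • osc D false (-m) l else 0 := by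
  have e1 : -m + p = 0 ↔ m = p := by omega
  have e2 : -m + q = 0 ↔ m = q := by omega
  have hf : ∀ (p : ℤ) (i : Fin (D - 2)), gcomm 1 (alpha D (-m) l * kac D m j l) (osc D false p i) =
      (if l = i ∧ -m + p = 0 then (-m : ℂ) else 0) • kac D m j l := by
    intro p i
    rw [gcomm_one_mul_left, gcomm_kac_alpha, gcomm_alpha, mul_zero, zero_add, smul_mul_assoc, one_mul]
    push_cast
    simp only [true_and]
  have ht : ∀ (p : ℤ) (i : Fin (D - 2)), gcomm 1 (alpha D (-m) l * kac D m j l) (osc D true p i) =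
      kron l i • (osc D false (-m) l * osc D true (m + p) j)
        - kron j i • (osc D false (-m) l * osc D true (m + p) l) := by
    intro p i
    rw [gcomm_one_mul_left, gcomm_kac_dOsc, gcomm_alpha, if_neg (by simp), zero_smul, zero_mul,
      add_zero, mul_sub, mul_smul_comm, mul_smul_comm]
    rfl
  cases t <;> cases u
  · rw [dcomm, hf, gcomm_smul_left]
    change _ • gcomm 1 _ _ = _
    rw [gcomm_kac_alpha, smul_zero]
  · rw [dcomm, hf, gcomm_smul_left]
    change _ • gcomm 1 _ _ = _
    rw [gcomm_kac_dOsc]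
    simp only [e1]
    split_ifs <;> simp
  · rw [dcomm, ht]
    change gcomm 1 _ _ = _
    rw [gcomm_sub_left, gcomm_smul_left, gcomm_smul_left, gcomm_one_mul_left, gcomm_one_mul_left,
      gcomm_osc D true false _ _ _ _ (s := 1) rfl, gcomm_osc D true false _ _ _ _ (s := 1) rfl,
      gcomm_osc D false false _ _ _ _ (s := 1) rfl]
    simp only [e2, Bool.true_eq_false, false_and, if_false, zero_smul, mul_zero, zero_add, true_and,
      oscNorm, smul_mul_assoc, one_mul]
    push_cast
    split_ifs <;> module
  · rw [dcomm, ht, gcomm_sub_left, gcomm_smul_left, gcomm_smul_left]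
    have h : ∀ x : Fin (D - 2), gcomm (exSign true true) (osc D false (-m) l * osc D true (m + p) x)
        (osc D true q k) = (if x = k ∧ m + p + q = 0 then (1 : ℂ) else 0) • osc D false (-m) l := by
      intro x
      have h := gcomm_mul_left 1 (osc D false (-m) l) (osc D true (m + p) x) (osc D true q k)
        (exSign true true)
      rw [mul_one, osc_gcomm, gcomm_osc D false true _ _ _ _ (s := 1) rfl] at h
      rw [h]
      simp [oscNorm]
    rw [h, h]
    by_cases h3 : m + p + q = 0 <;> simp only [h3, kron, and_true, and_false, if_true, if_false] <;>
      module

/-- The separate zero-mode term of F^j is exactly the summand m = 0 of the sum of α_{-m} K_m. The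
sum thus runs over all integers, and unlike for E^j no index is exceptional. -/
theorem dcomm_opYF (j : Fin (D - 2)) :
    dcomm D (opYF D j) t p i u q k =
      match t, u with
      | false, false => 0
      | false, true =>
          (-p : ℂ) • (kron i k • osc D true (p + q) j - kron j k • osc D true (p + q) i)
      | true, false =>
          (-q : ℂ) • (kron i k • osc D true (p + q) j - kron j i • osc D true (p + q) k)
      | true, true => kron j k • osc D false (p + q) i - kron j i • osc D false (p + q) k := by
  obtain ⟨a, U, hU, h⟩ : ∃ (a : ℤ) (U : Module.End ℂ (Dom D)),
      (U = match t, u with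
      | false, false => 0
      | false, true =>
          (-p : ℂ) • (kron i k • osc D true (p + q) j - kron j k • osc D true (p + q) i)
      | true, false =>
          (-q : ℂ) • (kron i k • osc D true (p + q) j - kron j i • osc D true (p + q) k)
      | true, true => kron j k • osc D false (p + q) i - kron j i • osc D false (p + q) k) ∧
      ∀ m : ℤ, dcomm D (∑ l, alpha D (-m) l * kac D m j l) t p i u q k = if m = a then U else 0 := by
    cases t <;> cases u
    · refine ⟨0, _, rfl, fun m => ?_⟩
      simp only [dcomm_sum, dcomm_alpha_kac]
      simp
    · refine ⟨p, _, rfl, fun m => ?_⟩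
      simp only [dcomm_sum, dcomm_alpha_kac, ite_and]
      rw [Finset.sum_ite_eq' Finset.univ i, if_pos (Finset.mem_univ _)]
      by_cases h : m = p
      · rw [if_pos h, if_pos h, h]
      · rw [if_neg h, if_neg h]
    · refine ⟨q, _, rfl, fun m => ?_⟩
      simp only [dcomm_sum, dcomm_alpha_kac, ite_and]
      rw [Finset.sum_ite_eq' Finset.univ k, if_pos (Finset.mem_univ _)]
      by_cases h : m = q
      · rw [if_pos h, if_pos h, h, add_comm p q]
        simp only [kron, eq_comm (a := k)]
      · rw [if_neg h, if_neg h]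
    · refine ⟨-(p + q), _, rfl, fun m => ?_⟩
      simp only [dcomm_sum, dcomm_alpha_kac]
      by_cases h : m = -(p + q)
      · have h' : m + p + q = 0 := by omega
        simp only [if_pos h, h', if_true, kron, end_sub_smul, Finset.sum_sub_distrib, ite_smul, zero_smul, Finset.sum_ite_eq', Finset.mem_univ, mul_ite, mul_one,
          mul_zero, one_smul]
        rw [h, neg_neg]
        by_cases hjk : j = k <;> simp [hjk]
      · have h' : ¬ (m + p + q = 0) := by omega
        rw [if_neg h]
        simp [h']
  rw [← hU]
  have hc : ∀ m : ℤ, ∑ l, kac D m j l * alpha D (-m) l = ∑ l, alpha D (-m) l * kac D m j l :=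
    fun m => Finset.sum_congr rfl fun l _ => (alpha_commute_kac D m (-m) j l l).eq.symm
  have h0 := hc 0
  rw [neg_zero] at h0
  have h1 := h 0
  rw [neg_zero] at h1
  obtain ⟨hf, h2⟩ := dcomm_locSum D t u p q i k (fTerm D j) (fTerm_finite D j)
  rw [opYF, dcomm_add, h0, h1, h2, locSum_signed_three _ hf
    (fun m => dcomm D (∑ l, alpha D (-m) l * kac D m j l) t p i u q k) a 0 0 U 0 0]
  -- The single contributing index a is found in the zero-mode term if it is 0 and in the infinite
  -- sum otherwise.
  · by_cases ha : a = 0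
    · simp [ha]
    · simp [ha, Ne.symm ha]
  · intro m _
    rw [h]
    simp
  · intro r
    rw [← dcomm_add, fTerm, Finset.sum_add_distrib]
    have h3 := hc (-((r : ℤ) + 1))
    rw [neg_neg] at h3
    rw [h3, neg_neg]

/-- All later computations rest on this formula: Y is cubic, so two commutators leave something
linear, with coefficients independent of a and of D. For p + q = 0 the conventions for division by
zero in `oscW` are the correct ones. -/
theorem dcomm_opY (a : ℝ) (j : Fin (D - 2)) :
    dcomm D (opY D a j) t p i u q k =
      (kron j i * oscU t p u q) • osc D (xor t u) (p + q) k
      + (kron j k * (exSign t u * oscU u q t p)) • osc D (xor t u) (p + q) i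
      + (kron i k * oscW t p u q) • osc D (xor t u) (p + q) j := by
  rw [opY, dcomm_add, dcomm_eSum, dcomm_opYF]
  cases t <;> cases u
  · simp only [true_and, if_true, oscU, oscW, exSign, Bool.xor_self, virCoeff, oscNorm, one_mul,
      add_zero, ite_not, mul_ite, mul_zero, ne_eq]
    congr 1
    congr 2
    push_cast
    ring
  · simp only [true_and, oscU, oscW, exSign, virCoeff, one_mul, ite_not, mul_ite, mul_zero,
      ne_eq, Bool.false_xor, Bool.true_eq_false, Bool.false_eq_true, false_and, if_false, zero_smul,
      add_zero]
    module
  · simp only [true_and, oscU, oscW, exSign, virCoeff, one_mul, ite_not, mul_ite, mul_zero,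
      ne_eq, Bool.true_xor, Bool.not_false, Bool.true_eq_false, false_and, if_false,
      zero_smul, add_zero, zero_add]
    module
  · simp only [if_true, oscU, oscW, exSign, Bool.xor_self, virCoeff, oscNorm,
      Bool.true_eq_false, false_and, if_false, zero_smul, zero_add]
    have e : (p + -((p + q : ℤ) : ℂ) / 2) * 1 / ((p : ℂ) + q) = ((p : ℂ) - q) / (2 * (p + q)) := by
      push_cast
      rw [div_mul_eq_div_div]
      ring
    have e' : ((-(p + q) : ℤ) : ℂ) = -((p + q : ℤ) : ℂ) := by push_cast; rfl
    rw [e', e]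
    module

end dcomm

/-! ### Rotations and energy -/

theorem gcomm_rotSum (D : ℕ) (j k : Fin (D - 2)) (t : Bool) (p : ℤ) (i : Fin (D - 2)) :
    gcomm 1 (locSum (rotTerm D j k) (rotTerm_finite D j k)) (osc D t p i) =
      if t = true ∨ p = 0 then 0 else kron k i • osc D t p j - kron j i • osc D t p k := by
  have key : ∀ m : ℤ, m ≠ 0 → (1 / (m : ℂ)) • gcomm 1 (alpha D (-m) j * alpha D m k) (osc D t p i) =
      (if m = -p then (if t = true then 0 else kron k i • osc D t p j) else 0)
      + (if m = p then (if t = true then 0 else -(kron j i • osc D t p k)) else 0)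
      + (if m = 0 then 0 else 0) := by
    intro m hm
    have hm' : (m : ℂ) ≠ 0 := by exact_mod_cast hm
    have h := gcomm_osc_mul D false t (-m) m p j k i
    change gcomm 1 (alpha D (-m) j * alpha D m k) (osc D t p i) = _ at h
    rw [h]
    cases t
    · simp only [true_and, oscNorm, exSign, one_mul, Bool.false_eq_true, if_false, ite_self,
        add_zero, smul_add, smul_smul]
      congr 1
      · by_cases h1 : m = -p
        · have e : m + p = 0 := by omega
          rw [if_pos h1, h1]
          by_cases h2 : k = i
          · rw [if_pos ⟨h2, by omega⟩, kron, if_pos h2, neg_neg]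
            rw [h1] at hm'
            rw [one_div_mul_cancel hm']
          · rw [if_neg (fun h => h2 h.1), kron, if_neg h2]; simp
        · rw [if_neg (fun h => h1 (by omega)), if_neg h1]; simp
      · by_cases h1 : m = p
        · rw [if_pos h1]
          by_cases h2 : j = i
          · rw [if_pos ⟨h2, by omega⟩, kron, if_pos h2, h1]
            rw [h1] at hm'
            push_cast
            rw [mul_neg, one_div_mul_cancel hm']
            module
          · rw [if_neg (fun h => h2 h.1), kron, if_neg h2]; simp
        · rw [if_neg (fun h => h1 (by omega)), if_neg h1]; simp
    · simp
  rw [gcomm_locSum, locSum_signed_three _ _ _ (-p) p 0 _ _ 0 key]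
  · cases t
    · by_cases hp : p = 0
      · simp [hp]
      · simp [hp]; abel
    · simp
  · intro r
    rw [rotTerm, gcomm_smul_left, gcomm_sub_left, smul_sub, sub_eq_add_neg]
    push_cast
    congr 1
    rw [neg_neg]
    have h := alpha_comm D ((r : ℤ) + 1) (-((r : ℤ) + 1)) j k
    obtain ⟨c, hc⟩ : ∃ c : ℂ, alpha D ((r : ℤ) + 1) j * alpha D (-((r : ℤ) + 1)) k
        = alpha D (-((r : ℤ) + 1)) k * alpha D ((r : ℤ) + 1) j + c • 1 := by
      rw [sub_eq_iff_eq_add'] at h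
      rw [h]
      split_ifs
      · exact ⟨_, rfl⟩
      · exact ⟨0, by simp⟩
    rw [hc, gcomm_add_left, gcomm_smul_one_left, add_zero, div_neg]
    module

/-- The momentum α_0 is the exception because the Fock space rotations do not move it; its rotation
is the orbital part added in `opT`. -/
theorem gcomm_opR (D : ℕ) (j k : Fin (D - 2)) (t : Bool) (p : ℤ) (i : Fin (D - 2)) :
    gcomm 1 (opR D j k) (osc D t p i) =
      if t = false ∧ p = 0 then 0 else kron k i • osc D t p j - kron j i • osc D t p k := by
  rw [opR, gcomm_add_left, gcomm_rotSum]
  cases t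
  · rw [gcomm_kac_alpha]; simp
  · rw [gcomm_kac_dOsc]; simp

/-- `x` lowers the energy by `w`. -/
def HasWeight {D : ℕ} (x : Module.End ℂ (Dom D)) (w : ℂ) : Prop :=
  gcomm 1 x (ham D) = w • x

namespace HasWeight
variable {D : ℕ} {x y : Module.End ℂ (Dom D)} {w w' : ℂ}

theorem mul (hx : HasWeight x w) (hy : HasWeight y w') : HasWeight (x * y) (w + w') := by
  unfold HasWeight at *
  rw [gcomm_one_mul_left, hx, hy, mul_smul_comm, smul_mul_assoc, add_smul, add_comm]

theorem smul (hx : HasWeight x w) (c : ℂ) : HasWeight (c • x) w := by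
  unfold HasWeight at *
  rw [gcomm_smul_left, hx, smul_comm]

theorem add (hx : HasWeight x w) (hy : HasWeight y w) : HasWeight (x + y) w := by
  unfold HasWeight at *
  rw [gcomm_add_left, hx, hy, smul_add]

theorem sub (hx : HasWeight x w) (hy : HasWeight y w) : HasWeight (x - y) w := by
  unfold HasWeight at *
  rw [gcomm_sub_left, hx, hy, smul_sub]

theorem zero : HasWeight (0 : Module.End ℂ (Dom D)) w := by
  unfold HasWeight
  rw [gcomm_zero_left, smul_zero]

theorem sum {κ : Type*} (S : Finset κ) {f : κ → Module.End ℂ (Dom D)}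
    (h : ∀ i ∈ S, HasWeight (f i) w) : HasWeight (∑ i ∈ S, f i) w :=
  Finset.sum_induction f (HasWeight · w) (fun _ _ => add) zero h

theorem locSum {ι : Type*} {T : ι → Module.End ℂ (Dom D)}
    (hT : ∀ v, {i | T i v ≠ 0}.Finite) (h : ∀ i, HasWeight (T i) w) :
    HasWeight (locSum T hT) w := by
  unfold HasWeight at *
  rw [gcomm_locSum]
  exact locSum_smul w hT _ h

theorem one : HasWeight (1 : Module.End ℂ (Dom D)) 0 := by
  simp [HasWeight, gcomm]

theorem congr (hx : HasWeight x w) (h : w = w') : HasWeight x w' := h ▸ hx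

end HasWeight

theorem gcomm_ham (D : ℕ) (t : Bool) (p : ℤ) (i : Fin (D - 2)) :
    gcomm 1 (ham D) (osc D t p i) = (-p : ℂ) • osc D t p i := by
  rw [ham, gcomm_locSum, locSum_signed_three _ _
    (fun m : ℤ => if m = -p then (-p : ℂ) • osc D t p i else 0) (-p) 0 0
      ((-p : ℂ) • osc D t p i) 0 0]
  · by_cases hp : p = 0
    · simp [hp]
    · simp [hp]
  · intro m _; simp
  · intro r
    simp only [hamTerm, gcomm_sum_left, gcomm_add_left, gcomm_smul_left]
    have h1 : ∀ x, gcomm 1 (alpha D (-((r : ℤ) + 1)) x * alpha D ((r : ℤ) + 1) x) (osc D t p i) = _ :=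
      fun x => gcomm_osc_mul D false t (-((r : ℤ) + 1)) ((r : ℤ) + 1) p x x i
    have h2 : ∀ x, gcomm 1 (dOsc D (-((r : ℤ) + 1)) x * dOsc D ((r : ℤ) + 1) x) (osc D t p i) = _ :=
      fun x => gcomm_osc_mul D true t (-((r : ℤ) + 1)) ((r : ℤ) + 1) p x x i
    simp only [h1, h2]
    have e1 : (r : ℤ) + 1 + p = 0 ↔ (r : ℤ) + 1 = -p := by omega
    have e2 : -((r : ℤ) + 1) + p = 0 ↔ -((r : ℤ) + 1) = -p := by omega
    simp only [e1, e2]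
    by_cases h3 : (r : ℤ) + 1 = -p
    · have h4 : ¬ (-((r : ℤ) + 1) = -p) := by omega
      have h5 : (r : ℂ) + 1 = -(p : ℂ) := by exact_mod_cast h3
      simp only [h3, and_true, if_true, neg_neg, h5]
      have h6 : ¬ (p = -p) := by omega
      cases t <;> simp [oscNorm, h6]
    · by_cases h4 : -((r : ℤ) + 1) = -p
      · have h5 : (r : ℤ) + 1 = p := by omega
        have h6 : ¬ (p = -p) := by omega
        have h7 : (r : ℂ) + 1 = (p : ℂ) := by exact_mod_cast h5
        simp only [h5, h6, h7, and_true, and_false, if_true, if_false]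
        cases t
        · simp [oscNorm, exSign]
        · simp [oscNorm, exSign, smul_smul]
          exact (neg_smul _ _).symm
      · simp only [h3, h4, and_false, if_false, zero_smul, smul_zero, add_zero,
          Finset.sum_const_zero]

theorem hasWeight_osc (D : ℕ) (t : Bool) (p : ℤ) (i : Fin (D - 2)) : HasWeight (osc D t p i) p := by
  have h := gcomm_ham D t p i
  unfold HasWeight
  simp only [gcomm, one_smul] at h ⊢
  rw [← neg_sub, h]
  module

theorem hasWeight_alpha (D : ℕ) (p : ℤ) (i : Fin (D - 2)) : HasWeight (alpha D p i) p :=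
  hasWeight_osc D false p i

theorem hasWeight_dOsc (D : ℕ) (p : ℤ) (i : Fin (D - 2)) : HasWeight (dOsc D p i) p :=
  hasWeight_osc D true p i

theorem hasWeight_wickA (D : ℕ) (m n : ℤ) (i j : Fin (D - 2)) :
    HasWeight (wickA D m n i j) (m + n) := by
  unfold wickA
  split_ifs
  · exact (hasWeight_alpha _ _ _).mul (hasWeight_alpha _ _ _)
  · exact ((hasWeight_alpha _ _ _).mul (hasWeight_alpha _ _ _)).congr (add_comm _ _)

theorem hasWeight_wickD (D : ℕ) (m n : ℤ) (i j : Fin (D - 2)) :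
    HasWeight (wickD D m n i j) (m + n) := by
  have h1 := (hasWeight_dOsc D m i).mul (hasWeight_dOsc D n j)
  have h2 := ((hasWeight_dOsc D n j).mul (hasWeight_dOsc D m i)).congr (add_comm _ _)
  unfold wickD
  split_ifs
  · exact h1
  · exact (neg_one_smul ℂ (dOsc D n j * dOsc D m i)) ▸ h2.smul (-1)
  · exact (h1.sub h2).smul _

theorem hasWeight_virasoro (D : ℕ) (a : ℝ) (m : ℤ) : HasWeight (virasoro D a m) m := by
  refine (((HasWeight.locSum _ fun n => ?_).smul _).add
    ((HasWeight.locSum _ fun n => ?_).smul _)).add ?_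
  · exact HasWeight.sum _ fun i _ => (hasWeight_wickA _ _ _ _ _).congr (by push_cast; ring)
  · exact (HasWeight.sum _ fun i _ => (hasWeight_wickD _ _ _ _ _).congr (by push_cast; ring)).smul _
  · split_ifs with h
    · exact (HasWeight.one.smul _).congr (by simp [h])
    · exact HasWeight.zero

theorem hasWeight_kac (D : ℕ) (m : ℤ) (j k : Fin (D - 2)) : HasWeight (kac D m j k) m := by
  refine (HasWeight.locSum _ fun n => ?_).smul _
  exact ((hasWeight_wickD _ _ _ _ _).congr (by push_cast; ring)).sub
    ((hasWeight_wickD _ _ _ _ _).congr (by push_cast; ring))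

theorem hasWeight_opY (D : ℕ) (a : ℝ) (j : Fin (D - 2)) : HasWeight (opY D a j) 0 := by
  refine (HasWeight.locSum _ fun r => ?_).add
    ((HasWeight.locSum _ fun r => ?_).add (HasWeight.sum _ fun l _ => ?_))
  · refine HasWeight.smul (HasWeight.sub ?_ ?_) _
    · exact ((hasWeight_alpha _ _ _).mul (hasWeight_virasoro _ _ _)).congr (by push_cast; ring)
    · exact ((hasWeight_virasoro _ _ _).mul (hasWeight_alpha _ _ _)).congr (by push_cast; ring)
  · refine HasWeight.sum _ fun l _ => HasWeight.add ?_ ?_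
    · exact ((hasWeight_alpha _ _ _).mul (hasWeight_kac _ _ _ _)).congr (by push_cast; ring)
    · exact ((hasWeight_kac _ _ _ _).mul (hasWeight_alpha _ _ _)).congr (by push_cast; ring)
  · exact ((hasWeight_kac _ _ _ _).mul (hasWeight_alpha _ _ _)).congr (by simp)

theorem hasWeight_opR (D : ℕ) (j k : Fin (D - 2)) : HasWeight (opR D j k) 0 := by
  refine (HasWeight.locSum _ fun r => ?_).add ((hasWeight_kac _ _ _ _).congr (by simp))
  refine HasWeight.smul (HasWeight.sub ?_ ?_) _ <;>
  exact ((hasWeight_alpha _ _ _).mul (hasWeight_alpha _ _ _)).congr (by push_cast; ring)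

/-! ### Ground states -/

theorem virasoro_ground {D : ℕ} {g : Dom D} (h : AnnFrom 1 g) (a : ℝ) {m : ℤ} (hm : 0 < m) :
    virasoro D a m g = 0 := by
  have h1 := locSum_eq_zero (virATerm D m) (virATerm_finite D m) g
    fun n => virATerm_eq_zero h (by omega)
  have h2 := locSum_eq_zero (virDTerm D m) (virDTerm_finite D m) g
    fun n => virDTerm_eq_zero h (by omega)
  simp [virasoro, h1, h2, hm.ne']

theorem kac_ground {D : ℕ} {g : Dom D} (h : AnnFrom 1 g) {m : ℤ} (hm : 0 < m)
    (j k : Fin (D - 2)) : kac D m j k g = 0 := by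
  have h1 := locSum_eq_zero (kacTerm D m j k) (kacTerm_finite D m j k) g
    fun n => kacTerm_eq_zero h (by omega) j k
  simp [kac, h1]

theorem kac_zero_ground {D : ℕ} {g : Dom D} (h : AnnFrom 1 g) (j k : Fin (D - 2)) :
    kac D 0 j k g = (1 / 2 : ℂ) • (dOsc D 0 j (dOsc D 0 k g) - dOsc D 0 k (dOsc D 0 j g)) := by
  rw [kac, LinearMap.smul_apply, locSum_apply, finsum_eq_single _ (0 : ℤ)]
  · congr 1
    rw [kacTerm, wickD, wickD]
    simp only [neg_zero, add_zero, lt_irrefl, if_false, LinearMap.sub_apply, LinearMap.smul_apply,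
      Module.End.mul_apply]
    module
  · intro n hn
    exact kacTerm_eq_zero h (by omega) j k

theorem AnnFrom.osc_apply {D : ℕ} {g : Dom D} (h : AnnFrom 1 g) (t : Bool) {m : ℤ} (hm : 0 < m)
    (i : Fin (D - 2)) : osc D t m i g = 0 := by
  cases t
  · exact (h m (by omega) i).1
  · exact (h m (by omega) i).2

theorem annFrom_one_of {D : ℕ} {g : Dom D}
    (h : ∀ (t : Bool) (m : ℤ) (i : Fin (D - 2)), 0 < m → osc D t m i g = 0) : AnnFrom 1 g :=
  fun m hm i => ⟨h false m i (by omega), h true m i (by omega)⟩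

/-- In every summand with m > 0 an operator that kills ground states stands on the right. Only the
zero-mode term K_0 α_0 survives. -/
theorem opY_ground {D : ℕ} {g : Dom D} (h : AnnFrom 1 g) (a : ℝ) (j : Fin (D - 2)) :
    opY D a j g = ∑ l, (1 / 2 : ℂ) • (dOsc D 0 j (dOsc D 0 l (alpha D 0 l g))
      - dOsc D 0 l (dOsc D 0 j (alpha D 0 l g))) := by
  have h0 : ∀ l, AnnFrom 1 (alpha D 0 l g) := by
    intro l
    refine annFrom_one_of fun t m i hm => ?_
    have h1 := gcomm_alpha D t m i 0 l
    rw [if_neg (by omega), zero_smul, gcomm, one_smul, sub_eq_zero] at h1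
    rw [← Module.End.mul_apply, ← h1, Module.End.mul_apply, h.osc_apply t hm, map_zero]
  have h1 := locSum_eq_zero (eTerm D a j) (eTerm_finite D a j) g fun r => by
    have := virasoro_ground h a (m := (r : ℤ) + 1) (by omega)
    simp [eTerm, this, (h ((r : ℤ) + 1) (by omega) j).1]
  have h2 := locSum_eq_zero (fTerm D j) (fTerm_finite D j) g fun r => by
    have := kac_ground h (m := (r : ℤ) + 1) (by omega)
    simp [fTerm, LinearMap.sum_apply, this, fun l => (h ((r : ℤ) + 1) (by omega) l).1]
  rw [opY, opYF, LinearMap.add_apply, LinearMap.add_apply, h1, h2, LinearMap.sum_apply, zero_add,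
    zero_add]
  refine Finset.sum_congr rfl fun l _ => ?_
  rw [Module.End.mul_apply, kac_zero_ground (h0 l)]

theorem opR_ground {D : ℕ} {g : Dom D} (h : AnnFrom 1 g) (j k : Fin (D - 2)) :
    opR D j k g = (1 / 2 : ℂ) • (dOsc D 0 j (dOsc D 0 k g) - dOsc D 0 k (dOsc D 0 j g)) := by
  have h1 := locSum_eq_zero (rotTerm D j k) (rotTerm_finite D j k) g fun r => by
    simp [rotTerm, fun l => (h ((r : ℤ) + 1) (by omega) l).1]
  rw [opR, LinearMap.add_apply, h1, zero_add, kac_zero_ground h]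

theorem ham_apply_of_ann {D : ℕ} {m : ℕ} {v : Dom D}
    (h : ∀ (t : Bool) (r : ℤ) (i : Fin (D - 2)), (m : ℤ) < r → osc D t r i v = 0) :
    ham D v = ∑ r ∈ Finset.range m, ∑ i, (alpha D (-((r : ℤ) + 1)) i (alpha D ((r : ℤ) + 1) i v)
      + ((r : ℂ) + 1) • dOsc D (-((r : ℤ) + 1)) i (dOsc D ((r : ℤ) + 1) i v)) := by
  rw [ham, locSum_apply, finsum_eq_sum_of_support_subset (s := Finset.range m)]
  · simp [hamTerm, LinearMap.sum_apply]
  · intro r hr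
    by_contra hc
    simp only [Finset.coe_range, Set.mem_Iio, not_lt] at hc
    apply hr
    have h1 : ∀ i, alpha D ((r : ℤ) + 1) i v = 0 := fun i => h false _ i (by omega)
    have h2 : ∀ i, dOsc D ((r : ℤ) + 1) i v = 0 := fun i => h true _ i (by omega)
    simp [hamTerm, LinearMap.sum_apply, h1, h2]

theorem ham_ground {D : ℕ} {g : Dom D} (h : AnnFrom 1 g) : ham D g = 0 := by
  rw [ham_apply_of_ann (m := 0) fun t r i hr => h.osc_apply t hr i]
  simp

/-! ### Cyclicity of the vacuum -/

/-- Creation operators fill the modes one at a time, each with a nonzero coefficient. The Fermi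
modes with m = 0 are filled by d_0, whose annihilation part vanishes on an empty mode.
Multiplication by α_0 is not needed because all test functions are already allowed on the vacuum. -/
theorem vacuum_cyclic {D : ℕ} (S : Submodule ℂ (Dom D))
    (h0 : ∀ f : TestFn D, f ⊗ₜ[ℂ] (Finsupp.single ((0, ∅) : FockIndex D) 1 : Fock D) ∈ S)
    (h1 : ∀ (t : Bool) (m : ℤ) (i : Fin (D - 2)), (t = true ∨ m ≠ 0) → m ≤ 0 →
      ∀ v ∈ S, osc D t m i v ∈ S) : S = ⊤ := by
  have hF : ∀ (T : Finset (ℕ ×ₗ Fin (D - 2))) (f : TestFn D),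
      f ⊗ₜ[ℂ] (Finsupp.single ((0, T) : FockIndex D) 1 : Fock D) ∈ S := by
    intro T
    induction T using Finset.induction_on with
    | empty => exact h0
    | insert x T hx ih =>
      intro f
      obtain ⟨k, i, rfl⟩ : ∃ k i, x = toLex (k, i) := ⟨(ofLex x).1, (ofLex x).2, rfl⟩
      have h2 := h1 true (-(k : ℤ)) i (Or.inl rfl) (by omega) _ (ih f)
      obtain ⟨c, hc, h3⟩ : ∃ c : ℂ, c ≠ 0 ∧ osc D true (-(k : ℤ)) i
          (f ⊗ₜ[ℂ] (Finsupp.single ((0, T) : FockIndex D) 1 : Fock D)) =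
          c • (f ⊗ₜ[ℂ] (Finsupp.single ((0, insert (toLex (k, i)) T) : FockIndex D) 1 : Fock D)) := by
        have hs : fermiSign T (toLex (k, i)) ≠ 0 := fun h => by
          have := fermiSign_mul_self T (toLex (k, i)); rw [h] at this; simp at this
        have hcre : fermiCre D k i (Finsupp.single ((0, T) : FockIndex D) 1) =
            fermiSign T (toLex (k, i)) •
              Finsupp.single ((0, insert (toLex (k, i)) T) : FockIndex D) 1 := by
          simp [hx]
        cases k with
        | zero =>
          refine ⟨((1 / Real.sqrt 2 : ℝ) : ℂ) * fermiSign T (toLex (0, i)), ?_, ?_⟩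
          · refine mul_ne_zero ?_ hs
            norm_num
          · change dOsc D 0 i _ = _
            rw [dOsc_zero, onFock, LinearMap.lTensor_tmul, LinearMap.smul_apply,
              LinearMap.add_apply, hcre, fermiAnn_single, if_neg hx, zero_add, smul_smul,
              TensorProduct.tmul_smul]
        | succ k =>
          refine ⟨fermiSign T (toLex (k + 1, i)), hs, ?_⟩
          change dOsc D (Int.negSucc k) i _ = _
          rw [dOsc_neg, onFock, LinearMap.lTensor_tmul, hcre, TensorProduct.tmul_smul]
      rw [h3] at h2
      exact (Submodule.smul_mem_iff S hc).1 h2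
  -- The initial occupation n' stays arbitrary so that additive induction on n can be iterated.
  have hB : ∀ (n n' : (ℕ × Fin (D - 2)) →₀ ℕ) (T : Finset (ℕ ×ₗ Fin (D - 2))) (f : TestFn D),
      f ⊗ₜ[ℂ] (Finsupp.single ((n', T) : FockIndex D) 1 : Fock D) ∈ S →
      f ⊗ₜ[ℂ] (Finsupp.single ((n' + n, T) : FockIndex D) 1 : Fock D) ∈ S := by
    intro n
    induction n using Finsupp.induction_linear with
    | zero => intro n' T f h; simpa using h
    | add a b ha hb =>
      intro n' T f h
      rw [← add_assoc]
      exact hb _ _ _ (ha _ _ _ h)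
    | single x q =>
      induction q with
      | zero => intro n' T f h; simpa using h
      | succ q ih =>
        intro n' T f h
        rw [Finsupp.single_add, ← add_assoc]
        obtain ⟨k, i⟩ := x
        have h2 := h1 false (Int.negSucc k) i (Or.inr (by omega)) (by omega) _ (ih _ _ _ h)
        change alpha D (Int.negSucc k) i _ ∈ S at h2
        set u := n' + Finsupp.single (k, i) q with hu
        rw [alpha_neg, onFock, LinearMap.lTensor_tmul, LinearMap.smul_apply, boseCre_single, one_mul,
          Finsupp.smul_single, ← mul_one (_ • _), ← smul_eq_mul, ← Finsupp.smul_single,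
          TensorProduct.tmul_smul] at h2
        refine (Submodule.smul_mem_iff S ?_).1 h2
        rw [smul_eq_mul]
        refine mul_ne_zero ?_ ?_
        · exact Complex.ofReal_ne_zero.2 (Real.sqrt_pos.2 (by positivity)).ne'
        · exact Complex.ofReal_ne_zero.2 (Real.sqrt_pos.2 (by positivity)).ne'
  rw [eq_top_iff]
  rintro v -
  induction v using TensorProduct.induction_on with
  | zero => exact S.zero_mem
  | add x y hx hy => exact S.add_mem hx hy
  | tmul f φ =>
    induction φ using Finsupp.induction_linear with
    | zero => rw [TensorProduct.tmul_zero]; exact S.zero_mem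
    | add x y hx hy => rw [TensorProduct.tmul_add]; exact S.add_mem hx hy
    | single s c =>
      have : (Finsupp.single s c : Fock D) = c • Finsupp.single s 1 := by simp
      rw [this, TensorProduct.tmul_smul]
      refine S.smul_mem _ ?_
      have := hB s.1 0 s.2 f (hF _ _)
      rwa [zero_add] at this

theorem annFrom_vacuum {D : ℕ} (f : TestFn D) :
    AnnFrom 1 (f ⊗ₜ[ℂ] (Finsupp.single ((0, ∅) : FockIndex D) 1 : Fock D)) := by
  refine annFrom_one_of fun t m i hm => ?_
  obtain ⟨k, rfl⟩ := Int.eq_succ_of_zero_lt hm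
  cases t
  · change alpha D (Int.ofNat (k + 1)) i _ = 0
    rw [alpha_pos, onFock, LinearMap.lTensor_tmul]
    simp
  · change dOsc D (Int.ofNat (k + 1)) i _ = 0
    rw [dOsc_pos, onFock, LinearMap.lTensor_tmul]
    simp

/-! ### Identities between the structure constants of Y -/

/-- The value of the graded commutator of two oscillators with the same transverse index. -/
def oscPair (t : Bool) (m : ℤ) (u : Bool) (n : ℤ) : ℂ :=
  if t = u ∧ m + n = 0 then oscNorm t m else 0

/-- This is the coefficient of δ_{j i₁} δ_{k i₂} φ^{i₃} in the triple commutator of the defect. The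
last term comes from 2 H R; the others come from [Y^j, Y^k]. -/
theorem oscU_identity {t u v : Bool} {p q r a b c : ℤ} (hp : t = true ∨ p ≠ 0)
    (hq : u = true ∨ q ≠ 0) (ha : a = p + q) (hb : b = p + r) (hc : c = q + r) :
    oscU u q v r * oscU t p (xor u v) c + exSign t u * oscU u q t p * oscU (xor t u) a v r
      - exSign t u * oscU t p v r * oscU u q (xor t v) b - oscU t p u q * oscU (xor t u) a v r
      + 2 * r * oscPair t p u q = 0 := by
  subst ha hb hc
  cases t <;> cases u
  · have hp : p ≠ 0 := by simpa using hp
    have hq : q ≠ 0 := by simpa using hq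
    by_cases h : p + q = 0
    · have hq' : q = -p := by omega
      subst hq'
      cases v <;> simp [oscU, oscPair, virCoeff, exSign, oscNorm, hp] <;> ring
    · cases v <;> simp [oscU, oscPair, virCoeff, exSign, hp, hq, h] <;> ring
  · have hp : p ≠ 0 := by simpa using hp
    cases v <;> simp [oscU, oscPair, virCoeff, exSign, hp] <;> ring
  · have hq : q ≠ 0 := by simpa using hq
    cases v <;> simp [oscU, oscPair, virCoeff, exSign, hq] <;> ring
  · by_cases h : p + q = 0
    · have hq' : q = -p := by omega
      subst hq'
      cases v <;> simp [oscU, oscPair, exSign, oscNorm] <;> ring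
    · cases v <;> simp [oscU, oscPair, virCoeff, exSign, h] <;> ring

/-- The coefficient of δ_{k i₁} δ_{i₂ i₃} φ^j in the triple commutator of the defect. The last two
terms come from 2 H R and from p^j Y^k. Since `oscW` has denominators, the loci q + r = 0 and p + q
+ r = 0 are treated apart. -/
theorem oscW_identity {t u v : Bool} {p q r a b c : ℤ} (hp : t = true ∨ p ≠ 0)
    (hq : u = true ∨ q ≠ 0) (hr : v = true ∨ r ≠ 0)
    (ha : a = p + q) (hb : b = p + r) (hc : c = q + r) :
    oscW u q v r * oscW t p (xor u v) c + exSign t u * oscU t p v r * oscW u q (xor t v) b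
      + exSign t v * exSign u v * oscU t p u q * oscW v r (xor t u) a
      - oscW u q v r * oscU t p (xor u v) c
      - 2 * (exSign t u * exSign t v) * q * oscPair u q v r
      + oscU t p u q * oscPair (xor t u) a v r = 0 := by
  subst ha hb hc
  by_cases h1 : q + r = 0
  · have hr' : r = -q := by omega
    subst hr'
    rcases eq_or_ne p 0 with rfl | h0
    · cases t <;> cases u <;> cases v <;>
      simp [oscU, oscW, oscPair, exSign, oscNorm] at hp hq hr ⊢ <;> (try ring)
    · cases t <;> cases u <;> cases v <;>
      simp [oscU, oscW, oscPair, virCoeff, exSign, oscNorm] at hp hq hr ⊢ <;>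
      (try simp [h0]) <;> (try field_simp) <;> (try ring)
  · have h1' : (q : ℂ) + r ≠ 0 := by exact_mod_cast h1
    by_cases h2 : p + q + r = 0
    · have hp' : p = -(q + r) := by omega
      subst hp'
      cases t <;> cases u <;> cases v <;>
      simp [oscU, oscW, oscPair, virCoeff, exSign, oscNorm, h1] at hp hq hr ⊢ <;>
      (try simp [hp]) <;> (try field_simp) <;> (try ring)
    · have h2' : (p : ℂ) + q + r ≠ 0 := by exact_mod_cast h2
      have h3' : (p : ℂ) + (q + r) ≠ 0 := by rwa [← add_assoc]
      have h4' : (q : ℂ) + (p + r) ≠ 0 := by intro h; apply h2'; linear_combination h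
      have h5' : (r : ℂ) + (p + q) ≠ 0 := by intro h; apply h2'; linear_combination h
      cases t <;> cases u <;> cases v <;>
      simp [oscU, oscW, oscPair, virCoeff, exSign, h1, h2] at hp hq hr ⊢ <;>
      (try simp only [hp, if_false]) <;> field_simp <;> ring

/-! ### Triple commutators -/

/-- The triple graded commutator of `x` with three oscillators. -/
def tcomm (D : ℕ) (x : Module.End ℂ (Dom D)) (t : Bool) (p : ℤ) (i : Fin (D - 2))
    (u : Bool) (q : ℤ) (k : Fin (D - 2)) (v : Bool) (r : ℤ) (l : Fin (D - 2)) :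
    Module.End ℂ (Dom D) :=
  gcomm (exSign t v * exSign u v) (dcomm D x t p i u q k) (osc D v r l)

/-- The graded Leibniz rule for a commutator [x, y]: the three oscillators are distributed over x
and y in all ways. With the signs fixed as ±1 it is an identity in a noncommutative ring. -/
theorem tcomm_aux {A : Type*} [Ring A] [Algebra ℂ A] (s12 s13 s23 : ℂ) (h12 : s12 * s12 = 1)
    (h13 : s13 * s13 = 1) (h23 : s23 * s23 = 1) (x y f g h : A) :
    gcomm (s13 * s23) (gcomm s12 (gcomm 1 (x * y - y * x) f) g) h =
      (gcomm 1 x (gcomm (s13 * s23) (gcomm s12 (gcomm 1 y f) g) h)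
        + gcomm (s12 * s13) (gcomm 1 x f) (gcomm s23 (gcomm 1 y g) h)
        + s12 • gcomm (s12 * s23) (gcomm 1 x g) (gcomm s13 (gcomm 1 y f) h)
        + (s13 * s23) • gcomm (s13 * s23) (gcomm 1 x h) (gcomm s12 (gcomm 1 y f) g))
      - (gcomm 1 y (gcomm (s13 * s23) (gcomm s12 (gcomm 1 x f) g) h)
        + gcomm (s12 * s13) (gcomm 1 y f) (gcomm s23 (gcomm 1 x g) h)
        + s12 • gcomm (s12 * s23) (gcomm 1 y g) (gcomm s13 (gcomm 1 x f) h)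
        + (s13 * s23) • gcomm (s13 * s23) (gcomm 1 y h) (gcomm s12 (gcomm 1 x f) g)) := by
  rcases mul_self_eq_one_iff.1 h12 with rfl | rfl <;>
  rcases mul_self_eq_one_iff.1 h13 with rfl | rfl <;>
  rcases mul_self_eq_one_iff.1 h23 with rfl | rfl <;>
  simp only [gcomm, one_smul, neg_smul, mul_one, mul_neg, neg_neg] <;> noncomm_ring

theorem kron_comm {n : ℕ} (j k : Fin n) : kron j k = kron k j := by
  unfold kron; simp only [eq_comm]

theorem exSign_xor (t u v : Bool) : exSign t (xor u v) = exSign t u * exSign t v := by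
  cases t <;> cases u <;> cases v <;> simp [exSign]

theorem osc_gcomm_pair (D : ℕ) (t u : Bool) (p q : ℤ) (i k : Fin (D - 2)) :
    gcomm (exSign t u) (osc D t p i) (osc D u q k) = (kron i k * oscPair t p u q) • 1 := by
  rw [osc_gcomm]
  congr 1
  unfold kron oscPair
  by_cases h1 : t = u <;> by_cases h2 : i = k <;> by_cases h3 : p + q = 0 <;> simp [h1, h2, h3]

/-- Where the pairing is nonzero the types agree and p + q = 0, so φ_r may be relabelled as the
oscillator of total mode and total type. This brings all terms of a triple commutator to a common
form. -/
theorem oscPair_smul_osc (D : ℕ) (t u v : Bool) (p q r : ℤ) (l : Fin (D - 2)) {w : Bool} {n : ℤ}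
    (hw : w = xor (xor t u) v) (hn : n = p + q + r) :
    oscPair t p u q • osc D v r l = oscPair t p u q • osc D w n l := by
  unfold oscPair
  split_ifs with h
  · rw [hw, hn, h.1, h.2, Bool.xor_self, Bool.false_xor, zero_add]
  · rw [zero_smul, zero_smul]

theorem oscPair_smul_osc_left (D : ℕ) (t u v : Bool) (p q r : ℤ) (l : Fin (D - 2)) {w : Bool} {n : ℤ}
    (hw : w = xor t (xor u v)) (hn : n = p + (q + r)) :
    oscPair u q v r • osc D t p l = oscPair u q v r • osc D w n l := by
  unfold oscPair
  split_ifs with h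
  · rw [hw, hn, h.1, h.2, Bool.xor_self, Bool.xor_false, add_zero]
  · rw [zero_smul, zero_smul]

theorem oscPair_smul_alpha (D : ℕ) (t u : Bool) (p q : ℤ) (l : Fin (D - 2)) {w : Bool} {n : ℤ}
    (hw : w = xor t u) (hn : n = p + q) :
    oscPair t p u q • alpha D 0 l = oscPair t p u q • osc D w n l := by
  unfold oscPair
  split_ifs with h
  · rw [hw, hn, h.1, h.2, Bool.xor_self]; rfl
  · rw [zero_smul, zero_smul]

/-- The inner double commutator is linear in the oscillators, so `dcomm_opY` applies a second time,
term by term. -/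
theorem nested_gcomm_opY (D : ℕ) (a : ℝ) (j k : Fin (D - 2)) (t u v : Bool) (p q r : ℤ)
    (i₁ i₂ i₃ : Fin (D - 2)) {w : Bool} {n c : ℤ} (hw : w = xor (xor t u) v) (hn : n = p + q + r)
    (hc : c = q + r) {s : ℂ} (hs : s = exSign t u * exSign t v) :
    gcomm s (gcomm 1 (opY D a j) (osc D t p i₁))
      (dcomm D (opY D a k) u q i₂ v r i₃) =
      (kron k i₂ * oscU u q v r) • ((kron j i₁ * oscU t p (xor u v) c) • osc D w n i₃
        + (kron j i₃ * (s * oscU (xor u v) c t p)) • osc D w n i₁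
        + (kron i₁ i₃ * oscW t p (xor u v) c) • osc D w n j)
      + (kron k i₃ * (exSign u v * oscU v r u q)) •
        ((kron j i₁ * oscU t p (xor u v) c) • osc D w n i₂
        + (kron j i₂ * (s * oscU (xor u v) c t p)) • osc D w n i₁
        + (kron i₁ i₂ * oscW t p (xor u v) c) • osc D w n j)
      + (kron i₂ i₃ * oscW u q v r) • ((kron j i₁ * oscU t p (xor u v) c) • osc D w n k
        + (kron j k * (s * oscU (xor u v) c t p)) • osc D w n i₁
        + (kron i₁ k * oscW t p (xor u v) c) • osc D w n j) := by
  have e : w = xor t (xor u v) := by rw [hw, Bool.xor_assoc]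
  have e2 : n = p + c := by omega
  subst hc
  rw [dcomm_opY, gcomm_add_right, gcomm_add_right, gcomm_smul_right, gcomm_smul_right,
    gcomm_smul_right, e, e2, hs, ← exSign_xor]
  rw [← dcomm_opY, ← dcomm_opY, ← dcomm_opY]
  rfl

/-! ### The defect of the bracket of Y^j and Y^k -/

/-- `H + p² / 2`. -/
def opH (D : ℕ) : Module.End ℂ (Dom D) :=
  ham D + (1 / 2 : ℂ) • ∑ l, alpha D 0 l * alpha D 0 l

/-- The defect of the bracket of `Y^j` and `Y^k`. -/
def opX (D : ℕ) (a : ℝ) (j k : Fin (D - 2)) : Module.End ℂ (Dom D) :=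
  (opY D a j * opY D a k - opY D a k * opY D a j)
    + (alpha D 0 j * opY D a k - alpha D 0 k * opY D a j) + (2 : ℂ) • (opH D * opR D j k)

theorem gcomm_alpha_zero (D : ℕ) (t : Bool) (p : ℤ) (j i : Fin (D - 2)) :
    gcomm 1 (alpha D 0 j) (osc D t p i) = 0 := by
  rw [gcomm_alpha]
  split_ifs with h <;> simp

theorem gcomm_opH (D : ℕ) (t : Bool) (p : ℤ) (i : Fin (D - 2)) :
    gcomm 1 (opH D) (osc D t p i) = (-p : ℂ) • osc D t p i := by
  rw [opH, gcomm_add_left, gcomm_ham, gcomm_smul_left, gcomm_sum_left]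
  simp only [gcomm_one_mul_left, gcomm_alpha_zero, mul_zero, zero_mul, add_zero,
    Finset.sum_const_zero, smul_zero]

/-- Both sides are the coefficient of δ_{i₁ i₂} δ_{j i₃} in the scalar triple commutator of Y, with
φ_r taken last on the left and first on the right. The order matters only up to sign since
oscillators have scalar graded commutators. -/
theorem oscW_oscPair {t u v : Bool} {p q r x y : ℤ} (hr : v = true ∨ r ≠ 0) (hx : x = p + q)
    (hy : y = p + r) : oscW t p u q * oscPair (xor t u) x v r =
      exSign t v * exSign u v * (oscU v r t p * oscPair (xor v t) y u q) := by
  subst hx hy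
  by_cases h : p + q + r = 0
  · have hp : p = -(q + r) := by omega
    subst hp
    cases t <;> cases u <;> cases v <;>
    simp [oscU, oscW, oscPair, virCoeff, exSign, oscNorm] at hr ⊢ <;>
    (try simp [hr]) <;> (try field_simp) <;> (try ring)
  · have h' : ¬ (p + r + q = 0) := by omega
    simp [oscPair, h, h']

section
variable (D : ℕ) (t u v : Bool) (p q r : ℤ) (i₁ i₂ i₃ : Fin (D - 2))

theorem gcomm_opR_of_ne (j k : Fin (D - 2)) (hp : t = true ∨ p ≠ 0) :
    gcomm 1 (opR D j k) (osc D t p i₁) = kron k i₁ • osc D t p j - kron j i₁ • osc D t p k := by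
  rw [gcomm_opR, if_neg]
  rintro ⟨rfl, rfl⟩
  simp at hp

theorem dcomm_opR (j k : Fin (D - 2)) (hp : t = true ∨ p ≠ 0) :
    dcomm D (opR D j k) t p i₁ u q i₂ =
      ((kron k i₁ * kron j i₂ - kron j i₁ * kron k i₂) * oscPair t p u q) • 1 := by
  rw [dcomm, gcomm_opR_of_ne _ _ _ _ _ _ hp, gcomm_sub_left, gcomm_smul_left, gcomm_smul_left,
    osc_gcomm_pair, osc_gcomm_pair]
  module

theorem dcomm_alpha_mul (j : Fin (D - 2)) (x : Module.End ℂ (Dom D)) :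
    dcomm D (alpha D 0 j * x) t p i₁ u q i₂ = alpha D 0 j * dcomm D x t p i₁ u q i₂ := by
  have h := gcomm_mul_left 1 (alpha D 0 j) (gcomm 1 x (osc D t p i₁)) (osc D u q i₂) (exSign t u)
  rw [gcomm_alpha_zero, zero_mul, smul_zero, add_zero, mul_one] at h
  rw [dcomm, dcomm, gcomm_one_mul_left, gcomm_alpha_zero, zero_mul, add_zero, h]

theorem dcomm_opH_opR (j k : Fin (D - 2)) (hp : t = true ∨ p ≠ 0) :
    dcomm D (opH D * opR D j k) t p i₁ u q i₂ =
      ((kron k i₁ * kron j i₂ - kron j i₁ * kron k i₂) * oscPair t p u q) • opH D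
      + (-(exSign t u * q) : ℂ) • (osc D u q i₂ * gcomm 1 (opR D j k) (osc D t p i₁))
      + (-p : ℂ) • (osc D t p i₁ * gcomm 1 (opR D j k) (osc D u q i₂)
        + (kron i₁ i₂ * oscPair t p u q) • opR D j k) := by
  have h1 := gcomm_mul_left 1 (opH D) (gcomm 1 (opR D j k) (osc D t p i₁)) (osc D u q i₂) (exSign t u)
  have h2 := gcomm_mul_left (exSign t u) (osc D t p i₁) (opR D j k) (osc D u q i₂) 1
  rw [mul_one] at h1
  rw [one_mul, one_smul] at h2
  have h3 := dcomm_opR D t u p q i₁ i₂ j k hp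
  rw [dcomm] at h3
  rw [h3, gcomm_opH] at h1
  rw [osc_gcomm_pair] at h2
  rw [dcomm, gcomm_one_mul_left, gcomm_opH, gcomm_add_left, h1,
    smul_mul_assoc (-p : ℂ) (osc D t p i₁), gcomm_smul_left, h2,
    mul_smul_comm, smul_mul_assoc, smul_mul_assoc, mul_one, one_mul, smul_smul, mul_neg]

theorem oscPair_smul_opH (c : ℂ) (hs : exSign t v * exSign u v = 1 ∨ oscPair t p u q = 0) :
    gcomm (exSign t v * exSign u v) ((c * oscPair t p u q) • opH D) (osc D v r i₃) =
      (c * oscPair t p u q * (-r)) • osc D v r i₃ := by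
  rcases hs with h | h
  · rw [h, gcomm_smul_left, gcomm_opH, smul_smul]
  · rw [h, mul_zero, zero_mul, zero_smul, zero_smul, gcomm_zero_left]

theorem oscPair_sign : exSign t v * exSign u v = 1 ∨ oscPair t p u q = 0 := by
  by_cases h : t = u
  · left; rw [h, exSign_mul_self]
  · right; rw [oscPair, if_neg]; exact fun h' => h h'.1

/-- Commutation with H scales φ_p by -p and commutation with R rotates its index, so every term is
an oscillator times a pairing of the other two. -/
theorem tcomm_opH_opR (j k : Fin (D - 2)) (hp : t = true ∨ p ≠ 0) (hq : u = true ∨ q ≠ 0)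
    (hr : v = true ∨ r ≠ 0) {w : Bool} {n : ℤ} (hw : w = xor (xor t u) v) (hn : n = p + q + r) :
    tcomm D (opH D * opR D j k) t p i₁ u q i₂ v r i₃ =
      ((kron k i₁ * kron j i₂ - kron j i₁ * kron k i₂) * oscPair t p u q * (-r)) • osc D w n i₃
      - (exSign t u * q * oscPair t p v r * (kron k i₁ * kron j i₃ - kron j i₁ * kron k i₃)) •
        osc D w n i₂
      - (exSign t u * q * exSign t v * oscPair u q v r * kron i₂ i₃) •
        (kron k i₁ • osc D w n j - kron j i₁ • osc D w n k)
      - (p * oscPair u q v r * (kron k i₂ * kron j i₃ - kron j i₂ * kron k i₃)) • osc D w n i₁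
      - (p * exSign u v * oscPair t p v r * kron i₁ i₃) •
        (kron k i₂ • osc D w n j - kron j i₂ • osc D w n k)
      - (p * oscPair t p u q * kron i₁ i₂) •
        (kron k i₃ • osc D w n j - kron j i₃ • osc D w n k) := by
  have ha : ∀ l, oscPair u q v r • osc D t p l = oscPair u q v r • osc D w n l := fun l =>
    oscPair_smul_osc_left D t u v p q r l (by rw [hw, Bool.xor_assoc]) (by omega)
  have hb : ∀ l, oscPair t p v r • osc D u q l = oscPair t p v r • osc D w n l := fun l =>
    oscPair_smul_osc_left D u t v q p r l
      (by rw [hw, Bool.xor_assoc, Bool.xor_left_comm]) (by omega)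
  have hc : ∀ l, oscPair t p u q • osc D v r l = oscPair t p u q • osc D w n l := fun l =>
    oscPair_smul_osc D t u v p q r l hw hn
  have h2 := gcomm_mul_left (exSign u v) (osc D u q i₂) (gcomm 1 (opR D j k) (osc D t p i₁))
    (osc D v r i₃) (exSign t v)
  have h3 := gcomm_mul_left (exSign t v) (osc D t p i₁) (gcomm 1 (opR D j k) (osc D u q i₂))
    (osc D v r i₃) (exSign u v)
  have h4 := dcomm_opR D t v p r i₁ i₃ j k hp
  have h5 := dcomm_opR D u v q r i₂ i₃ j k hq
  rw [dcomm] at h4 h5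
  rw [h4, osc_gcomm_pair, gcomm_opR_of_ne _ _ _ _ _ _ hp] at h2
  rw [h5, osc_gcomm_pair, gcomm_opR_of_ne _ _ _ _ _ _ hq, mul_comm (exSign u v)] at h3
  have h6 : gcomm (exSign t v * exSign u v) ((kron i₁ i₂ * oscPair t p u q) • opR D j k)
      (osc D v r i₃) = (kron i₁ i₂ * oscPair t p u q) •
        (kron k i₃ • osc D v r j - kron j i₃ • osc D v r k) := by
    rcases oscPair_sign t u v p q with h | h
    · rw [h, gcomm_smul_left, gcomm_opR_of_ne _ _ _ _ _ _ hr]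
    · rw [h, mul_zero, zero_smul, zero_smul, gcomm_zero_left]
  rw [tcomm, dcomm_opH_opR _ _ _ _ _ _ _ _ _ hp, gcomm_add_left, gcomm_add_left,
    oscPair_smul_opH _ _ _ _ _ _ _ _ _ (oscPair_sign t u v p q), gcomm_smul_left, gcomm_smul_left,
    gcomm_add_left, gcomm_opR_of_ne _ _ _ _ _ _ hp, gcomm_opR_of_ne _ _ _ _ _ _ hq, h2, h3, h6]
  simp only [mul_smul_comm, smul_mul_assoc, mul_one, one_mul]
  linear_combination (norm := module)
    (-(p * (kron k i₂ * kron j i₃ - kron j i₂ * kron k i₃)) : ℂ) • ha i₁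
    - (exSign t u * q * exSign t v * kron i₂ i₃ * kron k i₁) • ha j
    + (exSign t u * q * exSign t v * kron i₂ i₃ * kron j i₁) • ha k
    - (exSign t u * q * (kron k i₁ * kron j i₃ - kron j i₁ * kron k i₃)) • hb i₂
    - (p * exSign u v * kron i₁ i₃ * kron k i₂) • hb j
    + (p * exSign u v * kron i₁ i₃ * kron j i₂) • hb k
    + ((kron k i₁ * kron j i₂ - kron j i₁ * kron k i₂) * (-r)) • hc i₃
    - (p * kron i₁ i₂ * kron k i₃) • hc j + (p * kron i₁ i₂ * kron j i₃) • hc k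

/-- Three commutators exhaust the cubic operator Y and leave a scalar. This is what makes the
extreme terms of the Leibniz rule drop out in `tcomm_commutator`. -/
theorem tcomm_opY (a : ℝ) (j : Fin (D - 2)) {n : ℤ} {w : Bool} (hw : w = xor t u) (hn : n = p + q) :
    tcomm D (opY D a j) t p i₁ u q i₂ v r i₃ =
      (kron j i₁ * oscU t p u q * (kron i₂ i₃ * oscPair w n v r)
      + kron j i₂ * (exSign t u * oscU u q t p) * (kron i₁ i₃ * oscPair w n v r)
      + kron i₁ i₂ * oscW t p u q * (kron j i₃ * oscPair w n v r)) • 1 := by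
  have h : exSign t v * exSign u v = exSign w v := by
    rw [hw, exSign_comm (xor t u), exSign_xor, exSign_comm t, exSign_comm u]
  rw [tcomm, dcomm_opY, h, ← hw, ← hn, gcomm_add_left, gcomm_add_left, gcomm_smul_left, gcomm_smul_left,
    gcomm_smul_left, osc_gcomm_pair, osc_gcomm_pair, osc_gcomm_pair]
  module

/-- If the triple commutators of x and y are central, only the distributions with one oscillator on
one factor and two on the other remain. -/
theorem tcomm_commutator (x y : Module.End ℂ (Dom D)) (h₁ : ∀ z, gcomm 1 z (tcomm D x t p i₁ u q i₂ v r i₃) = 0)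
    (h₂ : ∀ z, gcomm 1 z (tcomm D y t p i₁ u q i₂ v r i₃) = 0) :
    tcomm D (x * y - y * x) t p i₁ u q i₂ v r i₃ =
      (gcomm (exSign t u * exSign t v) (gcomm 1 x (osc D t p i₁)) (dcomm D y u q i₂ v r i₃)
        + exSign t u • gcomm (exSign u t * exSign u v) (gcomm 1 x (osc D u q i₂))
          (dcomm D y t p i₁ v r i₃)
        + (exSign t v * exSign u v) • gcomm (exSign v t * exSign v u) (gcomm 1 x (osc D v r i₃))
          (dcomm D y t p i₁ u q i₂))
      - (gcomm (exSign t u * exSign t v) (gcomm 1 y (osc D t p i₁)) (dcomm D x u q i₂ v r i₃)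
        + exSign t u • gcomm (exSign u t * exSign u v) (gcomm 1 y (osc D u q i₂))
          (dcomm D x t p i₁ v r i₃)
        + (exSign t v * exSign u v) • gcomm (exSign v t * exSign v u) (gcomm 1 y (osc D v r i₃))
          (dcomm D x t p i₁ u q i₂)) := by
  have h := tcomm_aux (exSign t u) (exSign t v) (exSign u v) (exSign_mul_self _ _)
    (exSign_mul_self _ _) (exSign_mul_self _ _) x y (osc D t p i₁) (osc D u q i₂) (osc D v r i₃)
  change tcomm D (x * y - y * x) t p i₁ u q i₂ v r i₃ = _ at h
  rw [h]
  have e1 := h₁ y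
  have e2 := h₂ x
  unfold tcomm dcomm at e1 e2
  rw [e1, e2, zero_add, zero_add, exSign_comm u t, exSign_comm v t, exSign_comm v u]
  rfl

theorem gcomm_smul_one_right (z : Module.End ℂ (Dom D)) (c : ℂ) : gcomm 1 z (c • 1) = 0 := by
  simp [gcomm]

-- Both [Y^j, Y^k] and the correction terms have triple commutators linear in oscillators, and all
-- coefficients cancel by `oscU_identity` and `oscW_identity`. No sum over transverse indices
-- arises, which is why the dimension does not matter at this stage. The hypotheses exclude only the
-- momentum α_0.
set_option maxHeartbeats 2000000 in
theorem tcomm_opX (a : ℝ) {j k : Fin (D - 2)} (hjk : j ≠ k) (hp : t = true ∨ p ≠ 0)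
    (hq : u = true ∨ q ≠ 0) (hr : v = true ∨ r ≠ 0) :
    tcomm D (opX D a j k) t p i₁ u q i₂ v r i₃ = 0 := by
  obtain ⟨w, hw⟩ : ∃ w, w = xor (xor t u) v := ⟨_, rfl⟩
  obtain ⟨n, hn⟩ : ∃ n, n = p + q + r := ⟨_, rfl⟩
  obtain ⟨x, hx⟩ : ∃ x, x = p + q := ⟨_, rfl⟩
  obtain ⟨y, hy⟩ : ∃ y, y = p + r := ⟨_, rfl⟩
  obtain ⟨z, hz⟩ : ∃ z, z = q + r := ⟨_, rfl⟩
  have hk : kron j k = 0 := if_neg hjk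
  have hk' : kron k j = 0 := if_neg hjk.symm
  have hY : ∀ l b, gcomm 1 b (tcomm D (opY D a l) t p i₁ u q i₂ v r i₃) = 0 := fun l b => by
    rw [tcomm_opY _ _ _ _ _ _ _ _ _ _ a l rfl rfl, gcomm_smul_one_right]
  have hα : ∀ j k, tcomm D (alpha D 0 j * opY D a k) t p i₁ u q i₂ v r i₃ =
      (kron k i₁ * oscU t p u q * (kron i₂ i₃ * oscPair (xor t u) x v r)
      + kron k i₂ * (exSign t u * oscU u q t p) * (kron i₁ i₃ * oscPair (xor t u) x v r)
      + kron i₁ i₂ * oscW t p u q * (kron k i₃ * oscPair (xor t u) x v r)) • osc D w n j := by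
    intro j k
    have h := gcomm_mul_left 1 (alpha D 0 j) (dcomm D (opY D a k) t p i₁ u q i₂) (osc D v r i₃)
      (exSign t v * exSign u v)
    rw [gcomm_alpha_zero, zero_mul, smul_zero, add_zero, mul_one] at h
    rw [tcomm, dcomm_alpha_mul, h]
    change _ * tcomm D (opY D a k) t p i₁ u q i₂ v r i₃ = _
    rw [tcomm_opY _ _ _ _ _ _ _ _ _ _ a k rfl hx, mul_smul_comm, mul_one]
    have := oscPair_smul_alpha D (xor t u) v x r j hw (by omega : n = x + r)
    linear_combination (norm := module) (kron k i₁ * oscU t p u q * kron i₂ i₃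
      + kron k i₂ * (exSign t u * oscU u q t p) * kron i₁ i₃
      + kron i₁ i₂ * oscW t p u q * kron k i₃) • this
  have hsum : tcomm D (opX D a j k) t p i₁ u q i₂ v r i₃ =
      tcomm D (opY D a j * opY D a k - opY D a k * opY D a j) t p i₁ u q i₂ v r i₃
      + (tcomm D (alpha D 0 j * opY D a k) t p i₁ u q i₂ v r i₃
        - tcomm D (alpha D 0 k * opY D a j) t p i₁ u q i₂ v r i₃)
      + (2 : ℂ) • tcomm D (opH D * opR D j k) t p i₁ u q i₂ v r i₃ := by
    simp only [tcomm, dcomm, opX, gcomm_add_left, gcomm_sub_left, gcomm_smul_left]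
  have hw2 : w = xor (xor u t) v := by rw [hw, Bool.xor_comm t u]
  have hw3 : w = xor (xor v t) u := by rw [hw, Bool.xor_comm v, Bool.xor_right_comm]
  have hn2 : n = q + p + r := by omega
  have hn3 : n = r + p + q := by omega
  have A1 := oscU_identity (v := v) (r := r) hp hq hx hy hz
  have A2 := oscU_identity (v := u) (r := q) hp hr hy hx (hz.trans (add_comm _ _))
  have A3 := oscU_identity (v := t) (r := p) hq hr hz (hx.trans (add_comm _ _)) (hy.trans (add_comm _ _))
  have B1 := oscW_identity hp hq hr hx hy hz
  have B2 := oscW_identity hq hp hr (hx.trans (add_comm _ _)) hz hy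
  have B3 := oscW_identity hr hp hq (hy.trans (add_comm _ _)) (hz.trans (add_comm _ _)) hx
  rw [hsum, hα, hα, tcomm_opH_opR _ _ _ _ _ _ _ _ _ _ _ _ hp hq hr hw hn,
    tcomm_commutator _ _ _ _ _ _ _ _ _ _ _ _ (hY j) (hY k),
    nested_gcomm_opY D a j k t u v p q r i₁ i₂ i₃ hw hn hz rfl,
    nested_gcomm_opY D a j k u t v q p r i₂ i₁ i₃ hw2 hn2 hy rfl,
    nested_gcomm_opY D a j k v t u r p q i₃ i₁ i₂ hw3 hn3 hx rfl,
    nested_gcomm_opY D a k j t u v p q r i₁ i₂ i₃ hw hn hz rfl,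
    nested_gcomm_opY D a k j u t v q p r i₂ i₁ i₃ hw2 hn2 hy rfl,
    nested_gcomm_opY D a k j v t u r p q i₃ i₁ i₂ hw3 hn3 hx rfl, hk, hk']
  clear hsum hα hY hw hw2 hw3
  have C := oscW_oscPair (t := t) (u := u) (q := q) hr hx hy
  rw [kron_comm i₂ i₁, kron_comm i₃ i₁, kron_comm i₃ i₂, kron_comm i₁ k, kron_comm i₁ j,
    kron_comm i₂ k, kron_comm i₂ j, kron_comm i₃ k, kron_comm i₃ j]
  match_scalars
  all_goals
    replace A2 := congrArg (exSign u v * ·) A2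
    replace A3 := congrArg (exSign t u * exSign t v * ·) A3
    -- The signs are absorbed where the pairing is nonzero: there the two paired oscillators have
    -- equal statistics.
    have P3 : exSign t u * exSign t v * oscPair u q v r = oscPair u q v r := by
      cases t <;> cases u <;> cases v <;> simp [exSign, oscPair]
    have P2 : exSign u v * oscPair t p v r = exSign t u * oscPair t p v r := by
      cases t <;> cases u <;> cases v <;> simp [exSign, oscPair]
    replace B2 := congrArg (exSign t u * ·) B2
    replace B3 := congrArg (exSign t v * exSign u v * ·) B3
    clear hp hq hr
    cases t <;> cases u <;> cases v
  all_goals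
    simp only [exSign, Bool.xor_false, Bool.xor_true, Bool.not_false, Bool.not_true] at *
  -- The goals are the coefficients of φ^{i₃}, φ^{i₁}, φ^j, φ^{i₂} and φ^k in this order, each for
  -- the eight choices of statistics.
  iterate 8
    · linear_combination (kron j i₁ * kron k i₂ - kron j i₂ * kron k i₁) * A1
  iterate 8
    · linear_combination (kron j i₂ * kron k i₃ - kron j i₃ * kron k i₂) * (A3 - 2 * p * P3)
  iterate 8
    · linear_combination kron k i₁ * kron i₂ i₃ * B1 + kron k i₂ * kron i₁ i₃ * B2
        + kron k i₃ * kron i₁ i₂ * (B3 + C)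
  iterate 8
    · linear_combination (kron j i₁ * kron k i₃ - kron j i₃ * kron k i₁) * (A2 - 2 * q * P2)
  iterate 8
    · linear_combination -(kron j i₁ * kron i₂ i₃ * B1 + kron j i₂ * kron i₁ i₃ * B2
        + kron j i₃ * kron i₁ i₂ * (B3 + C))
end

/-! ### The action of the operators on ground states -/

theorem AnnFrom.osc_zero {D : ℕ} {g : Dom D} (h : AnnFrom 1 g) (t : Bool) (i : Fin (D - 2)) :
    AnnFrom 1 (osc D t 0 i g) := by
  refine annFrom_one_of fun u m l hm => ?_
  have h1 := osc_gcomm D u t m 0 l i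
  rw [if_neg (by omega), zero_smul, gcomm, sub_eq_zero] at h1
  rw [← Module.End.mul_apply, h1, LinearMap.smul_apply, Module.End.mul_apply, h.osc_apply u hm,
    map_zero, smul_zero]

theorem AnnFrom.add {D : ℕ} {g g' : Dom D} (h : AnnFrom 1 g) (h' : AnnFrom 1 g') :
    AnnFrom 1 (g + g') :=
  annFrom_one_of fun t m i hm => by rw [map_add, h.osc_apply t hm, h'.osc_apply t hm, add_zero]

theorem AnnFrom.smul {D : ℕ} {g : Dom D} (h : AnnFrom 1 g) (c : ℂ) : AnnFrom 1 (c • g) :=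
  annFrom_one_of fun t m i hm => by rw [map_smul, h.osc_apply t hm, smul_zero]

/-- The contraction `p_l d_0^l`. -/
def zeroD (D : ℕ) : Module.End ℂ (Dom D) := ∑ l, alpha D 0 l * dOsc D 0 l

theorem alpha_alpha_zero (D : ℕ) (i j : Fin (D - 2)) :
    alpha D 0 i * alpha D 0 j = alpha D 0 j * alpha D 0 i := by
  have h := alpha_comm D 0 0 i j
  rw [sub_eq_iff_eq_add] at h
  rw [h]
  simp

theorem dOsc_dOsc_zero (D : ℕ) (i j : Fin (D - 2)) :
    dOsc D 0 i * dOsc D 0 j = kron i j • 1 - dOsc D 0 j * dOsc D 0 i := by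
  have h := dOsc_anticomm D 0 0 i j
  rw [eq_sub_iff_add_eq, h, kron]
  by_cases h : i = j <;> simp [h]

theorem sum_kron_smul {n : ℕ} {M : Type*} [AddCommMonoid M] [Module ℂ M] (j : Fin n) (f : Fin n → M) :
    ∑ b, kron j b • f b = f j := by
  simp [kron]

theorem alpha_zero_zeroD (D : ℕ) (j : Fin (D - 2)) :
    alpha D 0 j * zeroD D = zeroD D * alpha D 0 j := by
  rw [zeroD, Finset.mul_sum, Finset.sum_mul]
  refine Finset.sum_congr rfl fun l _ => ?_
  rw [← mul_assoc, alpha_alpha_zero, mul_assoc, mul_assoc, (alpha_dOsc D 0 0 j l).eq]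

theorem zeroD_dOsc (D : ℕ) (j : Fin (D - 2)) :
    zeroD D * dOsc D 0 j = alpha D 0 j - dOsc D 0 j * zeroD D := by
  rw [zeroD, Finset.mul_sum, Finset.sum_mul, eq_sub_iff_add_eq, ← Finset.sum_add_distrib]
  rw [← sum_kron_smul j (fun b => alpha D 0 b)]
  refine Finset.sum_congr rfl fun l _ => ?_
  rw [mul_assoc, dOsc_dOsc_zero, mul_sub, mul_smul_comm, mul_one, ← mul_assoc (dOsc D 0 j),
    ← (alpha_dOsc D 0 0 l j).eq, mul_assoc, sub_add_cancel, kron_comm]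

/-- The zero modes d_0 generate a Clifford algebra, so p·d_0 is a Dirac operator with square p²/2.
-/
theorem zeroD_mul_self (D : ℕ) :
    zeroD D * zeroD D = (1 / 2 : ℂ) • ∑ l, alpha D 0 l * alpha D 0 l := by
  have h1 : ∀ s, zeroD D * s = ∑ l, alpha D 0 l * dOsc D 0 l * s := fun s => by
    rw [zeroD, Finset.sum_mul]
  have h2 : ∀ s, s * zeroD D = ∑ l, s * (alpha D 0 l * dOsc D 0 l) := fun s => by
    rw [zeroD, Finset.mul_sum]
  have h : zeroD D * zeroD D + zeroD D * zeroD D = ∑ l, alpha D 0 l * alpha D 0 l := by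
    conv_lhs => lhs; rw [h1]
    conv_lhs => rhs; rw [h2]
    rw [← Finset.sum_add_distrib]
    refine Finset.sum_congr rfl fun l _ => ?_
    rw [← mul_assoc, ← alpha_zero_zeroD, mul_assoc, mul_assoc, ← mul_add, zeroD_dOsc,
      add_sub_cancel]
  rw [← h]
  module

/-- The restriction of `Y^j` to the ground states. -/
def zeroY (D : ℕ) (j : Fin (D - 2)) : Module.End ℂ (Dom D) :=
  dOsc D 0 j * zeroD D - (1 / 2 : ℂ) • alpha D 0 j

/-- Anticommuting d_0^l past d_0^j turns the antisymmetrized product into d_0^j (p·d_0) - p^j/2. In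
this closed form products of several Y can be evaluated on ground states. -/
theorem opY_ground' {D : ℕ} {g : Dom D} (h : AnnFrom 1 g) (a : ℝ) (j : Fin (D - 2)) :
    opY D a j g = zeroY D j g := by
  have e : ∀ l, (1 / 2 : ℂ) • (dOsc D 0 j (dOsc D 0 l (alpha D 0 l g))
      - dOsc D 0 l (dOsc D 0 j (alpha D 0 l g))) =
      dOsc D 0 j (alpha D 0 l (dOsc D 0 l g)) - (1 / 2 : ℂ) • kron j l • alpha D 0 l g := by
    intro l
    have h1 := LinearMap.congr_fun (dOsc_dOsc_zero D l j) (alpha D 0 l g)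
    have h2 := LinearMap.congr_fun (alpha_dOsc D 0 0 l l).eq g
    simp only [Module.End.mul_apply, LinearMap.sub_apply, LinearMap.smul_apply,
      Module.End.one_apply] at h1 h2
    rw [h1, h2, kron_comm l j]
    module
  rw [opY_ground h, zeroY, LinearMap.sub_apply, Module.End.mul_apply, zeroD, LinearMap.sum_apply,
    map_sum, LinearMap.smul_apply]
  simp only [e, Finset.sum_sub_distrib, Module.End.mul_apply]
  rw [← Finset.smul_sum, sum_kron_smul j (fun l => alpha D 0 l g)]

/-- The counterpart of the defect for the zero modes, with p²/2 written as (p·d_0)². Moving p·d_0 to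
the right past d_0, and α_0 to the far right, makes all terms cancel. -/
theorem zeroY_comm (D : ℕ) (j k : Fin (D - 2)) :
    (zeroY D j * zeroY D k - zeroY D k * zeroY D j)
      + (alpha D 0 j * zeroY D k - alpha D 0 k * zeroY D j)
      + (dOsc D 0 j * dOsc D 0 k - dOsc D 0 k * dOsc D 0 j) * (zeroD D * zeroD D) = 0 := by
  have h1 := zeroD_dOsc D j
  have h2 := zeroD_dOsc D k
  have h3 := alpha_zero_zeroD D j
  have h4 := alpha_zero_zeroD D k
  have h6 := (alpha_dOsc D 0 0 j k).eq
  have h7 := (alpha_dOsc D 0 0 k j).eq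
  have h9 := alpha_alpha_zero D k j
  have e1 : ∀ x, zeroD D * (dOsc D 0 j * x) = alpha D 0 j * x - dOsc D 0 j * (zeroD D * x) :=
    fun x => by rw [← mul_assoc, h1, sub_mul, mul_assoc]
  have e2 : ∀ x, zeroD D * (dOsc D 0 k * x) = alpha D 0 k * x - dOsc D 0 k * (zeroD D * x) :=
    fun x => by rw [← mul_assoc, h2, sub_mul, mul_assoc]
  have e6 : ∀ x, alpha D 0 j * (dOsc D 0 k * x) = dOsc D 0 k * (alpha D 0 j * x) :=
    fun x => by rw [← mul_assoc, h6, mul_assoc]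
  have e7 : ∀ x, alpha D 0 k * (dOsc D 0 j * x) = dOsc D 0 j * (alpha D 0 k * x) :=
    fun x => by rw [← mul_assoc, h7, mul_assoc]
  simp only [zeroY, mul_sub, sub_mul, mul_smul_comm, smul_mul_assoc, mul_assoc, e1, e2, e6, e7,
    h3, h4, h9]
  module

theorem AnnFrom.zeroY {D : ℕ} {g : Dom D} (h : AnnFrom 1 g) (j : Fin (D - 2)) :
    AnnFrom 1 (zeroY D j g) := by
  have h1 : AnnFrom 1 (zeroD D g) := by
    rw [zeroD, LinearMap.sum_apply]
    refine Finset.sum_induction _ (AnnFrom 1) (fun _ _ => AnnFrom.add)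
      (annFrom_one_of fun t m i hm => map_zero _) fun l _ => ?_
    exact (h.osc_zero true l).osc_zero false l
  have h2 := (h1.osc_zero true j).add ((h.osc_zero false j).smul (-(1 / 2)))
  rw [neg_smul, ← sub_eq_add_neg] at h2
  exact h2

theorem opR_ground' {D : ℕ} {g : Dom D} (h : AnnFrom 1 g) {j k : Fin (D - 2)} (hjk : j ≠ k) :
    opR D j k g = dOsc D 0 j (dOsc D 0 k g) := by
  have h1 := LinearMap.congr_fun (dOsc_dOsc_zero D k j) g
  rw [kron, if_neg hjk.symm] at h1
  simp only [Module.End.mul_apply, zero_smul, zero_sub, LinearMap.neg_apply] at h1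
  rw [opR_ground h, h1]
  module

theorem opH_ground {D : ℕ} {g : Dom D} (h : AnnFrom 1 g) : opH D g = zeroD D (zeroD D g) := by
  rw [opH, LinearMap.add_apply, ham_ground h, zero_add, ← zeroD_mul_self, Module.End.mul_apply]

/-- Ground states are stable under Y, d_0 and p, so X acts on them through the zero modes, where H +
p²/2 is (p·d_0)² and R^{jk} is d_0^j d_0^k. The identity `zeroY_comm` then gives zero in every
dimension. -/
theorem opX_ground {D : ℕ} {g : Dom D} (h : AnnFrom 1 g) (a : ℝ) {j k : Fin (D - 2)} (hjk : j ≠ k) :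
    opX D a j k g = 0 := by
  have h1 := LinearMap.congr_fun (zeroY_comm D j k) g
  have h2 := LinearMap.congr_fun (dOsc_dOsc_zero D k j) (zeroD D (zeroD D g))
  rw [kron, if_neg hjk.symm] at h2
  have h3 : AnnFrom 1 (dOsc D 0 j (dOsc D 0 k g)) := (h.osc_zero true k).osc_zero true j
  have h4 : zeroD D (zeroD D (dOsc D 0 j (dOsc D 0 k g))) =
      dOsc D 0 j (dOsc D 0 k (zeroD D (zeroD D g))) := by
    have h : ∀ l, (zeroD D * zeroD D) * dOsc D 0 l = dOsc D 0 l * (zeroD D * zeroD D) := fun l => by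
      rw [mul_assoc, zeroD_dOsc, mul_sub, ← mul_assoc, zeroD_dOsc, sub_mul, alpha_zero_zeroD,
        sub_sub_cancel, mul_assoc]
    have h1 := LinearMap.congr_fun (h j) (dOsc D 0 k g)
    have h2 := congrArg (dOsc D 0 j) (LinearMap.congr_fun (h k) g)
    exact h1.trans h2
  simp only [Module.End.mul_apply, LinearMap.sub_apply, LinearMap.add_apply, LinearMap.zero_apply,
    zero_smul, zero_sub, LinearMap.neg_apply] at h1 h2
  simp only [opX, Module.End.mul_apply, LinearMap.sub_apply, LinearMap.add_apply, LinearMap.smul_apply,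
    opY_ground' h, opY_ground' (h.zeroY _), opR_ground' h hjk, opH_ground h3, h4]
  rw [h2] at h1
  linear_combination (norm := module) h1

theorem HasWeight.gcomm {D : ℕ} {x y : Module.End ℂ (Dom D)} {w w' : ℂ} (hx : HasWeight x w)
    (hy : HasWeight y w') (s : ℂ) : HasWeight (RamondString.gcomm s x y) (w + w') :=
  (hx.mul hy).sub (((hy.mul hx).congr (add_comm _ _)).smul s)

theorem hasWeight_opH (D : ℕ) : HasWeight (opH D) 0 := by
  refine HasWeight.add ?_ (HasWeight.smul (HasWeight.sum _ fun l _ => ?_) _)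
  · simp [HasWeight, gcomm]
  · exact ((hasWeight_alpha D 0 l).mul (hasWeight_alpha D 0 l)).congr (by simp)

theorem hasWeight_opX (D : ℕ) (a : ℝ) (j k : Fin (D - 2)) : HasWeight (opX D a j k) 0 := by
  have hY := hasWeight_opY D a
  have h1 : ∀ j k, HasWeight (opY D a j * opY D a k) 0 := fun j k =>
    ((hY j).mul (hY k)).congr (by simp)
  have h2 : ∀ j k, HasWeight (alpha D 0 j * opY D a k) 0 := fun j k =>
    ((hasWeight_alpha D 0 j).mul (hY k)).congr (by simp)
  refine (((h1 j k).sub (h1 k j)).add ((h2 j k).sub (h2 k j))).add (HasWeight.smul ?_ _)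
  exact ((hasWeight_opH D).mul (hasWeight_opR D j k)).congr (by simp)

theorem hasWeight_dcomm {D : ℕ} {x : Module.End ℂ (Dom D)} (hx : HasWeight x 0) (t u : Bool) (p q : ℤ)
    (i k : Fin (D - 2)) : HasWeight (dcomm D x t p i u q k) ((p + q : ℤ) : ℂ) :=
  ((hx.gcomm (hasWeight_osc D t p i) 1).gcomm (hasWeight_osc D u q k) _).congr (by push_cast; ring)

theorem HasWeight.apply {D : ℕ} {x : Module.End ℂ (Dom D)} {w : ℂ} (hx : HasWeight x w) {c : ℂ}
    {v : Dom D} (hv : ham D v = c • v) : ham D (x v) = (c - w) • x v := by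
  have h := LinearMap.congr_fun hx v
  simp only [RamondString.gcomm, one_smul, LinearMap.sub_apply, Module.End.mul_apply, LinearMap.smul_apply, hv,
    map_smul] at h
  rw [sub_smul, ← h, sub_sub_cancel]

theorem exSign_ne_zero (t u : Bool) : exSign t u ≠ 0 := by
  cases t <;> cases u <;> simp [exSign]

theorem gcomm_apply {D : ℕ} (s : ℂ) (x y : Module.End ℂ (Dom D)) (v : Dom D) :
    gcomm s x y v = x (y v) - s • y (x v) := rfl

/-! ### Double commutators of the defect on ground states -/

section
variable {D : ℕ} (a : ℝ) {j k : Fin (D - 2)} (hjk : j ≠ k) (t u v : Bool) (p q r : ℤ)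
  (i₁ i₂ i₃ : Fin (D - 2)) (hp : t = true ∨ p ≠ 0) (hq : u = true ∨ q ≠ 0) {g : Dom D}
include hjk hp hq

/-- This is the vanishing of the triple commutator, read as graded commutation of the double
commutator with each further oscillator. -/
theorem dcomm_opX_osc (hr : v = true ∨ r ≠ 0) (x : Dom D) :
    dcomm D (opX D a j k) t p i₁ u q i₂ (osc D v r i₃ x) =
      (exSign t v * exSign u v) • osc D v r i₃ (dcomm D (opX D a j k) t p i₁ u q i₂ x) := by
  have h := LinearMap.congr_fun (tcomm_opX D t u v p q r i₁ i₂ i₃ a hjk hp hq hr) x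
  rw [tcomm, gcomm_apply, LinearMap.zero_apply, sub_eq_zero] at h
  exact h

theorem annFrom_dcomm_opX (hg : AnnFrom 1 g) :
    AnnFrom 1 (dcomm D (opX D a j k) t p i₁ u q i₂ g) := by
  refine annFrom_one_of fun v r i hr => ?_
  have h := dcomm_opX_osc a hjk t u v p q r i₁ i₂ i hp hq (Or.inr hr.ne') g
  rw [hg.osc_apply v hr, map_zero, eq_comm, smul_eq_zero] at h
  exact h.resolve_left (mul_ne_zero (exSign_ne_zero _ _) (exSign_ne_zero _ _))

/-- The image is again a ground state and so has energy 0, while the operator changes the energy by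
-(p + q) ≠ 0. -/
theorem dcomm_opX_ground_of_ne (hg : AnnFrom 1 g) (h : p + q ≠ 0) :
    dcomm D (opX D a j k) t p i₁ u q i₂ g = 0 := by
  have h1 := ham_ground (annFrom_dcomm_opX a hjk t u p q i₁ i₂ hp hq hg)
  have h2 := (hasWeight_dcomm (hasWeight_opX D a j k) t u p q i₁ i₂).apply (c := 0)
    (by rw [ham_ground hg, zero_smul] : ham D g = (0 : ℂ) • g)
  rw [h1, eq_comm, smul_eq_zero, zero_sub, neg_eq_zero] at h2
  exact h2.resolve_left (by exact_mod_cast h)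

-- Zero modes preserve ground states, so each term in the expanded double commutator applies X to a
-- ground state.
omit hp hq in
theorem dcomm_opX_ground_zero (hg : AnnFrom 1 g) :
    dcomm D (opX D a j k) true 0 i₁ true 0 i₂ g = 0 := by
  have h1 := opX_ground (hg.osc_zero true i₁) a hjk
  have h2 := opX_ground (hg.osc_zero true i₂) a hjk
  have h3 := opX_ground ((hg.osc_zero true i₂).osc_zero true i₁) a hjk
  have h4 := opX_ground hg a hjk
  simp [dcomm, gcomm_apply, h1, h2, h3, h4]
end

/-- Graded Jacobi identity: the difference is the commutator of x with the graded commutator of the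
two oscillators, a scalar. -/
theorem dcomm_swap (D : ℕ) (x : Module.End ℂ (Dom D)) (t u : Bool) (p q : ℤ) (i k : Fin (D - 2)) :
    dcomm D x t p i u q k = exSign t u • dcomm D x u q k t p i := by
  have h : gcomm (exSign t u) (gcomm 1 x (osc D t p i)) (osc D u q k)
      - exSign t u • gcomm (exSign t u) (gcomm 1 x (osc D u q k)) (osc D t p i) =
      gcomm 1 x (gcomm (exSign t u) (osc D t p i) (osc D u q k)) := by
    have := exSign_mul_self t u
    simp only [gcomm, one_smul, mul_sub, sub_mul, smul_sub, mul_smul_comm, smul_mul_assoc, smul_smul,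
      this, mul_assoc]
    module
  rw [osc_gcomm, gcomm_smul_one_right, sub_eq_zero] at h
  rw [dcomm, dcomm, exSign_comm u t, h]

theorem dcomm_mul (D : ℕ) (x y : Module.End ℂ (Dom D)) (t u : Bool) (p q : ℤ) (i k : Fin (D - 2)) :
    dcomm D (x * y) t p i u q k = x * dcomm D y t p i u q k
      + exSign t u • (gcomm 1 x (osc D u q k) * gcomm 1 y (osc D t p i))
      + gcomm 1 x (osc D t p i) * gcomm 1 y (osc D u q k) + dcomm D x t p i u q k * y := by
  have h1 := gcomm_mul_left 1 x (gcomm 1 y (osc D t p i)) (osc D u q k) (exSign t u)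
  have h2 := gcomm_mul_left (exSign t u) (gcomm 1 x (osc D t p i)) y (osc D u q k) 1
  rw [mul_one] at h1
  rw [one_mul, one_smul] at h2
  rw [dcomm, gcomm_one_mul_left, gcomm_add_left, h1, h2]
  simp only [dcomm]
  abel

/-! ### The product of two single commutators on a ground state -/

theorem gcomm_opY_ground {D : ℕ} {g : Dom D} (hg : AnnFrom 1 g) (a : ℝ) (j : Fin (D - 2)) (u : Bool)
    {q : ℤ} (hq : 0 < q) (i : Fin (D - 2)) : gcomm 1 (opY D a j) (osc D u q i) g = 0 := by
  rw [gcomm_apply, hg.osc_apply u hq, map_zero, opY_ground' hg, (hg.zeroY j).osc_apply u hq,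
    smul_zero, sub_zero]

theorem osc_gcomm_opY_ground {D : ℕ} {g : Dom D} (hg : AnnFrom 1 g) (a : ℝ) (j : Fin (D - 2)) (t v : Bool)
    (p : ℤ) {r : ℤ} (hr : 0 < r) (i l : Fin (D - 2)) :
    osc D v r l (gcomm 1 (opY D a j) (osc D t p i) g) =
      -(exSign t v • dcomm D (opY D a j) t p i v r l g) := by
  rw [dcomm, gcomm_apply (exSign t v), hg.osc_apply v hr, map_zero, zero_sub, smul_neg, smul_smul, exSign_mul_self,
    one_smul, neg_neg]

theorem dcomm_opY_ground_of_pos {D : ℕ} {g : Dom D} (hg : AnnFrom 1 g) (a : ℝ) (j : Fin (D - 2))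
    (t v : Bool) (p r : ℤ) (hr : 0 < p + r) (i l : Fin (D - 2)) :
    dcomm D (opY D a j) t p i v r l g = 0 := by
  rw [dcomm_opY]
  simp [hg.osc_apply _ hr]

/-- The vector v = [Y^k, φ_{-(M+1)}] g has energy M + 1, so (M + 1) v = H v. Modes above M + 1
annihilate v, hence H v is a finite sum of creation times annihilation operators applied to v. An
annihilation operator turns v into a double commutator on g, and moving the outer operator past the
creation operator produces the second double commutator. -/
theorem gcomm_opY_mul_ground {D : ℕ} {g : Dom D} (hg : AnnFrom 1 g) (a : ℝ) (j k : Fin (D - 2))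
    (t u : Bool) (M : ℕ) (i₁ i₂ : Fin (D - 2)) :
    ((M : ℂ) + 1) • gcomm 1 (opY D a j) (osc D u ((M : ℤ) + 1) i₂)
        (gcomm 1 (opY D a k) (osc D t (-((M : ℤ) + 1)) i₁) g) =
      ∑ r ∈ Finset.range (M + 1), ∑ b,
        (-(dcomm D (opY D a j) u ((M : ℤ) + 1) i₂ false (-((r : ℤ) + 1)) b
            (dcomm D (opY D a k) t (-((M : ℤ) + 1)) i₁ false ((r : ℤ) + 1) b g))
        - (((r : ℂ) + 1) * exSign t true) •
          dcomm D (opY D a j) u ((M : ℤ) + 1) i₂ true (-((r : ℤ) + 1)) b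
            (dcomm D (opY D a k) t (-((M : ℤ) + 1)) i₁ true ((r : ℤ) + 1) b g)) := by
  set v := gcomm 1 (opY D a k) (osc D t (-((M : ℤ) + 1)) i₁) g with hv
  have h1 : ham D v = ((M : ℂ) + 1) • v := by
    have hw := ((hasWeight_opY D a k).gcomm (hasWeight_osc D t (-((M : ℤ) + 1)) i₁) 1)
    have h := hw.apply (c := 0) (by rw [ham_ground hg, zero_smul] : ham D g = (0 : ℂ) • g)
    rw [← hv] at h
    rw [h]
    push_cast
    congr 1
    ring
  rw [← map_smul, ← h1, ham_apply_of_ann (m := M + 1)]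
  · rw [map_sum]
    refine Finset.sum_congr rfl fun r hr => ?_
    rw [map_sum]
    refine Finset.sum_congr rfl fun b _ => ?_
    have hr' : (0 : ℤ) < (r : ℤ) + 1 := by omega
    have key : ∀ w : Bool, gcomm 1 (opY D a j) (osc D u ((M : ℤ) + 1) i₂)
        (osc D w (-((r : ℤ) + 1)) b (osc D w ((r : ℤ) + 1) b v)) =
        -(exSign t w • dcomm D (opY D a j) u ((M : ℤ) + 1) i₂ w (-((r : ℤ) + 1)) b
            (dcomm D (opY D a k) t (-((M : ℤ) + 1)) i₁ w ((r : ℤ) + 1) b g)) := by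
      intro w
      -- The inner double commutator is linear in oscillators of mode r - M. Commuting them through
      -- the outer operator raises the mode to r + 1 > 0, and such modes kill g; so only the
      -- commutator with the creation operator remains.
      have hz : gcomm 1 (opY D a j) (osc D u ((M : ℤ) + 1) i₂)
          (dcomm D (opY D a k) t (-((M : ℤ) + 1)) i₁ w ((r : ℤ) + 1) b g) = 0 := by
        rw [dcomm_opY, LinearMap.add_apply, LinearMap.add_apply, map_add, map_add]
        simp only [LinearMap.smul_apply, map_smul]
        have hz1 : ∀ x l, gcomm 1 (opY D a j) (osc D u ((M : ℤ) + 1) i₂)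
            (osc D x (-((M : ℤ) + 1) + ((r : ℤ) + 1)) l g) = 0 := by
          intro x l
          have h := gcomm_apply (exSign u x) (gcomm 1 (opY D a j) (osc D u ((M : ℤ) + 1) i₂))
            (osc D x (-((M : ℤ) + 1) + ((r : ℤ) + 1)) l) g
          rw [gcomm_opY_ground hg a j u (by omega), map_zero, smul_zero, sub_zero] at h
          rw [← h]
          exact dcomm_opY_ground_of_pos hg a j u x _ _ (by omega) _ _
        simp only [hz1, smul_zero, add_zero]
      have h := gcomm_apply (exSign u w) (gcomm 1 (opY D a j) (osc D u ((M : ℤ) + 1) i₂))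
        (osc D w (-((r : ℤ) + 1)) b)
        (dcomm D (opY D a k) t (-((M : ℤ) + 1)) i₁ w ((r : ℤ) + 1) b g)
      rw [hz, map_zero, smul_zero, sub_zero] at h
      rw [hv, osc_gcomm_opY_ground hg a k t w _ hr', map_neg, map_smul, map_neg, map_smul, ← h]
      rfl
    have k1 := key false
    have k2 := key true
    have hs : exSign t false = 1 := by cases t <;> rfl
    rw [hs, one_smul] at k1
    rw [map_add, map_smul, mul_smul, sub_eq_add_neg, ← smul_neg, ← k2, ← k1]
    rfl
  · intro w r i hr
    push_cast at hr
    rw [hv, osc_gcomm_opY_ground hg a k t w _ (by omega),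
      dcomm_opY_ground_of_pos hg a k t w _ _ (by omega), smul_zero, neg_zero]

/-- Of the nine products the one with δ_{jb} δ_{kb} vanishes because j ≠ k. The first term keeps a
genuine sum over b, through which the dimension enters. -/
theorem sum_bilinear {n : ℕ} {V : Type*} [AddCommGroup V] [Module ℂ V] {j k : Fin n} (hjk : j ≠ k)
    (c a : Fin n) (U U' W T T' W' : ℂ) (O O' : Fin n → Module.End ℂ V) (g : V) :
    ∑ b, ((kron j c * U) • O b + (kron j b * U') • O c + (kron c b * W) • O j)
      (((kron k a * T) • O' b + (kron k b * T') • O' a + (kron a b * W') • O' k) g) =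
      (kron j c * kron k a * (U * T)) • ∑ b, O b (O' b g) + (kron j c * (U * T')) • O k (O' a g)
      + (kron j c * (U * W')) • O a (O' k g) + (kron k a * (U' * T)) • O c (O' j g)
      + (kron k a * (W * T)) • O j (O' c g) + (kron j a * (U' * W')) • O c (O' k g)
      + (kron k c * (W * T')) • O j (O' a g) + (kron c a * (W * W')) • O j (O' k g) := by
  have hs : ∀ b, ((kron j c * U) • O b + (kron j b * U') • O c + (kron c b * W) • O j)
      (((kron k a * T) • O' b + (kron k b * T') • O' a + (kron a b * W') • O' k) g) =
      (kron j c * kron k a * (U * T)) • O b (O' b g)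
      + kron k b • (kron j c * (U * T')) • O b (O' a g)
      + kron a b • (kron j c * (U * W')) • O b (O' k g)
      + kron j b • (kron k a * (U' * T)) • O c (O' b g)
      + kron c b • (kron k a * (W * T)) • O j (O' b g)
      + kron a b • (kron j b * (U' * W')) • O c (O' k g)
      + kron c b • (kron k b * (W * T')) • O j (O' a g)
      + kron a b • (kron c b * (W * W')) • O j (O' k g) := by
    intro b
    have h0 : kron j b * kron k b = 0 := by
      unfold kron
      split_ifs with h1 h2
      · exact absurd (h1.trans h2.symm) hjk
      all_goals simp
    simp only [LinearMap.add_apply, LinearMap.smul_apply, map_add, map_smul]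
    linear_combination (norm := module) (U' * T') • (h0 • O c (O' a g))
  simp only [hs, Finset.sum_add_distrib, sum_kron_smul, ← Finset.smul_sum]

theorem osc_osc_ground {D : ℕ} {g : Dom D} (hg : AnnFrom 1 g) (t u : Bool) {p : ℤ} (hp : 0 < p) (q : ℤ)
    (i k : Fin (D - 2)) : osc D t p i (osc D u q k g) = (kron i k * oscPair t p u q) • g := by
  have h := LinearMap.congr_fun (osc_gcomm_pair D t u p q i k) g
  rw [gcomm_apply, hg.osc_apply t hp, map_zero, smul_zero, sub_zero] at h
  exact h

section
variable {D : ℕ} {g : Dom D} (hg : AnnFrom 1 g) (a : ℝ) {j k : Fin (D - 2)} (hjk : j ≠ k)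
  (t u θ : Bool) (i₁ i₂ : Fin (D - 2))
include hjk

theorem sum_dcomm_dcomm (p q p' q' : ℤ) :
    ∑ b, dcomm D (opY D a j) u q i₂ θ q' b (dcomm D (opY D a k) t p i₁ θ p' b g) =
      (kron j i₂ * kron k i₁ * (oscU u q θ q' * oscU t p θ p')) •
        ∑ b, osc D (xor u θ) (q + q') b (osc D (xor t θ) (p + p') b g)
      + (kron j i₂ * (oscU u q θ q' * (exSign t θ * oscU θ p' t p))) •
        osc D (xor u θ) (q + q') k (osc D (xor t θ) (p + p') i₁ g)
      + (kron j i₂ * (oscU u q θ q' * oscW t p θ p')) •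
        osc D (xor u θ) (q + q') i₁ (osc D (xor t θ) (p + p') k g)
      + (kron k i₁ * ((exSign u θ * oscU θ q' u q) * oscU t p θ p')) •
        osc D (xor u θ) (q + q') i₂ (osc D (xor t θ) (p + p') j g)
      + (kron k i₁ * (oscW u q θ q' * oscU t p θ p')) •
        osc D (xor u θ) (q + q') j (osc D (xor t θ) (p + p') i₂ g)
      + (kron j i₁ * ((exSign u θ * oscU θ q' u q) * oscW t p θ p')) •
        osc D (xor u θ) (q + q') i₂ (osc D (xor t θ) (p + p') k g)
      + (kron k i₂ * (oscW u q θ q' * (exSign t θ * oscU θ p' t p))) •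
        osc D (xor u θ) (q + q') j (osc D (xor t θ) (p + p') i₁ g)
      + (kron i₂ i₁ * (oscW u q θ q' * oscW t p θ p')) •
        osc D (xor u θ) (q + q') j (osc D (xor t θ) (p + p') k g) := by
  simp only [dcomm_opY]
  exact sum_bilinear hjk i₂ i₁ _ _ _ _ _ _ _ _ g

-- A positive mode on the left contracts to a scalar on g, and the trace over b yields D - 2. Apart
-- from `sum_dOsc_dOsc_zero` this is where the dimension appears.
include hg in
theorem sum_dcomm_dcomm_ground (p q p' q' : ℤ) (h : 0 < q + q') :
    ∑ b, dcomm D (opY D a j) u q i₂ θ q' b (dcomm D (opY D a k) t p i₁ θ p' b g) =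
      (oscPair (xor u θ) (q + q') (xor t θ) (p + p') * (kron j i₂ * kron k i₁ *
        (((D - 2 : ℕ) : ℂ) * (oscU u q θ q' * oscU t p θ p')
          + oscU u q θ q' * (exSign t θ * oscU θ p' t p) + oscU u q θ q' * oscW t p θ p'
          + (exSign u θ * oscU θ q' u q) * oscU t p θ p' + oscW u q θ q' * oscU t p θ p')
        + kron j i₁ * kron k i₂ * ((exSign u θ * oscU θ q' u q) * oscW t p θ p'
          + oscW u q θ q' * (exSign t θ * oscU θ p' t p)))) • g := by
  have hk : kron j k = 0 := if_neg hjk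
  have hself : ∀ x : Fin (D - 2), kron x x = 1 := fun x => if_pos rfl
  rw [sum_dcomm_dcomm a hjk]
  simp only [osc_osc_ground hg _ _ h, hself, hk, ← Finset.sum_smul, one_mul, Finset.sum_const,
    Finset.card_univ, Fintype.card_fin, nsmul_eq_mul]
  rw [kron_comm i₁ k, kron_comm i₂ k, kron_comm i₂ j]
  match_scalars
  ring_nf

-- Terms in which the positive mode acts directly on g vanish. What remains are zero modes together
-- with the products [Y, φ_m][Y, φ_{-m}] g, left unevaluated here.
include hg in
theorem dcomm_opX_ground (M : ℕ) :
    dcomm D (opX D a j k) t (-((M : ℤ) + 1)) i₁ u ((M : ℤ) + 1) i₂ g =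
      (dcomm D (opY D a j) t (-((M : ℤ) + 1)) i₁ u ((M : ℤ) + 1) i₂ (zeroY D k g)
        - zeroY D k (dcomm D (opY D a j) t (-((M : ℤ) + 1)) i₁ u ((M : ℤ) + 1) i₂ g))
      - (dcomm D (opY D a k) t (-((M : ℤ) + 1)) i₁ u ((M : ℤ) + 1) i₂ (zeroY D j g)
        - zeroY D j (dcomm D (opY D a k) t (-((M : ℤ) + 1)) i₁ u ((M : ℤ) + 1) i₂ g))
      + exSign t u • (gcomm 1 (opY D a j) (osc D u ((M : ℤ) + 1) i₂)
          (gcomm 1 (opY D a k) (osc D t (-((M : ℤ) + 1)) i₁) g)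
        - gcomm 1 (opY D a k) (osc D u ((M : ℤ) + 1) i₂)
          (gcomm 1 (opY D a j) (osc D t (-((M : ℤ) + 1)) i₁) g))
      + (alpha D 0 j (dcomm D (opY D a k) t (-((M : ℤ) + 1)) i₁ u ((M : ℤ) + 1) i₂ g)
        - alpha D 0 k (dcomm D (opY D a j) t (-((M : ℤ) + 1)) i₁ u ((M : ℤ) + 1) i₂ g))
      + ((kron k i₁ * kron j i₂ - kron j i₁ * kron k i₂) *
          oscPair t (-((M : ℤ) + 1)) u ((M : ℤ) + 1)) •
        (∑ b, alpha D 0 b (alpha D 0 b g) + (2 * ((M : ℂ) + 1)) • g)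
      + (2 * ((M : ℂ) + 1) * kron i₁ i₂ * oscPair t (-((M : ℤ) + 1)) u ((M : ℤ) + 1)) •
        dOsc D 0 j (dOsc D 0 k g) := by
  have hm : (0 : ℤ) < (M : ℤ) + 1 := by omega
  have hB : ∀ l, AnnFrom 1 (dcomm D (opY D a l) t (-((M : ℤ) + 1)) i₁ u ((M : ℤ) + 1) i₂ g) := by
    intro l
    rw [dcomm_opY, neg_add_cancel]
    simp only [LinearMap.add_apply, LinearMap.smul_apply]
    exact (((hg.osc_zero _ _).smul _).add ((hg.osc_zero _ _).smul _)).add ((hg.osc_zero _ _).smul _)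
  have hQ : ∀ l, gcomm 1 (opY D a l) (osc D u ((M : ℤ) + 1) i₂) g = 0 := fun l =>
    gcomm_opY_ground hg a l u hm i₂
  have hYY : ∀ j k, dcomm D (opY D a j * opY D a k) t (-((M : ℤ) + 1)) i₁ u ((M : ℤ) + 1) i₂ g =
      zeroY D j (dcomm D (opY D a k) t (-((M : ℤ) + 1)) i₁ u ((M : ℤ) + 1) i₂ g)
      + exSign t u • gcomm 1 (opY D a j) (osc D u ((M : ℤ) + 1) i₂)
          (gcomm 1 (opY D a k) (osc D t (-((M : ℤ) + 1)) i₁) g)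
      + dcomm D (opY D a j) t (-((M : ℤ) + 1)) i₁ u ((M : ℤ) + 1) i₂ (zeroY D k g) := by
    intro j k
    rw [dcomm_mul]
    simp only [LinearMap.add_apply, LinearMap.smul_apply, Module.End.mul_apply, hQ, map_zero, add_zero]
    rw [opY_ground' (hB k), opY_ground' hg]
  have hR : gcomm 1 (opR D j k) (osc D u ((M : ℤ) + 1) i₂) g = 0 := by
    rw [gcomm_opR_of_ne _ _ _ _ _ _ (Or.inr hm.ne')]
    simp [hg.osc_apply u hm]
  have hR' : osc D u ((M : ℤ) + 1) i₂ (gcomm 1 (opR D j k) (osc D t (-((M : ℤ) + 1)) i₁) g) =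
      -((exSign t u * (kron k i₁ * kron j i₂ - kron j i₁ * kron k i₂)
        * oscPair t (-((M : ℤ) + 1)) u ((M : ℤ) + 1)) • g) := by
    have h := LinearMap.congr_fun (dcomm_opR D t u (-((M : ℤ) + 1)) ((M : ℤ) + 1) i₁ i₂ j k
      (Or.inr (by omega))) g
    rw [dcomm, gcomm_apply, hg.osc_apply u hm, map_zero, zero_sub, LinearMap.smul_apply,
      Module.End.one_apply] at h
    have h' := congrArg (fun x => exSign t u • x) h
    simp only [smul_neg, smul_smul, exSign_mul_self, one_smul] at h'
    rw [← neg_eq_iff_eq_neg, h', mul_assoc]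
  have hH : opH D g = (1 / 2 : ℂ) • ∑ b, alpha D 0 b (alpha D 0 b g) := by
    rw [opH, LinearMap.add_apply, ham_ground hg, zero_add]
    simp
  have hα : ∀ j k, dcomm D (alpha D 0 j * opY D a k) t (-((M : ℤ) + 1)) i₁ u ((M : ℤ) + 1) i₂ g =
      alpha D 0 j (dcomm D (opY D a k) t (-((M : ℤ) + 1)) i₁ u ((M : ℤ) + 1) i₂ g) := fun j k => by
    rw [dcomm_alpha_mul, Module.End.mul_apply]
  rw [opX, dcomm_add, dcomm_add, dcomm_sub, dcomm_sub, dcomm_smul,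
    dcomm_opH_opR _ _ _ _ _ _ _ _ _ (Or.inr (by omega))]
  simp only [LinearMap.add_apply, LinearMap.sub_apply, LinearMap.smul_apply, hYY, hα,
    Module.End.mul_apply, hR, hR', hH, map_zero, opR_ground' hg hjk, zero_add]
  have hs := exSign_mul_self t u
  push_cast
  linear_combination (norm := module) (2 * ((M : ℂ) + 1) *
    (kron k i₁ * kron j i₂ - kron j i₁ * kron k i₂) * oscPair t (-((M : ℤ) + 1)) u ((M : ℤ) + 1)) •
    (hs • g)
end

/-! ### Evaluation for opposite modes -/

section
variable {D : ℕ} {g : Dom D} (hg : AnnFrom 1 g) (a : ℝ) {j k : Fin (D - 2)} (hjk : j ≠ k)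
  (t u : Bool) (i₁ i₂ : Fin (D - 2))

/-- The contribution of the intermediate oscillators of type `θ` and mode `r + 1` to a product of two
single commutators. -/
def quadTerm (M : ℕ) (g : Dom D) (θ : Bool) (r : ℕ) (j k : Fin (D - 2)) : Dom D :=
  ∑ b, dcomm D (opY D a j) u ((M : ℤ) + 1) i₂ θ (-((r : ℤ) + 1)) b
    (dcomm D (opY D a k) t (-((M : ℤ) + 1)) i₁ θ ((r : ℤ) + 1) b g)

include hg in
theorem gcomm_opY_mul_diff (M : ℕ) :
    ((M : ℂ) + 1) • (gcomm 1 (opY D a j) (osc D u ((M : ℤ) + 1) i₂)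
        (gcomm 1 (opY D a k) (osc D t (-((M : ℤ) + 1)) i₁) g)
      - gcomm 1 (opY D a k) (osc D u ((M : ℤ) + 1) i₂)
        (gcomm 1 (opY D a j) (osc D t (-((M : ℤ) + 1)) i₁) g)) =
      ∑ r ∈ Finset.range M, (-(quadTerm a t u i₁ i₂ M g false r j k - quadTerm a t u i₁ i₂ M g false r k j)
        - (((r : ℂ) + 1) * exSign t true) •
          (quadTerm a t u i₁ i₂ M g true r j k - quadTerm a t u i₁ i₂ M g true r k j))
      + (-(quadTerm a t u i₁ i₂ M g false M j k - quadTerm a t u i₁ i₂ M g false M k j)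
        - (((M : ℂ) + 1) * exSign t true) •
          (quadTerm a t u i₁ i₂ M g true M j k - quadTerm a t u i₁ i₂ M g true M k j)) := by
  rw [smul_sub, gcomm_opY_mul_ground hg, gcomm_opY_mul_ground hg, ← Finset.sum_sub_distrib,
    ← Finset.sum_range_succ (fun r : ℕ => (-(quadTerm a t u i₁ i₂ M g false r j k
        - quadTerm a t u i₁ i₂ M g false r k j) - (((r : ℂ) + 1) * exSign t true) •
          (quadTerm a t u i₁ i₂ M g true r j k - quadTerm a t u i₁ i₂ M g true r k j)))]
  refine Finset.sum_congr rfl fun r _ => ?_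
  simp only [Finset.sum_sub_distrib, Finset.sum_neg_distrib, ← Finset.smul_sum, quadTerm]
  module

theorem sum_succ_range (M : ℕ) : ∑ r ∈ Finset.range M, ((r : ℂ) + 1) = M * (M + 1) / 2 := by
  induction M with
  | zero => simp
  | succ M ih => rw [Finset.sum_range_succ, ih]; push_cast; ring

include hg hjk

/-- Bose and Fermi intermediate states are taken together, since only their sum is r + 1 times an
expression independent of r. The trace gives D - 2 and the exchange terms give -8. -/
theorem quadTerm_bose (M r : ℕ) (hr : r < M) :
    -(quadTerm a false false i₁ i₂ M g false r j k - quadTerm a false false i₁ i₂ M g false r k j)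
        - (((r : ℂ) + 1) * exSign false true) •
          (quadTerm a false false i₁ i₂ M g true r j k - quadTerm a false false i₁ i₂ M g true r k j) =
      (((r : ℂ) + 1) * ((((D - 2 : ℕ) : ℂ) - 8) / 4 * ((M : ℂ) + 1) ^ 2 *
        (kron j i₂ * kron k i₁ - kron j i₁ * kron k i₂))) • g := by
  have hpos : (0 : ℤ) < (M : ℤ) + 1 + -((r : ℤ) + 1) := by omega
  have h1 : (M : ℤ) + 1 + -((r : ℤ) + 1) + (-((M : ℤ) + 1) + ((r : ℤ) + 1)) = 0 := by ring
  have h2 : (M : ℤ) + 1 ≠ 0 := by omega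
  have h3 : (r : ℤ) + 1 ≠ 0 := by omega
  -- The coefficients contain the denominator M - r, nonzero exactly because the case r = M is kept
  -- aside.
  have hx : (M : ℂ) + 1 + (-1 + -r) ≠ 0 := by
    intro h
    have : (M : ℂ) = r := by linear_combination h
    have : M = r := by exact_mod_cast this
    omega
  have hx' : -1 + -(M : ℂ) + (r + 1) ≠ 0 := by
    intro h; apply hx; linear_combination -h
  unfold quadTerm
  rw [sum_dcomm_dcomm_ground hg a hjk _ _ _ _ _ _ _ _ _ hpos,
    sum_dcomm_dcomm_ground hg a hjk.symm _ _ _ _ _ _ _ _ _ hpos,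
    sum_dcomm_dcomm_ground hg a hjk _ _ _ _ _ _ _ _ _ hpos,
    sum_dcomm_dcomm_ground hg a hjk.symm _ _ _ _ _ _ _ _ _ hpos]
  match_scalars
  simp only [Bool.xor_false, Bool.xor_true, Bool.not_false, oscPair, h1, true_and, if_true, oscU,
    oscW, exSign, oscNorm, virCoeff, h2, h3, neg_eq_zero, if_false]
  push_cast
  simp only [neg_add_rev]
  field_simp
  ring

omit hg hjk in
theorem alpha_zero_zeroY (i l : Fin (D - 2)) (v : Dom D) :
    alpha D 0 i (zeroY D l v) = zeroY D l (alpha D 0 i v) := by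
  have h : alpha D 0 i * zeroY D l = zeroY D l * alpha D 0 i := by
    rw [zeroY, mul_sub, sub_mul, ← mul_assoc, (alpha_dOsc D 0 0 i l).eq, mul_assoc, alpha_zero_zeroD,
      mul_assoc, mul_smul_comm, smul_mul_assoc, alpha_alpha_zero]
  exact LinearMap.congr_fun h v

omit hg hjk in
theorem alpha_alpha_zero_apply (i l : Fin (D - 2)) (v : Dom D) :
    alpha D 0 i (alpha D 0 l v) = alpha D 0 l (alpha D 0 i v) :=
  LinearMap.congr_fun (alpha_alpha_zero D i l) v

omit hg hjk in
theorem dOsc_dOsc_zero_apply (i l : Fin (D - 2)) (v : Dom D) :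
    dOsc D 0 i (dOsc D 0 l v) = kron i l • v - dOsc D 0 l (dOsc D 0 i v) :=
  LinearMap.congr_fun (dOsc_dOsc_zero D i l) v

omit hg hjk in
theorem sum_dOsc_dOsc_zero (v : Dom D) :
    ∑ b, dOsc D 0 b (dOsc D 0 b v) = (((D - 2 : ℕ) : ℂ) / 2) • v := by
  have h : ∀ b, dOsc D 0 b (dOsc D 0 b v) = (1 / 2 : ℂ) • v := fun b => by
    have h := dOsc_dOsc_zero_apply b b v
    rw [kron, if_pos rfl] at h
    have h2 : dOsc D 0 b (dOsc D 0 b v) + dOsc D 0 b (dOsc D 0 b v) = v := by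
      rw [eq_sub_iff_add_eq, one_smul] at h; exact h
    linear_combination (norm := module) (1 / 2 : ℂ) • h2
  simp only [h, Finset.sum_const, Finset.card_univ, Fintype.card_fin]
  rw [← Nat.cast_smul_eq_nsmul ℂ, smul_smul, mul_one_div]

/-- The modes r < M contribute through the sum M (M + 1)/2. The case r = M leaves products of zero
modes; their momentum and spin parts cancel against the remaining terms of `dcomm_opX_ground`, and
the trace of d_0 d_0, equal to (D - 2)/2, completes the dimension-dependent part. -/
theorem dcomm_opX_bose (M : ℕ) :
    dcomm D (opX D a j k) false (-((M : ℤ) + 1)) i₁ false ((M : ℤ) + 1) i₂ g =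
      ((8 - ((D - 2 : ℕ) : ℂ)) / 8 * ((M : ℂ) + 1) ^ 3 *
        (kron j i₁ * kron k i₂ - kron j i₂ * kron k i₁)) • g := by
  have h2 : (M : ℤ) + 1 ≠ 0 := by omega
  have h3 : (M : ℂ) + 1 ≠ 0 := by exact_mod_cast h2
  have hk : kron j k = 0 := if_neg hjk
  have key := gcomm_opY_mul_diff hg a (j := j) (k := k) false false i₁ i₂ M
  rw [Finset.sum_congr rfl (fun r hr =>
    quadTerm_bose hg a hjk i₁ i₂ M r (Finset.mem_range.1 hr)), ← Finset.sum_smul, ← Finset.sum_mul,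
    sum_succ_range] at key
  rw [dcomm_opX_ground hg a hjk]
  generalize (gcomm 1 (opY D a j) (osc D false ((M : ℤ) + 1) i₂)
        (gcomm 1 (opY D a k) (osc D false (-((M : ℤ) + 1)) i₁) g)
      - gcomm 1 (opY D a k) (osc D false ((M : ℤ) + 1) i₂)
        (gcomm 1 (opY D a j) (osc D false (-((M : ℤ) + 1)) i₁) g)) = V at key ⊢
  unfold quadTerm at key
  rw [sum_dcomm_dcomm a hjk, sum_dcomm_dcomm a hjk, sum_dcomm_dcomm a hjk.symm,
    sum_dcomm_dcomm a hjk.symm] at key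
  have hV : V = ((M : ℂ) + 1)⁻¹ • (((M : ℂ) + 1) • V) := by
    rw [smul_smul, inv_mul_cancel₀ h3, one_smul]
  rw [hV, key]
  have e1 := alpha_alpha_zero_apply i₂ j g
  have e2 := alpha_alpha_zero_apply i₂ k g
  have e3 := alpha_alpha_zero_apply i₁ j g
  have e4 := alpha_alpha_zero_apply i₁ k g
  have e5 := alpha_alpha_zero_apply k j g
  have f1 := dOsc_dOsc_zero_apply i₂ j g
  have f2 := dOsc_dOsc_zero_apply i₂ k g
  have f3 := dOsc_dOsc_zero_apply i₁ j g
  have f4 := dOsc_dOsc_zero_apply i₁ k g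
  have f5 := dOsc_dOsc_zero_apply k j g
  rw [kron_comm k j, hk, zero_smul, zero_sub] at f5
  rw [kron_comm i₂ j] at f1
  rw [kron_comm i₂ k] at f2
  rw [kron_comm i₁ j] at f3
  rw [kron_comm i₁ k] at f4
  clear key hV
  simp only [dcomm_opY, LinearMap.add_apply, LinearMap.smul_apply, map_add, map_smul, osc, exSign,
    Bool.xor_false, Bool.xor_true, Bool.not_false, neg_add_cancel, add_neg_cancel, alpha_zero_zeroY,
    e1, e2, e3, e4, e5, f1, f2, f3, f4, f5, sum_dOsc_dOsc_zero, oscPair, oscU, oscW, oscNorm, virCoeff,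
    h2, neg_eq_zero, if_false, true_and, if_true]
  rw [kron_comm i₂ i₁]
  push_cast
  simp only [neg_add_cancel, add_neg_cancel, div_zero]
  match_scalars <;> field_simp <;> ring

end

section
variable {D : ℕ} {g : Dom D} (hg : AnnFrom 1 g) (a : ℝ) {j k : Fin (D - 2)} (hjk : j ≠ k)
  (t u : Bool) (i₁ i₂ : Fin (D - 2))

theorem dOsc_zeroY (i l : Fin (D - 2)) (v : Dom D) :
    dOsc D 0 i (zeroY D l v) = zeroY D l (dOsc D 0 i v) + kron i l • zeroD D v
      - dOsc D 0 l (alpha D 0 i v) := by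
  have h : dOsc D 0 i * zeroY D l = zeroY D l * dOsc D 0 i + kron i l • zeroD D
      - dOsc D 0 l * alpha D 0 i := by
    rw [zeroY, mul_sub, sub_mul, ← mul_assoc, dOsc_dOsc_zero, sub_mul, smul_mul_assoc, one_mul,
      mul_assoc, mul_assoc, zeroD_dOsc, mul_sub, mul_smul_comm, smul_mul_assoc,
      (alpha_dOsc D 0 0 l i).eq]
    module
  exact LinearMap.congr_fun h v

theorem sum_dOsc_alpha_zero (v : Dom D) : ∑ b, dOsc D 0 b (alpha D 0 b v) = zeroD D v := by
  rw [zeroD, LinearMap.sum_apply]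
  exact Finset.sum_congr rfl fun b _ => (LinearMap.congr_fun (alpha_dOsc D 0 0 b b).eq v).symm

theorem alpha_dOsc_zero_apply (i l : Fin (D - 2)) (v : Dom D) :
    alpha D 0 i (dOsc D 0 l v) = dOsc D 0 l (alpha D 0 i v) :=
  LinearMap.congr_fun (alpha_dOsc D 0 0 i l).eq v

include hg hjk

theorem quadTerm_fermi (M r : ℕ) (hr : r < M) :
    -(quadTerm a true true i₁ i₂ M g false r j k - quadTerm a true true i₁ i₂ M g false r k j)
        - (((r : ℂ) + 1) * exSign true true) •
          (quadTerm a true true i₁ i₂ M g true r j k - quadTerm a true true i₁ i₂ M g true r k j) =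
      (((r : ℂ) + 1) * ((((D - 2 : ℕ) : ℂ) - 8) * ((M : ℂ) + 1) *
        (kron j i₂ * kron k i₁ - kron j i₁ * kron k i₂))) • g := by
  have hpos : (0 : ℤ) < (M : ℤ) + 1 + -((r : ℤ) + 1) := by omega
  have h1 : (M : ℤ) + 1 + -((r : ℤ) + 1) + (-((M : ℤ) + 1) + ((r : ℤ) + 1)) = 0 := by ring
  have h2 : (M : ℤ) + 1 ≠ 0 := by omega
  have h3 : (r : ℤ) + 1 ≠ 0 := by omega
  have hx : (M : ℂ) + 1 + (-1 + -r) ≠ 0 := by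
    intro h
    have : (M : ℂ) = r := by linear_combination h
    have : M = r := by exact_mod_cast this
    omega
  have hx' : -1 + -(M : ℂ) + (r + 1) ≠ 0 := by
    intro h; apply hx; linear_combination -h
  unfold quadTerm
  rw [sum_dcomm_dcomm_ground hg a hjk _ _ _ _ _ _ _ _ _ hpos,
    sum_dcomm_dcomm_ground hg a hjk.symm _ _ _ _ _ _ _ _ _ hpos,
    sum_dcomm_dcomm_ground hg a hjk _ _ _ _ _ _ _ _ _ hpos,
    sum_dcomm_dcomm_ground hg a hjk.symm _ _ _ _ _ _ _ _ _ hpos]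
  match_scalars
  simp only [Bool.xor_false, Bool.xor_true, Bool.not_true, oscPair, h1, true_and, if_true, oscU,
    oscW, exSign, oscNorm, virCoeff, h3, neg_eq_zero, if_false]
  push_cast
  simp only [neg_add_rev]
  field_simp
  ring

/-- The mechanism is that of `dcomm_opX_bose`. The same critical value D - 2 = 8 results, with one
power of the mode number less. -/
theorem dcomm_opX_fermi (M : ℕ) :
    dcomm D (opX D a j k) true (-((M : ℤ) + 1)) i₁ true ((M : ℤ) + 1) i₂ g =
      ((((D - 2 : ℕ) : ℂ) - 8) / 2 * ((M : ℂ) + 1) ^ 2 *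
        (kron j i₁ * kron k i₂ - kron j i₂ * kron k i₁)) • g := by
  have h2 : (M : ℤ) + 1 ≠ 0 := by omega
  have h3 : (M : ℂ) + 1 ≠ 0 := by exact_mod_cast h2
  have hk : kron j k = 0 := if_neg hjk
  have key := gcomm_opY_mul_diff hg a (j := j) (k := k) true true i₁ i₂ M
  rw [Finset.sum_congr rfl (fun r hr =>
    quadTerm_fermi hg a hjk i₁ i₂ M r (Finset.mem_range.1 hr)), ← Finset.sum_smul, ← Finset.sum_mul,
    sum_succ_range] at key
  rw [dcomm_opX_ground hg a hjk]
  generalize (gcomm 1 (opY D a j) (osc D true ((M : ℤ) + 1) i₂)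
        (gcomm 1 (opY D a k) (osc D true (-((M : ℤ) + 1)) i₁) g)
      - gcomm 1 (opY D a k) (osc D true ((M : ℤ) + 1) i₂)
        (gcomm 1 (opY D a j) (osc D true (-((M : ℤ) + 1)) i₁) g)) = V at key ⊢
  unfold quadTerm at key
  rw [sum_dcomm_dcomm a hjk, sum_dcomm_dcomm a hjk, sum_dcomm_dcomm a hjk.symm,
    sum_dcomm_dcomm a hjk.symm] at key
  have hV : V = ((M : ℂ) + 1)⁻¹ • (((M : ℂ) + 1) • V) := by
    rw [smul_smul, inv_mul_cancel₀ h3, one_smul]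
  rw [hV, key]
  have e1 := alpha_alpha_zero_apply i₂ j g
  have e2 := alpha_alpha_zero_apply i₂ k g
  have e3 := alpha_alpha_zero_apply i₁ j g
  have e4 := alpha_alpha_zero_apply i₁ k g
  have e5 := alpha_alpha_zero_apply k j g
  have f1 := dOsc_dOsc_zero_apply i₂ j g
  have f2 := dOsc_dOsc_zero_apply i₂ k g
  have f3 := dOsc_dOsc_zero_apply i₁ j g
  have f4 := dOsc_dOsc_zero_apply i₁ k g
  have f5 := dOsc_dOsc_zero_apply k j g
  rw [kron_comm k j, hk, zero_smul, zero_sub] at f5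
  rw [kron_comm i₂ j] at f1
  rw [kron_comm i₂ k] at f2
  rw [kron_comm i₁ j] at f3
  rw [kron_comm i₁ k] at f4
  clear key hV
  simp only [dcomm_opY, LinearMap.add_apply, LinearMap.smul_apply, map_add, map_smul, osc, exSign,
    Bool.xor_false, Bool.xor_true, Bool.not_true, neg_add_cancel, add_neg_cancel, alpha_zero_zeroY,
    e1, e2, e3, e4, e5, f1, f2, f3, f4, f5, sum_dOsc_dOsc_zero, oscPair, oscU, oscW, oscNorm, virCoeff,
    h2, neg_eq_zero, if_false, true_and, if_true]
  rw [kron_comm i₂ i₁]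
  push_cast
  simp only [neg_add_cancel, add_neg_cancel]
  match_scalars <;> field_simp <;> ring


/-- The two double commutators produce oscillators of different statistics, whose contraction
vanishes. -/
theorem quadTerm_mixed (htu : t ≠ u) (θ : Bool) (M r : ℕ) (hr : r < M) :
    quadTerm a t u i₁ i₂ M g θ r j k = 0 := by
  have hpos : (0 : ℤ) < (M : ℤ) + 1 + -((r : ℤ) + 1) := by omega
  unfold quadTerm
  rw [sum_dcomm_dcomm_ground hg a hjk _ _ _ _ _ _ _ _ _ hpos, oscPair, if_neg, zero_mul, zero_smul]
  rintro ⟨h, -⟩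
  revert h htu
  cases t <;> cases u <;> cases θ <;> simp

/-- Only r = M contributes, leaving expressions odd in d_0. They cancel in every dimension, using
that the sum of d_0^b p^b is p·d_0. -/
theorem dcomm_opX_mixed (htu : t ≠ u) (M : ℕ) :
    dcomm D (opX D a j k) t (-((M : ℤ) + 1)) i₁ u ((M : ℤ) + 1) i₂ g = 0 := by
  have h2 : (M : ℤ) + 1 ≠ 0 := by omega
  have h3 : (M : ℂ) + 1 ≠ 0 := by exact_mod_cast h2
  have hk : kron j k = 0 := if_neg hjk
  have hk' : kron k j = 0 := if_neg hjk.symm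
  have key := gcomm_opY_mul_diff hg a (j := j) (k := k) t u i₁ i₂ M
  rw [Finset.sum_eq_zero (fun r hr => by
    have hr := Finset.mem_range.1 hr
    rw [quadTerm_mixed hg a hjk t u i₁ i₂ htu _ M r hr,
      quadTerm_mixed hg a hjk.symm t u i₁ i₂ htu _ M r hr, quadTerm_mixed hg a hjk t u i₁ i₂ htu _ M r hr,
      quadTerm_mixed hg a hjk.symm t u i₁ i₂ htu _ M r hr, sub_zero, smul_zero, neg_zero, sub_zero])]
    at key
  rw [dcomm_opX_ground hg a hjk]
  generalize (gcomm 1 (opY D a j) (osc D u ((M : ℤ) + 1) i₂)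
        (gcomm 1 (opY D a k) (osc D t (-((M : ℤ) + 1)) i₁) g)
      - gcomm 1 (opY D a k) (osc D u ((M : ℤ) + 1) i₂)
        (gcomm 1 (opY D a j) (osc D t (-((M : ℤ) + 1)) i₁) g)) = V at key ⊢
  unfold quadTerm at key
  rw [sum_dcomm_dcomm a hjk, sum_dcomm_dcomm a hjk, sum_dcomm_dcomm a hjk.symm,
    sum_dcomm_dcomm a hjk.symm] at key
  have hV : V = ((M : ℂ) + 1)⁻¹ • (((M : ℂ) + 1) • V) := by
    rw [smul_smul, inv_mul_cancel₀ h3, one_smul]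
  rw [hV, key]
  clear key hV
  rw [kron_comm i₂ i₁]
  cases t <;> cases u <;> try exact absurd rfl htu
  all_goals
    simp only [dcomm_opY, LinearMap.add_apply, LinearMap.smul_apply, map_add, map_smul, osc, exSign,
      Bool.xor_false, Bool.xor_true, Bool.not_false, Bool.not_true, neg_add_cancel, add_neg_cancel,
      dOsc_zeroY, alpha_dOsc_zero_apply, oscPair, oscU, oscW, oscNorm, virCoeff, kron_comm i₁ j,
      kron_comm i₁ k, kron_comm i₂ j, kron_comm i₂ k, hk, hk',
      h2, neg_eq_zero, if_false, Bool.false_eq_true, Bool.true_eq_false, false_and]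
    rw [sum_dOsc_alpha_zero]
    push_cast
    simp only [neg_add_cancel, add_neg_cancel, mul_zero, div_zero]
    match_scalars <;> field_simp <;> ring

end

/-! ### The defect vanishes in ten dimensions -/

/-- The kernel of x contains the vacuum states and is stable under the oscillators, so cyclicity of
the vacuum applies. The momentum α_0 need not be tested. -/
theorem eq_zero_of_gcomm {D : ℕ} (x : Module.End ℂ (Dom D)) (s : Bool → ℂ)
    (h0 : ∀ g, AnnFrom 1 g → x g = 0)
    (h1 : ∀ (t : Bool) (m : ℤ) (i : Fin (D - 2)), (t = true ∨ m ≠ 0) →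
      gcomm (s t) x (osc D t m i) = 0) : x = 0 := by
  have h : LinearMap.ker x = ⊤ := by
    refine vacuum_cyclic _ (fun f => h0 _ (annFrom_vacuum f)) fun t m i hm _ v hv => ?_
    have h := LinearMap.congr_fun (h1 t m i hm) v
    rw [gcomm_apply, LinearMap.mem_ker.1 hv, map_zero, smul_zero, sub_zero] at h
    exact h
  exact LinearMap.ker_eq_top.1 h

/-- A single commutator V = [x, φ_p] graded-commutes with all oscillators, so by `eq_zero_of_gcomm`
it need only be checked on ground states g. For p = 0 this follows as φ_0 g is again a ground state;
for p ≠ 0 the vector V g is a ground state of energy -p, hence zero. -/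
theorem eq_zero_of_dcomm {D : ℕ} {x : Module.End ℂ (Dom D)} (hx : HasWeight x 0)
    (h0 : ∀ g, AnnFrom 1 g → x g = 0)
    (h1 : ∀ (t u : Bool) (p q : ℤ) (i₁ i₂ : Fin (D - 2)), (t = true ∨ p ≠ 0) →
      (u = true ∨ q ≠ 0) → dcomm D x t p i₁ u q i₂ = 0) : x = 0 := by
  have hV : ∀ (t : Bool) (p : ℤ) (i : Fin (D - 2)), (t = true ∨ p ≠ 0) →
      gcomm 1 x (osc D t p i) = 0 := by
    intro t p i hp
    refine eq_zero_of_gcomm _ (exSign t) (fun g hg => ?_) fun u q l hq => h1 t u p q i l hp hq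
    by_cases hz : p = 0
    · subst hz
      rw [gcomm_apply, h0 g hg, h0 _ (hg.osc_zero t i)]
      simp
    · have h2 : AnnFrom 1 (gcomm 1 x (osc D t p i) g) := by
        refine annFrom_one_of fun u q l hq => ?_
        have h := LinearMap.congr_fun (h1 t u p q i l hp (Or.inr hq.ne')) g
        rw [dcomm, gcomm_apply, hg.osc_apply u hq, map_zero, zero_sub, LinearMap.zero_apply,
          neg_eq_zero, smul_eq_zero] at h
        exact h.resolve_left (exSign_ne_zero _ _)
      have h3 := (hx.gcomm (hasWeight_osc D t p i) 1).apply (c := 0)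
        (by rw [ham_ground hg, zero_smul] : ham D g = (0 : ℂ) • g)
      rw [ham_ground h2, eq_comm, smul_eq_zero, zero_sub, neg_eq_zero, zero_add] at h3
      exact h3.resolve_left (by exact_mod_cast hz)
  exact eq_zero_of_gcomm _ (fun _ => 1) h0 hV

section
variable {D : ℕ} (a : ℝ) {j k : Fin (D - 2)} (hjk : j ≠ k)
include hjk

theorem dcomm_opX_ground_of_neg (hD : D = 10) {g : Dom D} (hg : AnnFrom 1 g) (t u : Bool) {p q : ℤ}
    (i₁ i₂ : Fin (D - 2)) (hp : p < 0) (hpq : p + q = 0) :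
    dcomm D (opX D a j k) t p i₁ u q i₂ g = 0 := by
  obtain ⟨M, hM⟩ : ∃ M : ℕ, q = (M : ℤ) + 1 := ⟨(q - 1).toNat, by omega⟩
  have hp' : p = -((M : ℤ) + 1) := by omega
  have h8 : ((D - 2 : ℕ) : ℂ) = 8 := by rw [hD]; norm_num
  subst hM hp'
  by_cases htu : t = u
  · subst htu
    cases t
    · rw [dcomm_opX_bose hg a hjk, h8]; simp
    · rw [dcomm_opX_fermi hg a hjk, h8]; simp
  · exact dcomm_opX_mixed hg a hjk t u i₁ i₂ htu M

theorem dcomm_opX_ground_eq_zero (hD : D = 10) {g : Dom D} (hg : AnnFrom 1 g) (t u : Bool) (p q : ℤ)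
    (i₁ i₂ : Fin (D - 2)) (hp : t = true ∨ p ≠ 0) (hq : u = true ∨ q ≠ 0) :
    dcomm D (opX D a j k) t p i₁ u q i₂ g = 0 := by
  by_cases hpq : p + q = 0
  · rcases lt_trichotomy p 0 with h | h | h
    · exact dcomm_opX_ground_of_neg a hjk hD hg t u i₁ i₂ h hpq
    · have hq0 : q = 0 := by omega
      subst h hq0
      obtain rfl : t = true := by simpa using hp
      obtain rfl : u = true := by simpa using hq
      exact dcomm_opX_ground_zero a hjk i₁ i₂ hg
    · rw [dcomm_swap, LinearMap.smul_apply,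
        dcomm_opX_ground_of_neg a hjk hD hg u t i₂ i₁ (by omega) (by omega), smul_zero]
  · exact dcomm_opX_ground_of_ne a hjk t u p q i₁ i₂ hp hq hg hpq

/-- Vanishing is lifted from triple to double commutators by `eq_zero_of_gcomm` and from there to X
by `eq_zero_of_dcomm`. The dimension is used only for opposite nonzero modes. -/
theorem opX_eq_zero (hD : D = 10) : opX D a j k = 0 :=
  eq_zero_of_dcomm (hasWeight_opX D a j k) (fun _ hg => opX_ground hg a hjk)
    fun t u p q i₁ i₂ hp hq => eq_zero_of_gcomm _ (fun v => exSign t v * exSign u v)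
      (fun _ hg => dcomm_opX_ground_eq_zero a hjk hD hg t u p q i₁ i₂ hp hq)
      (fun v r i hr => tcomm_opX D t u v p q r i₁ i₂ i a hjk hp hq hr)
end

/-! ### The one-particle operators -/

theorem derivOp_mulOp {D : ℕ} (v : Mom D) (g : Mom D →L[ℝ] ℂ)
    (hg : ContDiffOn ℝ ∞ g {p | 0 < p.1}) :
    derivOp v * mulOp g hg - mulOp g hg * derivOp v = g v • 1 := by
  ext f p
  change fderiv ℝ (fun q => g q * f q) p v - g p * fderiv ℝ f p v = g v * f p
  rw [fderiv_fun_mul g.differentiableAt (f.contDiff.differentiable (by simp) p), g.fderiv]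
  simp only [add_apply, smul_apply, smul_eq_mul]
  ring

theorem derivOp_comm {D : ℕ} (v w : Mom D) : derivOp (D := D) v * derivOp w = derivOp w * derivOp v := by
  ext f p
  change fderiv ℝ (fun q => fderiv ℝ f q w) p v = fderiv ℝ (fun q => fderiv ℝ f q v) p w
  have hd : DifferentiableAt ℝ (fderiv ℝ f) p :=
    ((f.contDiff.fderiv_right (m := ∞) (by simp)).differentiable (by simp)) p
  rw [fderiv_clm_apply hd (differentiableAt_const w), fderiv_clm_apply hd (differentiableAt_const v)]
  have hs : IsSymmSndFDerivAt ℝ f p :=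
    f.contDiff.contDiffAt.isSymmSndFDerivAt (by
      rw [minSmoothness_of_isRCLikeNormedField]; exact WithTop.coe_le_coe.2 (le_top : (2 : ℕ∞) ≤ ⊤))
  simp [hs.eq v w]

theorem dPlus_pPlus (D : ℕ) : dPlus D * pPlus D - pPlus D * dPlus D = 1 := by
  have h := derivOp_mulOp (D := D) (1, 0)
    (Complex.ofRealCLM.comp (ContinuousLinearMap.fst ℝ ℝ (Fin (D - 2) → ℝ)))
    (Complex.ofRealCLM.contDiff.comp contDiff_fst).contDiffOn
  exact h.trans (by simp)

theorem dTr_pPlus (D : ℕ) (j : Fin (D - 2)) : dTr D j * pPlus D - pPlus D * dTr D j = 0 := by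
  have h := derivOp_mulOp (D := D) (0, Pi.single j 1)
    (Complex.ofRealCLM.comp (ContinuousLinearMap.fst ℝ ℝ (Fin (D - 2) → ℝ)))
    (Complex.ofRealCLM.contDiff.comp contDiff_fst).contDiffOn
  exact h.trans (by simp)

theorem dPlus_pTr (D : ℕ) (j : Fin (D - 2)) : dPlus D * pTr D j - pTr D j * dPlus D = 0 := by
  have h := derivOp_mulOp (D := D) (1, 0)
    (Complex.ofRealCLM.comp ((ContinuousLinearMap.proj j).comp
      (ContinuousLinearMap.snd ℝ ℝ (Fin (D - 2) → ℝ))))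
    (Complex.ofRealCLM.contDiff.comp (g := Complex.ofRealCLM) (f := fun p : Mom D => p.2 j)
      (by fun_prop)).contDiffOn
  exact h.trans (by simp)

theorem dTr_pTr (D : ℕ) (j k : Fin (D - 2)) :
    dTr D j * pTr D k - pTr D k * dTr D j = kron j k • 1 := by
  have h := derivOp_mulOp (D := D) (0, Pi.single j 1)
    (Complex.ofRealCLM.comp ((ContinuousLinearMap.proj k).comp
      (ContinuousLinearMap.snd ℝ ℝ (Fin (D - 2) → ℝ))))
    (Complex.ofRealCLM.contDiff.comp (g := Complex.ofRealCLM) (f := fun p : Mom D => p.2 k)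
      (by fun_prop)).contDiffOn
  refine h.trans ?_
  congr 1
  by_cases hjk : j = k
  · subst hjk; simp [kron]
  · simp [kron, hjk, Ne.symm hjk]

theorem pPlusInv_mul_pPlus (D : ℕ) : pPlusInv D * pPlus D = 1 := by
  ext f p
  change ((p.1⁻¹ : ℝ) : ℂ) * (((p.1 : ℝ) : ℂ) * f p) = f p
  by_cases hp : 0 < p.1
  · rw [← mul_assoc, ← Complex.ofReal_mul, inv_mul_cancel₀ hp.ne', Complex.ofReal_one, one_mul]
  · have : f p = 0 := by
      by_contra h
      exact hp (f.tsupport_subset (subset_tsupport f h))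
    rw [this, mul_zero, mul_zero]

theorem pMinus_eq (D : ℕ) (μ : ℝ) : pMinus D μ =
    (1 / 2 : ℂ) • (pPlusInv D * (∑ j, pTr D j * pTr D j + ((μ : ℂ) ^ 2) • 1)) := by
  ext f p
  have h : ∀ S : Finset (Fin (D - 2)), (∑ j ∈ S, pTr D j * pTr D j) f p = (∑ j ∈ S, (p.2 j : ℂ) ^ 2) * f p := by
    intro S
    induction S using Finset.induction_on with
    | empty => simp
    | insert i S hi ih =>
      rw [Finset.sum_insert hi, Finset.sum_insert hi, LinearMap.add_apply]
      change (pTr D i * pTr D i) f p + (∑ j ∈ S, pTr D j * pTr D j) f p = _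
      rw [ih]
      change (p.2 i : ℂ) * ((p.2 i : ℂ) * f p) + _ = _
      ring
  change ((pMinusFun D μ p : ℝ) : ℂ) * f p = (1 / 2 : ℂ) * (((p.1⁻¹ : ℝ) : ℂ) *
    ((∑ j, pTr D j * pTr D j) f p + ((μ : ℂ) ^ 2) * f p))
  rw [h, pMinusFun]
  push_cast
  rw [div_eq_mul_inv, mul_inv]
  ring

/-! ### Base commutators -/

theorem lie_mul_right {A : Type*} [Ring A] (x y z : A) : ⁅x, y * z⁆ = ⁅x, y⁆ * z + y * ⁅x, z⁆ := by
  simp only [Ring.lie_def]; noncomm_ring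

/-! ### Operators on momentum space and the oscillators -/

theorem osc_onMom {D : ℕ} {t : Bool} {m : ℤ} (hm : t = true ∨ m ≠ 0) (i : Fin (D - 2))
    (A : Module.End ℂ (TestFn D)) : gcomm 1 (onMom A) (osc D t m i) = 0 := by
  obtain ⟨B, hB⟩ : ∃ B, osc D t m i = onFock B := by
    cases t
    · have hm : m ≠ 0 := by simpa using hm
      rcases int_cases m with rfl | ⟨k, rfl⟩ | ⟨k, rfl⟩
      · exact absurd rfl hm
      · exact ⟨_, alpha_pos D k i⟩
      · exact ⟨_, alpha_neg D k i⟩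
    · rcases int_cases m with rfl | ⟨k, rfl⟩ | ⟨k, rfl⟩
      · exact ⟨_, dOsc_zero D i⟩
      · exact ⟨_, dOsc_pos D k i⟩
      · exact ⟨_, dOsc_neg D k i⟩
  rw [hB, gcomm, one_smul, onMom_onFock, sub_self]

theorem gcomm_one_eq {A : Type*} [Ring A] [Module ℂ A] (x y : A) : gcomm 1 x y = ⁅x, y⁆ := by
  rw [gcomm, one_smul, Ring.lie_def]

theorem gcomm_one_mul_right (D : ℕ) (z x y : Module.End ℂ (Dom D)) :
    gcomm 1 z (x * y) = gcomm 1 z x * y + x * gcomm 1 z y := by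
  rw [gcomm_one_eq, gcomm_one_eq, gcomm_one_eq, lie_mul_right]

theorem gcomm_one_swap (D : ℕ) (x y : Module.End ℂ (Dom D)) : gcomm 1 x y = -gcomm 1 y x := by
  rw [gcomm, gcomm, one_smul, one_smul, neg_sub]

/-- The Jacobi identity. -/
theorem gcomm_gcomm (D : ℕ) (x y z : Module.End ℂ (Dom D)) :
    gcomm 1 (gcomm 1 x y) z = gcomm 1 x (gcomm 1 y z) - gcomm 1 y (gcomm 1 x z) := by
  simp only [gcomm, one_smul, mul_sub, sub_mul, mul_assoc]
  abel

theorem gcomm_sum_right {D : ℕ} {κ : Type*} (S : Finset κ) (s : ℂ) (x : κ → Module.End ℂ (Dom D))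
    (z : Module.End ℂ (Dom D)) : gcomm s z (∑ i ∈ S, x i) = ∑ i ∈ S, gcomm s z (x i) := by
  simp only [gcomm, Finset.sum_mul, Finset.mul_sum, Finset.smul_sum, Finset.sum_sub_distrib]

theorem hasWeight_onMom {D : ℕ} (A : Module.End ℂ (TestFn D)) : HasWeight (onMom A) 0 := by
  have h : gcomm 1 (ham D) (onMom A) = 0 := by
    rw [ham, gcomm_locSum, locSum_zero]
    intro r
    have h1 : ∀ (t : Bool) (m : ℤ) (i : Fin (D - 2)), m ≠ 0 → gcomm 1 (osc D t m i) (onMom A) = 0 :=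
      fun t m i hm => by rw [gcomm_one_swap, osc_onMom (Or.inr hm), neg_zero]
    have hA : ∀ (m : ℤ) (i : Fin (D - 2)), m ≠ 0 → gcomm 1 (alpha D m i) (onMom A) = 0 := h1 false
    have hd : ∀ (m : ℤ) (i : Fin (D - 2)), m ≠ 0 → gcomm 1 (dOsc D m i) (onMom A) = 0 := h1 true
    have e1 : (r : ℤ) + 1 ≠ 0 := by omega
    have e2 : -((r : ℤ) + 1) ≠ 0 := by omega
    simp only [hamTerm, gcomm_sum_left, gcomm_add_left, gcomm_smul_left, gcomm_one_mul_left,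
      hA _ _ e1, hA _ _ e2, hd _ _ e1, hd _ _ e2, mul_zero, zero_mul, add_zero, smul_zero,
      Finset.sum_const_zero]
  unfold HasWeight
  rw [gcomm_one_swap, h, neg_zero, zero_smul]

theorem AnnFrom.onMom {D : ℕ} {g : Dom D} (hg : AnnFrom 1 g) (A : Module.End ℂ (TestFn D)) :
    AnnFrom 1 (onMom A g) := by
  refine annFrom_one_of fun t m i hm => ?_
  have h := LinearMap.congr_fun (osc_onMom (t := t) (Or.inr hm.ne') i A) g
  rw [gcomm_apply, one_smul, hg.osc_apply t hm, map_zero, zero_sub, LinearMap.zero_apply,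
    neg_eq_zero] at h
  exact h

/-- The double commutator of a commutator. -/
theorem dcomm_gcomm (D : ℕ) (z x : Module.End ℂ (Dom D)) (t u : Bool) (p q : ℤ) (i k : Fin (D - 2)) :
    dcomm D (gcomm 1 z x) t p i u q k = gcomm 1 z (dcomm D x t p i u q k)
      - gcomm (exSign t u) (gcomm 1 x (gcomm 1 z (osc D t p i))) (osc D u q k)
      - gcomm (exSign t u) (gcomm 1 x (osc D t p i)) (gcomm 1 z (osc D u q k)) := by
  simp only [dcomm, gcomm, one_smul, mul_sub, sub_mul, smul_sub, mul_smul_comm, smul_mul_assoc,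
    mul_assoc]
  module

theorem gcomm_onMom_opR {D : ℕ} (A : Module.End ℂ (TestFn D)) (j k : Fin (D - 2)) :
    gcomm 1 (onMom A) (opR D j k) = 0 := by
  refine eq_zero_of_gcomm _ (fun _ => 1) (fun g hg => ?_) fun t m i hm => ?_
  · have h : ∀ l v, onMom A (dOsc D 0 l v) = dOsc D 0 l (onMom A v) := fun l v => by
      have h := LinearMap.congr_fun (osc_onMom (t := true) (m := 0) (Or.inl rfl) l A) v
      rw [gcomm_apply, one_smul, LinearMap.zero_apply, sub_eq_zero] at h
      exact h
    rw [gcomm_apply, opR_ground hg, opR_ground (hg.onMom A), map_smul, map_sub, h, h, h, h, one_smul,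
      sub_self]
  · rw [gcomm_gcomm, osc_onMom hm, gcomm_zero_right, gcomm_opR_of_ne _ _ _ _ _ _ hm, gcomm_sub_right,
      gcomm_smul_right, gcomm_smul_right, osc_onMom hm, osc_onMom hm]
    simp

theorem opR_antisymm (D : ℕ) (j k : Fin (D - 2)) : opR D j k = -opR D k j := by
  rw [← sub_eq_zero, sub_neg_eq_add]
  refine eq_zero_of_gcomm _ (fun _ => 1) (fun g hg => ?_) fun t m i hm => ?_
  · rw [LinearMap.add_apply, opR_ground hg, opR_ground hg]
    module
  · rw [gcomm_add_left, gcomm_opR_of_ne _ _ _ _ _ _ hm, gcomm_opR_of_ne _ _ _ _ _ _ hm]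
    abel

/-- Such an A commutes with all oscillators including α_0, and α_0 is the only way in which Y
depends on the momentum. The infinite sums are avoided by the uniqueness principle
`eq_zero_of_dcomm`. -/
theorem gcomm_onMom_opY {D : ℕ} {A : Module.End ℂ (TestFn D)} (hA : ∀ i, A * pTr D i = pTr D i * A)
    (a : ℝ) (k : Fin (D - 2)) : gcomm 1 (onMom A) (opY D a k) = 0 := by
  have h0 : ∀ (t : Bool) (m : ℤ) (i : Fin (D - 2)), gcomm 1 (onMom A) (osc D t m i) = 0 := by
    intro t m i
    by_cases hm : t = true ∨ m ≠ 0
    · exact osc_onMom hm i A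
    · simp only [not_or, not_not, Bool.not_eq_true] at hm
      rw [hm.1, hm.2]
      change gcomm 1 (onMom A) (onMom (pTr D i)) = 0
      rw [gcomm, one_smul, ← onMom_mul, ← onMom_mul, hA, sub_self]
  refine eq_zero_of_dcomm (((hasWeight_onMom A).gcomm (hasWeight_opY D a k) 1).congr (zero_add _))
    (fun g hg => ?_) fun t u p q i₁ i₂ _ _ => ?_
  · have hz : gcomm 1 (onMom A) (zeroY D k) = 0 := by
      have h1 : ∀ i, gcomm 1 (onMom A) (dOsc D 0 i) = 0 := h0 true 0
      have h2 : ∀ i, gcomm 1 (onMom A) (alpha D 0 i) = 0 := h0 false 0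
      simp only [zeroY, zeroD, gcomm_sub_right, gcomm_smul_right, gcomm_one_mul_right, gcomm_sum_right,
        h1, h2, zero_mul, mul_zero, add_zero, Finset.sum_const_zero, smul_zero, sub_zero]
    have h := LinearMap.congr_fun hz g
    rw [gcomm_apply] at h ⊢
    rw [opY_ground' hg, opY_ground' (hg.onMom A), h, LinearMap.zero_apply]
  · rw [dcomm_gcomm, h0, h0, gcomm_zero_right, gcomm_zero_right, gcomm_zero_left, dcomm_opY]
    simp only [gcomm_add_right, gcomm_smul_right, h0, smul_zero, add_zero, sub_zero]

theorem gcomm_dTr_osc (D : ℕ) (j : Fin (D - 2)) (t : Bool) (m : ℤ) (i : Fin (D - 2)) :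
    gcomm 1 (onMom (dTr D j)) (osc D t m i) = (if t = false ∧ m = 0 then kron j i else 0) • 1 := by
  by_cases hm : t = true ∨ m ≠ 0
  · rw [osc_onMom hm, if_neg, zero_smul]
    rintro ⟨rfl, rfl⟩
    simp at hm
  · simp only [not_or, not_not, Bool.not_eq_true] at hm
    rw [hm.1, hm.2, if_pos ⟨rfl, rfl⟩]
    change gcomm 1 (onMom (dTr D j)) (onMom (pTr D i)) = _
    rw [gcomm, one_smul, ← onMom_mul, ← onMom_mul, ← onMom_sub, dTr_pTr, onMom_smul, onMom_one]

/-- Differentiation removes a factor α_0 from Y. In the double commutators only terms whose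
resulting oscillator is α_0 survive, and their coefficients are those of R; on ground states it is a
Clifford relation. -/
theorem gcomm_dTr_opY (D : ℕ) (a : ℝ) (j k : Fin (D - 2)) :
    gcomm 1 (onMom (dTr D j)) (opY D a k) = opR D k j := by
  rw [← sub_eq_zero]
  refine eq_zero_of_dcomm ((((hasWeight_onMom _).gcomm (hasWeight_opY D a k) 1).congr
    (zero_add _)).sub (hasWeight_opR D k j)) (fun g hg => ?_) fun t u p q i₁ i₂ hp hq => ?_
  · have hz : gcomm 1 (onMom (dTr D j)) (zeroY D k) = dOsc D 0 k * dOsc D 0 j - (1 / 2 * kron j k : ℂ) • 1 := by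
      have h1 : ∀ i, gcomm 1 (onMom (dTr D j)) (dOsc D 0 i) = 0 :=
        fun i => osc_onMom (t := true) (Or.inl rfl) i _
      have h2 : ∀ i, gcomm 1 (onMom (dTr D j)) (alpha D 0 i) = kron j i • 1 := fun i => by
        have := gcomm_dTr_osc D j false 0 i
        rwa [if_pos ⟨rfl, rfl⟩] at this
      simp only [zeroY, zeroD, gcomm_sub_right, gcomm_smul_right, gcomm_one_mul_right, gcomm_sum_right,
        h1, h2, zero_mul, zero_add, mul_zero, add_zero, smul_mul_assoc, one_mul, sum_kron_smul, smul_smul]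
    have h := LinearMap.congr_fun hz g
    have h2 := dOsc_dOsc_zero_apply j k g
    rw [gcomm_apply] at h
    rw [LinearMap.sub_apply, gcomm_apply, opY_ground' hg, opY_ground' (hg.onMom _), h, opR_ground hg]
    simp only [LinearMap.sub_apply, LinearMap.smul_apply, Module.End.mul_apply, Module.End.one_apply]
    rw [h2]
    module
  · rw [dcomm_sub, dcomm_gcomm, osc_onMom hp, osc_onMom hq, gcomm_zero_right, gcomm_zero_right,
      gcomm_zero_left, dcomm_opY, dcomm_opR _ _ _ _ _ _ _ _ _ hp]
    simp only [gcomm_add_right, gcomm_smul_right, gcomm_dTr_osc]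
    rw [kron_comm j i₁, kron_comm j i₂, kron_comm k i₁, kron_comm k i₂, kron_comm j k]
    by_cases h : t = u ∧ p + q = 0
    · obtain ⟨rfl, h⟩ := h
      obtain rfl : q = -p := by omega
      cases t
      · simp only [false_or, Bool.false_eq_true] at hp
        simp [oscU, oscW, oscPair, oscNorm, exSign, virCoeff, hp]
        module
      · simp [oscU, oscW, oscPair, oscNorm, exSign]
        module
    · have h1 : ¬ (xor t u = false ∧ p + q = 0) := fun h' => h ⟨by simpa using h'.1, h'.2⟩
      rw [if_neg h1, if_neg h1, if_neg h1, oscPair, if_neg h]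
      simp

/-! ### Commutators of the one-particle operators -/

/-- `A` multiplies by a function of the momentum. -/
class IsMult {D : ℕ} (A : Module.End ℂ (TestFn D)) : Prop where
  eq_mulOp : ∃ g hg, A = mulOp g hg

instance (D : ℕ) : IsMult (pPlus D) := ⟨_, _, rfl⟩
instance (D : ℕ) : IsMult (pPlusInv D) := ⟨_, _, rfl⟩
instance (D : ℕ) (μ : ℝ) : IsMult (pMinus D μ) := ⟨_, _, rfl⟩
instance (D : ℕ) (j : Fin (D - 2)) : IsMult (pTr D j) := ⟨_, _, rfl⟩

section
variable {D : ℕ} (A B : Module.End ℂ (TestFn D))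

theorem IsMult.comm [hA : IsMult A] [hB : IsMult B] : A * B = B * A := by
  obtain ⟨g, hg, rfl⟩ := hA.eq_mulOp
  obtain ⟨h, hh, rfl⟩ := hB.eq_mulOp
  exact mulOp_comm _ _ _ _

theorem gcomm_onMom : gcomm 1 (onMom A) (onMom B) = onMom (A * B - B * A) := by
  rw [gcomm, one_smul, onMom_sub, onMom_mul, onMom_mul]

theorem gcomm_mult [IsMult A] [IsMult B] : gcomm 1 (onMom A) (onMom B) = 0 := by
  rw [gcomm_onMom, IsMult.comm A B, sub_self, onMom_zero]

theorem gcomm_mult_opY [IsMult A] (a : ℝ) (k : Fin (D - 2)) : gcomm 1 (onMom A) (opY D a k) = 0 :=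
  gcomm_onMom_opY (fun i => IsMult.comm A (pTr D i)) a k

theorem gcomm_opY_mult [IsMult A] (a : ℝ) (k : Fin (D - 2)) : gcomm 1 (opY D a k) (onMom A) = 0 := by
  rw [gcomm_one_swap, gcomm_mult_opY, neg_zero]

theorem gcomm_opR_onMom (j k : Fin (D - 2)) : gcomm 1 (opR D j k) (onMom A) = 0 := by
  rw [gcomm_one_swap, gcomm_onMom_opR, neg_zero]
end

section
variable (D : ℕ)

theorem pPlus_mul_pPlusInv : pPlus D * pPlusInv D = 1 := by
  rw [IsMult.comm, pPlusInv_mul_pPlus]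

theorem onMom_pPlus_mul_pPlusInv : onMom (pPlus D) * onMom (pPlusInv D) = 1 := by
  rw [← onMom_mul, pPlus_mul_pPlusInv, onMom_one]

theorem gcomm_dPlus_pPlus : gcomm 1 (onMom (dPlus D)) (onMom (pPlus D)) = 1 := by
  rw [gcomm_onMom, dPlus_pPlus, onMom_one]

theorem gcomm_dTr_pPlus (j : Fin (D - 2)) : gcomm 1 (onMom (dTr D j)) (onMom (pPlus D)) = 0 := by
  rw [gcomm_onMom, dTr_pPlus, onMom_zero]

theorem gcomm_dPlus_pTr (j : Fin (D - 2)) : gcomm 1 (onMom (dPlus D)) (onMom (pTr D j)) = 0 := by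
  rw [gcomm_onMom, dPlus_pTr, onMom_zero]

theorem gcomm_dTr_pTr (j k : Fin (D - 2)) :
    gcomm 1 (onMom (dTr D j)) (onMom (pTr D k)) = kron j k • 1 := by
  rw [gcomm_onMom, dTr_pTr, onMom_smul, onMom_one]

theorem gcomm_dPlus_dTr (j : Fin (D - 2)) : gcomm 1 (onMom (dPlus D)) (onMom (dTr D j)) = 0 := by
  rw [gcomm_onMom, dPlus, dTr, derivOp_comm, sub_self, onMom_zero]

theorem gcomm_dTr_dTr (j k : Fin (D - 2)) : gcomm 1 (onMom (dTr D j)) (onMom (dTr D k)) = 0 := by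
  rw [gcomm_onMom, dTr, dTr, derivOp_comm, sub_self, onMom_zero]

theorem end_neg_mul (x y : Module.End ℂ (Dom D)) : -x * y = -(x * y) := neg_mul x y

theorem gcomm_self (x : Module.End ℂ (Dom D)) : gcomm 1 x x = 0 := by
  rw [gcomm, one_smul, sub_self]

/-- The commutator with an inverse. -/
theorem gcomm_inv {x y z : Module.End ℂ (Dom D)} (h1 : y * z = 1) (h2 : z * y = 1) :
    gcomm 1 x z = -(z * gcomm 1 x y * z) := by
  have h : gcomm 1 x (z * y) = 0 := by rw [h2, gcomm]; simp
  rw [gcomm_one_mul_right, add_eq_zero_iff_eq_neg] at h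
  calc gcomm 1 x z = gcomm 1 x z * (y * z) := by rw [h1, mul_one]
    _ = gcomm 1 x z * y * z := (mul_assoc _ _ _).symm
    _ = _ := by rw [h, end_neg_mul]

theorem gcomm_dPlus_pPlusInv : gcomm 1 (onMom (dPlus D)) (onMom (pPlusInv D)) =
    -(onMom (pPlusInv D) * onMom (pPlusInv D)) := by
  rw [gcomm_inv D (y := onMom (pPlus D)) (onMom_pPlus_mul_pPlusInv D)
    (by rw [← onMom_mul, pPlusInv_mul_pPlus, onMom_one]), gcomm_dPlus_pPlus, mul_one]

theorem gcomm_dTr_pPlusInv (j : Fin (D - 2)) :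
    gcomm 1 (onMom (dTr D j)) (onMom (pPlusInv D)) = 0 := by
  rw [gcomm_inv D (y := onMom (pPlus D)) (onMom_pPlus_mul_pPlusInv D)
    (by rw [← onMom_mul, pPlusInv_mul_pPlus, onMom_one]), gcomm_dTr_pPlus, mul_zero, zero_mul, neg_zero]

theorem onMom_pMinus (μ : ℝ) : onMom (pMinus D μ) = (1 / 2 : ℂ) • (onMom (pPlusInv D) *
    (∑ j, onMom (pTr D j) * onMom (pTr D j) + ((μ : ℂ) ^ 2) • 1)) := by
  have h : ∀ S : Finset (Fin (D - 2)), onMom (∑ j ∈ S, pTr D j * pTr D j) =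
      ∑ j ∈ S, onMom (pTr D j) * onMom (pTr D j) := fun S => by
    induction S using Finset.induction_on with
    | empty => simp [onMom_zero]
    | insert i S hi ih => rw [Finset.sum_insert hi, Finset.sum_insert hi, onMom_add, ih, onMom_mul]
  rw [pMinus_eq, onMom_smul, onMom_mul, onMom_add, onMom_smul, onMom_one, h]

theorem gcomm_dPlus_pMinus (μ : ℝ) : gcomm 1 (onMom (dPlus D)) (onMom (pMinus D μ)) =
    -(onMom (pPlusInv D) * onMom (pMinus D μ)) := by
  have h1 : gcomm 1 (onMom (dPlus D)) ((1 : Module.End ℂ (Dom D))) = 0 := by rw [gcomm]; simp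
  rw [onMom_pMinus, gcomm_smul_right, gcomm_one_mul_right, gcomm_add_right, gcomm_sum_right,
    gcomm_smul_right, h1, gcomm_dPlus_pPlusInv]
  simp only [gcomm_one_mul_right, gcomm_dPlus_pTr, mul_zero, zero_mul, add_zero,
    Finset.sum_const_zero, smul_zero, mul_smul_comm, end_neg_mul, mul_assoc, smul_neg]

theorem gcomm_dTr_pMinus (μ : ℝ) (j : Fin (D - 2)) :
    gcomm 1 (onMom (dTr D j)) (onMom (pMinus D μ)) = onMom (pPlusInv D) * onMom (pTr D j) := by
  have h1 : gcomm 1 (onMom (dTr D j)) ((1 : Module.End ℂ (Dom D))) = 0 := by rw [gcomm]; simp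
  rw [onMom_pMinus, gcomm_smul_right, gcomm_one_mul_right, gcomm_add_right, gcomm_sum_right,
    gcomm_smul_right, h1, gcomm_dTr_pPlusInv]
  have h2 : ∀ x : Module.End ℂ (Dom D), (1 / 2 : ℂ) • (x + x) = x := fun x => by module
  simp only [gcomm_one_mul_right, gcomm_dTr_pTr, smul_mul_assoc, one_mul, mul_smul_comm, mul_one,
    Finset.sum_add_distrib, sum_kron_smul, smul_zero, zero_mul, add_zero]
  rw [zero_add, mul_add, h2]

/-! ### Rotations -/

/-- The rotation generator up to the factor `-i`. -/
def opT (k l : Fin (D - 2)) : Module.End ℂ (Dom D) :=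
  (onMom (pTr D k) * onMom (dTr D l) - onMom (pTr D l) * onMom (dTr D k)) + opR D k l

theorem gcomm_opT_dTr (k l j : Fin (D - 2)) : gcomm 1 (opT D k l) (onMom (dTr D j)) =
    kron l j • onMom (dTr D k) - kron k j • onMom (dTr D l) := by
  have h : ∀ k, gcomm 1 (onMom (pTr D k)) (onMom (dTr D j)) = -(kron j k • 1) := fun k => by
    rw [gcomm_one_swap, gcomm_dTr_pTr]
  simp only [opT, gcomm_add_left, gcomm_sub_left, gcomm_one_mul_left, h, gcomm_dTr_dTr,
    gcomm_opR_onMom, kron_comm j, mul_zero, zero_add, add_zero, end_neg_mul, smul_mul_assoc, one_mul]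
  module

theorem gcomm_opT_osc (k l : Fin (D - 2)) (t : Bool) (p : ℤ) (i : Fin (D - 2)) :
    gcomm 1 (opT D k l) (osc D t p i) = kron l i • osc D t p k - kron k i • osc D t p l := by
  have h : gcomm 1 (onMom (pTr D k) * onMom (dTr D l) - onMom (pTr D l) * onMom (dTr D k))
      (osc D t p i) = if t = false ∧ p = 0 then kron l i • osc D t p k - kron k i • osc D t p l else 0 := by
    by_cases hp : t = true ∨ p ≠ 0
    · rw [if_neg (by rintro ⟨rfl, rfl⟩; simp at hp)]
      simp only [gcomm_sub_left, gcomm_one_mul_left, osc_onMom hp, mul_zero, zero_mul, add_zero,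
        sub_zero]
    · simp only [not_or, not_not, Bool.not_eq_true] at hp
      obtain ⟨rfl, rfl⟩ := hp
      rw [if_pos ⟨rfl, rfl⟩]
      change gcomm 1 _ (onMom (pTr D i)) = kron l i • onMom (pTr D k) - kron k i • onMom (pTr D l)
      simp only [gcomm_sub_left, gcomm_one_mul_left, gcomm_mult, gcomm_dTr_pTr, zero_mul, add_zero,
        mul_smul_comm, mul_one]
  rw [opT, gcomm_add_left, h, gcomm_opR]
  split_ifs <;> simp

/-- The total rotation `opT` rotates every oscillator, α_0 included, and the double commutators of Y
involve only invariant tensors. So Y^j rotates as a vector. -/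
theorem gcomm_opT_opY (a : ℝ) (k l j : Fin (D - 2)) : gcomm 1 (opT D k l) (opY D a j) =
    kron l j • opY D a k - kron k j • opY D a l := by
  have hT : HasWeight (opT D k l) 0 := by
    refine HasWeight.add (HasWeight.sub ?_ ?_) (hasWeight_opR D k l) <;>
    exact ((hasWeight_onMom _).mul (hasWeight_onMom _)).congr (zero_add _)
  rw [← sub_eq_zero]
  refine eq_zero_of_dcomm (((hT.gcomm (hasWeight_opY D a j) 1).congr (zero_add _)).sub
    (((hasWeight_opY D a k).smul _).sub ((hasWeight_opY D a l).smul _))) (fun g hg => ?_)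
    fun t u p q i₁ i₂ _ _ => ?_
  · have hd : ∀ i, gcomm 1 (opT D k l) (dOsc D 0 i) = kron l i • dOsc D 0 k - kron k i • dOsc D 0 l :=
      fun i => gcomm_opT_osc D k l true 0 i
    have ha : ∀ i, gcomm 1 (opT D k l) (alpha D 0 i) = kron l i • alpha D 0 k - kron k i • alpha D 0 l :=
      fun i => gcomm_opT_osc D k l false 0 i
    have hz : gcomm 1 (opT D k l) (zeroD D) = 0 := by
      simp only [zeroD, gcomm_sum_right, gcomm_one_mul_right, hd, ha, sub_mul, mul_sub, smul_mul_assoc,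
        mul_smul_comm, Finset.sum_add_distrib, Finset.sum_sub_distrib, sum_kron_smul]
      abel
    have hY : gcomm 1 (opT D k l) (zeroY D j) = kron l j • zeroY D k - kron k j • zeroY D l := by
      simp only [zeroY, gcomm_sub_right, gcomm_smul_right, gcomm_one_mul_right, hd, ha, hz, mul_zero,
        add_zero, sub_mul, smul_mul_assoc]
      module
    have hg' : AnnFrom 1 (opT D k l g) := by
      refine annFrom_one_of fun t m i hm => ?_
      have h := LinearMap.congr_fun (gcomm_opT_osc D k l t m i) g
      rw [gcomm_apply, one_smul, hg.osc_apply t hm, map_zero, zero_sub, LinearMap.sub_apply,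
        LinearMap.smul_apply, LinearMap.smul_apply, hg.osc_apply t hm, hg.osc_apply t hm, smul_zero,
        smul_zero, sub_zero, neg_eq_zero] at h
      exact h
    have h := LinearMap.congr_fun hY g
    rw [gcomm_apply] at h
    rw [LinearMap.sub_apply, gcomm_apply, opY_ground' hg, opY_ground' hg', h]
    simp only [LinearMap.sub_apply, LinearMap.smul_apply, opY_ground' hg, sub_self]
  · have e1 : ∀ (x y z : Module.End ℂ (Dom D)) (b c : ℂ), gcomm 1 x (b • y - c • z) =
        b • gcomm 1 x y - c • gcomm 1 x z := fun x y z b c => by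
      rw [gcomm_sub_right, gcomm_smul_right, gcomm_smul_right]
    rw [dcomm_sub, dcomm_sub, dcomm_smul, dcomm_smul, dcomm_gcomm]
    simp only [gcomm_opT_osc, gcomm_sub_right, gcomm_smul_right, gcomm_sub_left, gcomm_smul_left,
      ← dcomm.eq_def]
    simp only [dcomm_opY, gcomm_add_right, gcomm_smul_right, gcomm_opT_osc]
    rw [kron_comm l j, kron_comm k j, kron_comm i₁ k, kron_comm i₁ l]
    module

theorem AnnFrom.opR {g : Dom D} (hg : AnnFrom 1 g) (k l : Fin (D - 2)) :
    AnnFrom 1 (RamondString.opR D k l g) := by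
  refine annFrom_one_of fun t m i hm => ?_
  have h := LinearMap.congr_fun (gcomm_opR_of_ne D t m i k l (Or.inr hm.ne')) g
  rw [gcomm_apply, one_smul, hg.osc_apply t hm, map_zero, zero_sub, LinearMap.sub_apply,
    LinearMap.smul_apply, LinearMap.smul_apply, hg.osc_apply t hm, hg.osc_apply t hm, smul_zero,
    smul_zero, sub_zero, neg_eq_zero] at h
  exact h

theorem gcomm_opR_opR (k l p q : Fin (D - 2)) : gcomm 1 (opR D k l) (opR D p q) =
    kron l p • opR D k q - kron k p • opR D l q - kron l q • opR D k p + kron k q • opR D l p := by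
  rw [← sub_eq_zero]
  refine eq_zero_of_gcomm _ (fun _ => 1) (fun g hg => ?_) fun t m i hm => ?_
  · set S : Fin (D - 2) → Fin (D - 2) → Module.End ℂ (Dom D) := fun p q =>
      (1 / 2 : ℂ) • (dOsc D 0 p * dOsc D 0 q - dOsc D 0 q * dOsc D 0 p) with hS
    have hR : ∀ {g}, AnnFrom 1 g → ∀ p q, opR D p q g = S p q g := fun hg p q => opR_ground hg p q
    have hd : ∀ i, gcomm 1 (opR D k l) (dOsc D 0 i) = kron l i • dOsc D 0 k - kron k i • dOsc D 0 l :=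
      fun i => gcomm_opR_of_ne D true 0 i k l (Or.inl rfl)
    have h := LinearMap.congr_fun (show gcomm 1 (opR D k l) (S p q) =
        kron l p • S k q - kron k p • S l q - kron l q • S k p + kron k q • S l p by
      simp only [hS, gcomm_smul_right, gcomm_sub_right, gcomm_one_mul_right, hd, sub_mul, mul_sub,
        smul_mul_assoc, mul_smul_comm]
      module) g
    rw [gcomm_apply] at h
    rw [LinearMap.sub_apply, gcomm_apply, hR hg, hR (hg.opR D k l), h]
    simp only [LinearMap.sub_apply, LinearMap.add_apply, LinearMap.smul_apply, hR hg, sub_self]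
  · simp only [gcomm_sub_left, gcomm_add_left, gcomm_smul_left, gcomm_gcomm,
      gcomm_opR_of_ne _ _ _ _ _ _ hm, gcomm_sub_right, gcomm_smul_right]
    rw [kron_comm q k, kron_comm q l, kron_comm p k, kron_comm p l]
    module

theorem gcomm_opT_opT (k l p q : Fin (D - 2)) : gcomm 1 (opT D k l) (opT D p q) =
    kron l p • opT D k q - kron k p • opT D l q - kron l q • opT D k p + kron k q • opT D l p := by
  have ha : ∀ i, gcomm 1 (opT D k l) (onMom (pTr D i)) =
      kron l i • onMom (pTr D k) - kron k i • onMom (pTr D l) :=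
    fun i => gcomm_opT_osc D k l false 0 i
  -- The orbital part commutes with the Fock space rotations, so the brackets split into an orbital
  -- and an internal part.
  have hR : gcomm 1 (opT D k l) (opR D p q) = gcomm 1 (opR D k l) (opR D p q) := by
    simp only [opT, gcomm_add_left, gcomm_sub_left, gcomm_one_mul_left, gcomm_onMom_opR, mul_zero,
      zero_mul, add_zero, sub_zero, zero_add]
  have h : gcomm 1 (opT D k l) (opT D p q) = gcomm 1 (opT D k l) (onMom (pTr D p) * onMom (dTr D q)
      - onMom (pTr D q) * onMom (dTr D p)) + gcomm 1 (opT D k l) (opR D p q) := gcomm_add_right _ _ _ _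
  rw [h, hR, gcomm_opR_opR]
  simp only [gcomm_sub_right, gcomm_one_mul_right, gcomm_opT_dTr, ha, sub_mul, mul_sub, smul_mul_assoc,
    mul_smul_comm]
  simp only [opT]
  module

theorem hasWeight_opT (k l : Fin (D - 2)) : HasWeight (opT D k l) 0 := by
  refine HasWeight.add (HasWeight.sub ?_ ?_) (hasWeight_opR D k l) <;>
  exact ((hasWeight_onMom _).mul (hasWeight_onMom _)).congr (zero_add _)
end

/-! ### The generators up to factors `±i` and their commutators -/

section
variable (D : ℕ) (μ a : ℝ)

/-- The boost `J^{k+}` up to the factor `i`. -/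
def opA (k : Fin (D - 2)) : Module.End ℂ (Dom D) := onMom (pPlus D) * onMom (dTr D k)

/-- The boost `J^{+-}` up to the factor `-i`. -/
def opB : Module.End ℂ (Dom D) := onMom (pPlus D) * onMom (dPlus D)

/-- The boost `J^{k-}` up to the factor `i`. -/
def opC (k : Fin (D - 2)) : Module.End ℂ (Dom D) :=
  onMom (pMinus D μ) * onMom (dTr D k) + onMom (pTr D k) * onMom (dPlus D)
    - onMom (pPlusInv D) * opY D a k

theorem ramond_J (k l : Fin (D - 2)) : (ramond D μ a).J k l = (-Complex.I) • opT D k l := by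
  change onMom (orbTr D k l) + rotR D k l = _
  rw [orbTr, rotR_eq, onMom_smul, onMom_sub, onMom_mul, onMom_mul, opT, smul_add]

theorem ramond_Jpm_one (k : Fin (D - 2)) : (ramond D μ a).Jpm k 1 = Complex.I • opA D k := by
  change onMom (orbPlus D k) = _
  rw [orbPlus, onMom_smul, onMom_mul, opA]

theorem ramond_Jpm_neg_one (k : Fin (D - 2)) :
    (ramond D μ a).Jpm k (-1) = Complex.I • opC D μ a k := by
  change onMom (orbMinus D μ k) + onMom (pPlusInv D) * opK D a k = _
  rw [orbMinus, onMom_smul, onMom_add, onMom_mul, onMom_mul, opC, opK_eq,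
    mul_smul_comm]
  module

theorem ramond_JPM : (ramond D μ a).JPM = (-Complex.I) • opB D := by
  change onMom (orbPM D) = _
  rw [orbPM, onMom_smul, onMom_mul, opB]

theorem ramond_Ppm_one : (ramond D μ a).Ppm 1 = onMom (pPlus D) := rfl

theorem ramond_Ppm_neg_one : (ramond D μ a).Ppm (-1) = onMom (pMinus D μ) := rfl

theorem end_mul_one (x : Module.End ℂ (Dom D)) : x * 1 = x := mul_one x

theorem end_one_mul (x : Module.End ℂ (Dom D)) : 1 * x = x := one_mul x

theorem gcomm_dTr_dPlus (k : Fin (D - 2)) : gcomm 1 (onMom (dTr D k)) (onMom (dPlus D)) = 0 := by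
  rw [gcomm_one_swap, gcomm_dPlus_dTr, neg_zero]

theorem end_mul_neg (x y : Module.End ℂ (Dom D)) : x * -y = -(x * y) := mul_neg x y

theorem onMom_mult_comm (A B : Module.End ℂ (TestFn D)) [IsMult A] [IsMult B] :
    onMom A * onMom B = onMom B * onMom A := by
  rw [← onMom_mul, IsMult.comm A B, onMom_mul]

variable {D}

theorem gcomm_mult_dTr (A : Module.End ℂ (TestFn D)) [IsMult A] (k : Fin (D - 2)) :
    gcomm 1 (onMom A) (onMom (dTr D k)) = -gcomm 1 (onMom (dTr D k)) (onMom A) :=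
  gcomm_one_swap _ _ _

theorem gcomm_mult_dPlus (A : Module.End ℂ (TestFn D)) [IsMult A] :
    gcomm 1 (onMom A) (onMom (dPlus D)) = -gcomm 1 (onMom (dPlus D)) (onMom A) :=
  gcomm_one_swap _ _ _

/-- Operators that multiply by functions of `p⁺` and `p⁻` are rotation invariant. -/
theorem gcomm_opT_pPlus (k l : Fin (D - 2)) : gcomm 1 (opT D k l) (onMom (pPlus D)) = 0 := by
  simp only [opT, gcomm_add_left, gcomm_sub_left, gcomm_one_mul_left, gcomm_dTr_pPlus, gcomm_mult,
    gcomm_opR_onMom, mul_zero, zero_mul, add_zero, sub_zero]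

theorem gcomm_opT_pPlusInv (k l : Fin (D - 2)) : gcomm 1 (opT D k l) (onMom (pPlusInv D)) = 0 := by
  simp only [opT, gcomm_add_left, gcomm_sub_left, gcomm_one_mul_left, gcomm_dTr_pPlusInv, gcomm_mult,
    gcomm_opR_onMom, mul_zero, zero_mul, add_zero, sub_zero]

theorem gcomm_opT_pMinus (k l : Fin (D - 2)) : gcomm 1 (opT D k l) (onMom (pMinus D μ)) = 0 := by
  simp only [opT, gcomm_add_left, gcomm_sub_left, gcomm_one_mul_left, gcomm_dTr_pMinus, gcomm_mult,
    gcomm_opR_onMom, zero_mul, add_zero]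
  rw [onMom_mult_comm D (pPlusInv D) (pTr D l), onMom_mult_comm D (pPlusInv D) (pTr D k), ← mul_assoc,
    ← mul_assoc, onMom_mult_comm D (pTr D k) (pTr D l), sub_self]

theorem gcomm_opT_dPlus (k l : Fin (D - 2)) : gcomm 1 (opT D k l) (onMom (dPlus D)) = 0 := by
  simp only [opT, gcomm_add_left, gcomm_sub_left, gcomm_one_mul_left, gcomm_mult_dPlus,
    gcomm_dTr_dPlus, gcomm_dPlus_pTr, gcomm_opR_onMom, neg_zero, mul_zero, zero_mul, add_zero, sub_zero]

theorem gcomm_opT_pTr (k l j : Fin (D - 2)) : gcomm 1 (opT D k l) (onMom (pTr D j)) =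
    kron l j • onMom (pTr D k) - kron k j • onMom (pTr D l) := gcomm_opT_osc D k l false 0 j

theorem gcomm_opT_opA (k l j : Fin (D - 2)) : gcomm 1 (opT D k l) (opA D j) =
    kron l j • opA D k - kron k j • opA D l := by
  simp only [opA, gcomm_one_mul_right, gcomm_opT_pPlus, gcomm_opT_dTr, zero_mul, zero_add, mul_sub,
    mul_smul_comm]

theorem gcomm_opT_opB (k l : Fin (D - 2)) : gcomm 1 (opT D k l) (opB D) = 0 := by
  simp only [opB, gcomm_one_mul_right, gcomm_opT_pPlus, gcomm_opT_dPlus, zero_mul, mul_zero, add_zero]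

theorem gcomm_opT_opC (k l j : Fin (D - 2)) : gcomm 1 (opT D k l) (opC D μ a j) =
    kron l j • opC D μ a k - kron k j • opC D μ a l := by
  simp only [opC, gcomm_one_mul_right, gcomm_sub_right, gcomm_add_right, gcomm_opT_pPlusInv,
    gcomm_opT_pMinus, gcomm_opT_pTr, gcomm_opT_dTr, gcomm_opT_dPlus, gcomm_opT_opY, zero_mul, mul_zero,
    zero_add, add_zero, sub_mul, mul_sub, mul_smul_comm, smul_mul_assoc]
  module

theorem gcomm_pPlus_opB : gcomm 1 (onMom (pPlus D)) (opB D) = -onMom (pPlus D) := by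
  simp only [opB, gcomm_one_mul_right, gcomm_mult, gcomm_mult_dPlus, gcomm_dPlus_pPlus, zero_mul,
    zero_add, end_mul_neg, mul_one]

theorem gcomm_pMinus_opB : gcomm 1 (onMom (pMinus D μ)) (opB D) = onMom (pMinus D μ) := by
  simp only [opB, gcomm_one_mul_right, gcomm_mult, gcomm_mult_dPlus, gcomm_dPlus_pMinus, zero_mul,
    zero_add, neg_neg]
  rw [← mul_assoc, onMom_pPlus_mul_pPlusInv, one_mul]

theorem gcomm_pTr_opB (j : Fin (D - 2)) : gcomm 1 (onMom (pTr D j)) (opB D) = 0 := by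
  simp only [opB, gcomm_one_mul_right, gcomm_mult, gcomm_mult_dPlus, gcomm_dPlus_pTr, zero_mul,
    mul_zero, neg_zero, add_zero]

theorem gcomm_pPlus_opA (k : Fin (D - 2)) : gcomm 1 (onMom (pPlus D)) (opA D k) = 0 := by
  simp only [opA, gcomm_one_mul_right, gcomm_mult, gcomm_mult_dTr, gcomm_dTr_pPlus, zero_mul,
    mul_zero, neg_zero, add_zero]

theorem gcomm_pMinus_opA (k : Fin (D - 2)) :
    gcomm 1 (onMom (pMinus D μ)) (opA D k) = -onMom (pTr D k) := by
  simp only [opA, gcomm_one_mul_right, gcomm_mult, gcomm_mult_dTr, gcomm_dTr_pMinus, zero_mul,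
    end_mul_neg, zero_add]
  rw [← mul_assoc, onMom_pPlus_mul_pPlusInv, one_mul]

theorem gcomm_pTr_opA (j k : Fin (D - 2)) :
    gcomm 1 (onMom (pTr D j)) (opA D k) = -(kron j k • onMom (pPlus D)) := by
  simp only [opA, gcomm_one_mul_right, gcomm_mult, gcomm_mult_dTr, gcomm_dTr_pTr, zero_mul,
    end_mul_neg, zero_add, mul_smul_comm, mul_one, kron_comm k j]

theorem gcomm_pPlus_opC (k : Fin (D - 2)) :
    gcomm 1 (onMom (pPlus D)) (opC D μ a k) = -onMom (pTr D k) := by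
  simp only [opC, gcomm_sub_right, gcomm_add_right, gcomm_one_mul_right, gcomm_mult, gcomm_mult_opY,
    gcomm_mult_dTr, gcomm_mult_dPlus, gcomm_dTr_pPlus, gcomm_dPlus_pPlus, zero_mul, mul_zero, neg_zero,
    end_mul_neg, mul_one, zero_add, add_zero, sub_zero]

theorem gcomm_pMinus_opC (k : Fin (D - 2)) :
    gcomm 1 (onMom (pMinus D μ)) (opC D μ a k) = 0 := by
  simp only [opC, gcomm_sub_right, gcomm_add_right, gcomm_one_mul_right, gcomm_mult, gcomm_mult_opY,
    gcomm_mult_dTr, gcomm_mult_dPlus, gcomm_dTr_pMinus, gcomm_dPlus_pMinus, zero_mul, mul_zero,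
    end_mul_neg, zero_add, add_zero, sub_zero, neg_neg]
  rw [onMom_mult_comm D (pPlusInv D) (pTr D k), onMom_mult_comm D (pPlusInv D) (pMinus D μ),
    ← mul_assoc, ← mul_assoc, onMom_mult_comm D (pMinus D μ) (pTr D k), neg_add_cancel]

theorem gcomm_pTr_opC (j k : Fin (D - 2)) :
    gcomm 1 (onMom (pTr D j)) (opC D μ a k) = -(kron j k • onMom (pMinus D μ)) := by
  simp only [opC, gcomm_sub_right, gcomm_add_right, gcomm_one_mul_right, gcomm_mult, gcomm_mult_opY,
    gcomm_mult_dTr, gcomm_mult_dPlus, gcomm_dTr_pTr, gcomm_dPlus_pTr, zero_mul, mul_zero,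
    end_mul_neg, zero_add, add_zero, sub_zero, neg_zero, mul_smul_comm, mul_one, kron_comm k j]

theorem gcomm_dPlus_opY (k : Fin (D - 2)) : gcomm 1 (onMom (dPlus D)) (opY D a k) = 0 :=
  gcomm_onMom_opY (fun i => by rw [← sub_eq_zero]; exact dPlus_pTr D i) a k

theorem gcomm_opB_opA (k : Fin (D - 2)) : gcomm 1 (opB D) (opA D k) = opA D k := by
  simp only [opA, opB, gcomm_one_mul_left, gcomm_one_mul_right, gcomm_mult, gcomm_mult_dTr,
    gcomm_dTr_pPlus, gcomm_dPlus_dTr, gcomm_dPlus_pPlus, zero_mul, mul_zero, neg_zero, add_zero,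
    end_mul_one]

theorem gcomm_opB_opC (k : Fin (D - 2)) : gcomm 1 (opB D) (opC D μ a k) = -opC D μ a k := by
  have h1 : ∀ x : Module.End ℂ (Dom D), onMom (pPlus D) * (onMom (pPlusInv D) * x) = x := fun x => by
    rw [← mul_assoc, onMom_pPlus_mul_pPlusInv, one_mul]
  simp only [opC, opB, gcomm_sub_right, gcomm_add_right, gcomm_one_mul_left, gcomm_one_mul_right,
    gcomm_mult, gcomm_mult_dTr, gcomm_mult_dPlus, gcomm_mult_opY, gcomm_dPlus_opY, gcomm_dTr_pPlus,
    gcomm_dPlus_dTr, gcomm_dPlus_pPlus, gcomm_dPlus_pMinus, gcomm_dPlus_pTr, gcomm_dPlus_pPlusInv,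
    gcomm_self, end_neg_mul, end_mul_neg, zero_mul, mul_zero, neg_zero, add_zero, zero_add,
    end_one_mul, h1]
  abel

theorem gcomm_opA_opA (j k : Fin (D - 2)) : gcomm 1 (opA D j) (opA D k) = 0 := by
  simp only [opA, gcomm_one_mul_left, gcomm_one_mul_right, gcomm_mult, gcomm_mult_dTr,
    gcomm_dTr_pPlus, gcomm_dTr_dTr, zero_mul, mul_zero, neg_zero, add_zero]

/-- The derivative contained in `opA` acts on Y^k and yields R, which is precisely the internal part
missing from the orbital rotation. -/
theorem gcomm_opA_opC (j k : Fin (D - 2)) :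
    gcomm 1 (opA D j) (opC D μ a k) = opT D j k + kron j k • opB D := by
  have h1 : ∀ x : Module.End ℂ (Dom D), onMom (pPlus D) * (onMom (pPlusInv D) * x) = x := fun x => by
    rw [← mul_assoc, onMom_pPlus_mul_pPlusInv, one_mul]
  have h2 : ∀ x : Module.End ℂ (Dom D), onMom (pPlusInv D) * (onMom (pPlus D) * x) = x := fun x => by
    rw [← mul_assoc, onMom_mult_comm, onMom_pPlus_mul_pPlusInv, one_mul]
  simp only [opC, opA, opB, opT, gcomm_sub_right, gcomm_add_right, gcomm_one_mul_left, gcomm_one_mul_right,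
    gcomm_mult, gcomm_mult_dTr, gcomm_mult_dPlus, gcomm_mult_opY, gcomm_dTr_opY, gcomm_dTr_pPlus, gcomm_dTr_dPlus,
    gcomm_dTr_dTr, gcomm_dPlus_pPlus, gcomm_dTr_pMinus, gcomm_dTr_pTr, gcomm_dTr_pPlusInv,
    end_neg_mul, end_mul_neg, zero_mul, mul_zero, neg_zero, add_zero, zero_add, mul_one, smul_mul_assoc,
    one_mul, mul_smul_comm, h1]
  rw [opR_antisymm D k j, end_mul_neg, end_mul_neg, h2]
  abel

/-- Derivatives acting on Y give the term 2 p⁻ R / p⁺, that is (p² + μ²) R / (p⁺)². Its p² part is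
the one contained in the defect, which leaves μ² R, while the H R term of the defect must be
subtracted again. Since j ≠ k, no Kronecker terms survive. -/
theorem gcomm_opC_opC {j k : Fin (D - 2)} (hjk : j ≠ k) : gcomm 1 (opC D μ a j) (opC D μ a k) =
    onMom (pPlusInv D) * (onMom (pPlusInv D) * (opX D a j k
      + (((μ : ℂ) ^ 2) • opR D j k - (2 : ℂ) • (ham D * opR D j k)))) := by
  have h3 : ∀ (A : Module.End ℂ (TestFn D)) [IsMult A] j, gcomm 1 (opY D a j) (onMom A) = 0 :=
    fun A _ j => gcomm_opY_mult A a j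
  have h4 : ∀ l m, gcomm 1 (opY D a l) (onMom (dTr D m)) = - opR D l m := fun l m => by
    rw [gcomm_one_swap, gcomm_dTr_opY]
  have h5 : ∀ l, gcomm 1 (opY D a l) (onMom (dPlus D)) = 0 := fun l => by
    rw [gcomm_one_swap, gcomm_dPlus_opY, neg_zero]
  have hjk' : kron j k = 0 := if_neg hjk
  have hkj : kron k j = 0 := if_neg hjk.symm
  simp only [opC, gcomm_sub_right, gcomm_add_right, gcomm_sub_left, gcomm_add_left,
    gcomm_one_mul_left, gcomm_one_mul_right,
    gcomm_mult, gcomm_mult_dTr, gcomm_mult_dPlus, gcomm_mult_opY, gcomm_dTr_opY, gcomm_dTr_dPlus, h3, h4, h5,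
    gcomm_dPlus_opY, gcomm_dPlus_dTr, gcomm_dPlus_pMinus, gcomm_dPlus_pTr, gcomm_self,
    gcomm_dTr_dTr, gcomm_dTr_pMinus, gcomm_dTr_pTr, gcomm_dTr_pPlusInv, gcomm_dPlus_pPlusInv,
    hjk', hkj, zero_smul,
    end_neg_mul, end_mul_neg, zero_mul, mul_zero, neg_zero, add_zero, zero_add,
    mul_assoc]
  have c1 : ∀ l (x : Module.End ℂ (Dom D)), onMom (pTr D l) * (onMom (pPlusInv D) * x) =
      onMom (pPlusInv D) * (onMom (pTr D l) * x) := fun l x => by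
    rw [← mul_assoc, onMom_mult_comm, mul_assoc]
  have c2 : ∀ (x : Module.End ℂ (Dom D)), onMom (pMinus D μ) * (onMom (pPlusInv D) * x) =
      onMom (pPlusInv D) * (onMom (pMinus D μ) * x) := fun x => by
    rw [← mul_assoc, onMom_mult_comm, mul_assoc]
  have c3 : ∀ l (x : Module.End ℂ (Dom D)), onMom (pTr D l) * (onMom (pMinus D μ) * x) =
      onMom (pMinus D μ) * (onMom (pTr D l) * x) := fun l x => by
    rw [← mul_assoc, onMom_mult_comm, mul_assoc]
  have hM : onMom (pMinus D μ) * opR D j k = (1 / 2 : ℂ) • (onMom (pPlusInv D) *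
      ((∑ l, onMom (pTr D l) * onMom (pTr D l)) * opR D j k + ((μ : ℂ) ^ 2) • opR D j k)) := by
    rw [onMom_pMinus, smul_mul_assoc, mul_assoc, add_mul, smul_mul_assoc, end_one_mul]
  simp only [c1, c2, c3, opR_antisymm D k j, end_mul_neg, hM, opX, opH, alpha_zero, add_mul, mul_add,
    mul_sub, smul_mul_assoc, mul_smul_comm, gcomm, one_smul]
  module
end

/-! ### The spectrum of the Hamiltonian on the domain -/

theorem boseCre_boseAnn_single (D k : ℕ) (j : Fin (D - 2)) (s : FockIndex D) :
    boseCre D k j (boseAnn D k j (Finsupp.single s 1)) = s.1 (k, j) • Finsupp.single s 1 := by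
  obtain ⟨n, S⟩ := s
  rw [boseAnn_single, boseCre_single]
  rcases Nat.eq_zero_or_pos (n (k, j)) with h0 | h0
  · simp [h0]
  · have h1 : n - Finsupp.single (k, j) 1 + Finsupp.single (k, j) 1 = n :=
      tsub_add_cancel_of_le (by simpa using Nat.succ_le_of_lt h0)
    have h2 : ((((n - Finsupp.single (k, j) 1 : (ℕ × Fin (D - 2)) →₀ ℕ)) (k, j) : ℕ) : ℝ) + 1 = n (k, j) := by
      have := DFunLike.congr_fun h1 (k, j)
      rw [Finsupp.add_apply, Finsupp.single_eq_same] at this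
      exact_mod_cast this
    simp only [h1, h2, one_mul]
    rw [← Complex.ofReal_mul, Real.mul_self_sqrt (by positivity)]
    simp

theorem fermiCre_fermiAnn_single (D k : ℕ) (j : Fin (D - 2)) (s : FockIndex D) :
    fermiCre D k j (fermiAnn D k j (Finsupp.single s 1)) =
      (if toLex (k, j) ∈ s.2 then 1 else 0 : ℕ) • Finsupp.single s 1 := by
  obtain ⟨n, S⟩ := s
  rw [fermiAnn_single]
  by_cases h : toLex (k, j) ∈ S
  · have h1 := fermiSign_erase (y := toLex (k, j)) h
    rw [if_neg (lt_irrefl _), one_mul] at h1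
    simp [h, h1, fermiSign_mul_self]
  · simp [h]

/-- Each summand of H multiplies an occupation number state by a natural number. Working in the
additive submonoid of multiples of the vector keeps the eigenvalue natural without computing it. -/
theorem exists_ham_single (D : ℕ) (f : TestFn D) (s : FockIndex D) :
    ∃ n : ℕ, ham D (f ⊗ₜ[ℂ] (Finsupp.single s 1 : Fock D)) =
      (n : ℂ) • f ⊗ₜ[ℂ] (Finsupp.single s 1 : Fock D) := by
  set v : Dom D := f ⊗ₜ[ℂ] (Finsupp.single s 1 : Fock D) with hv
  suffices h : ham D v ∈ AddSubmonoid.multiples v by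
    obtain ⟨n, hn⟩ := h
    exact ⟨n, by rw [← hn, Nat.cast_smul_eq_nsmul]⟩
  rw [ham, locSum_apply]
  refine finsum_induction (· ∈ AddSubmonoid.multiples v) (zero_mem _) (fun _ _ => add_mem) fun r => ?_
  rw [hamTerm, LinearMap.sum_apply]
  refine sum_mem fun i _ => ?_
  have h1 : alpha D (-((r : ℤ) + 1)) i (alpha D ((r : ℤ) + 1) i v) = ((r + 1) * s.1 (r, i)) • v := by
    have e : alpha D (-((r : ℤ) + 1)) i = onFock (((Real.sqrt (r + 1) : ℝ) : ℂ) • boseCre D r i) := by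
      rw [← alpha_neg, Int.negSucc_eq]
    have e' : alpha D ((r : ℤ) + 1) i = onFock (((Real.sqrt (r + 1) : ℝ) : ℂ) • boseAnn D r i) :=
      alpha_pos D r i
    rw [e, e', hv, onFock, onFock, LinearMap.lTensor_tmul, LinearMap.lTensor_tmul, LinearMap.smul_apply,
      LinearMap.smul_apply, map_smul, boseCre_boseAnn_single, smul_smul, sqrt_mul_self_succ,
      ← Nat.cast_smul_eq_nsmul ℂ, ← Nat.cast_smul_eq_nsmul ℂ, smul_smul, TensorProduct.tmul_smul]
    push_cast
    rfl
  have h2 : dOsc D (-((r : ℤ) + 1)) i (dOsc D ((r : ℤ) + 1) i v) =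
      (if toLex (r + 1, i) ∈ s.2 then 1 else 0 : ℕ) • v := by
    have e : dOsc D (-((r : ℤ) + 1)) i = onFock (fermiCre D (r + 1) i) := by
      rw [← dOsc_neg, Int.negSucc_eq]
    have e' : dOsc D ((r : ℤ) + 1) i = onFock (fermiAnn D (r + 1) i) := dOsc_pos D r i
    rw [e, e', hv, onFock, onFock, LinearMap.lTensor_tmul, LinearMap.lTensor_tmul,
      fermiCre_fermiAnn_single, ← Nat.cast_smul_eq_nsmul ℂ, ← Nat.cast_smul_eq_nsmul ℂ,
      TensorProduct.tmul_smul]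
  have h3 : ((r : ℂ) + 1) = ((r + 1 : ℕ) : ℂ) := by push_cast; rfl
  rw [LinearMap.add_apply, LinearMap.smul_apply, Module.End.mul_apply, Module.End.mul_apply, h1, h2, h3,
    Nat.cast_smul_eq_nsmul]
  exact add_mem (nsmul_mem (AddSubmonoid.mem_multiples v) _)
    (nsmul_mem (nsmul_mem (AddSubmonoid.mem_multiples v) _) _)

/-- The eigenvalue must not depend on f. A rank one operator on momentum space carries a fixed
nonzero test function to f, and it commutes with H. -/
theorem exists_ham_tmul_single (D : ℕ) (s : FockIndex D) :
    ∃ n : ℕ, ∀ f : TestFn D, ham D (f ⊗ₜ[ℂ] (Finsupp.single s 1 : Fock D)) =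
      (n : ℂ) • f ⊗ₜ[ℂ] (Finsupp.single s 1 : Fock D) := by
  by_cases h : ∃ f : TestFn D, f ≠ 0
  · obtain ⟨f₀, hf₀⟩ := h
    obtain ⟨n, hn⟩ := exists_ham_single D f₀ s
    obtain ⟨φ, hφ⟩ := Module.Projective.exists_dual_eq_one ℂ hf₀
    refine ⟨n, fun f => ?_⟩
    have h1 : onMom (LinearMap.toSpanSingleton ℂ _ f ∘ₗ φ) (f₀ ⊗ₜ[ℂ] (Finsupp.single s 1 : Fock D)) =
        f ⊗ₜ[ℂ] (Finsupp.single s 1 : Fock D) := by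
      rw [onMom, LinearMap.rTensor_tmul, LinearMap.comp_apply, hφ, LinearMap.toSpanSingleton_apply,
        one_smul]
    have h2 := (hasWeight_onMom (LinearMap.toSpanSingleton ℂ _ f ∘ₗ φ)).apply hn
    rwa [h1, sub_zero] at h2
  · simp only [not_exists, not_not] at h
    exact ⟨0, fun f => by rw [h f, TensorProduct.zero_tmul, map_zero, smul_zero]⟩

/-! ### States in the eigenspaces of the Hamiltonian -/

/-- The coefficient of an occupation number state. -/
def comp {D : ℕ} (s : FockIndex D) : Dom D →ₗ[ℂ] TestFn D :=
  Finsupp.lapply s ∘ₗ (TensorProduct.finsuppScalarRight ℂ ℂ (TestFn D) (FockIndex D)).toLinearMap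

theorem comp_tmul {D : ℕ} (s : FockIndex D) (f : TestFn D) (x : Fock D) :
    comp s (f ⊗ₜ[ℂ] x) = x s • f := TensorProduct.finsuppScalarRight_apply_tmul_apply _ _ _

theorem ext_comp {D : ℕ} {v w : Dom D} (h : ∀ s, comp s v = comp s w) : v = w :=
  (TensorProduct.finsuppScalarRight ℂ ℂ (TestFn D) (FockIndex D)).injective (Finsupp.ext h)

theorem dom_induction {D : ℕ} {p : Dom D → Prop} (h0 : p 0) (ha : ∀ v w, p v → p w → p (v + w))
    (h1 : ∀ f s, p (f ⊗ₜ[ℂ] (Finsupp.single s 1 : Fock D))) (v : Dom D) : p v := by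
  induction v using TensorProduct.induction_on with
  | zero => exact h0
  | add x y hx hy => exact ha x y hx hy
  | tmul f φ =>
    induction φ using Finsupp.induction_linear with
    | zero => rw [TensorProduct.tmul_zero]; exact h0
    | add x y hx hy => rw [TensorProduct.tmul_add]; exact ha _ _ hx hy
    | single s c =>
      have : (Finsupp.single s c : Fock D) = c • Finsupp.single s 1 := by simp
      rw [this, TensorProduct.tmul_smul, TensorProduct.smul_tmul']
      exact h1 _ s

theorem toHilbert_single {D : ℕ} (f : TestFn D) (s : FockIndex D) :
    toHilbert D (f ⊗ₜ[ℂ] (Finsupp.single s 1 : Fock D)) =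
      lp.single (E := fun _ : FockIndex D => OneParticle D) 2 s (TestFn.toL2 D f) := by
  simp [toHilbert]

theorem toHilbert_apply {D : ℕ} (v : Dom D) (s : FockIndex D) :
    toHilbert D v s = TestFn.toL2 D (comp s v) := by
  induction v using dom_induction with
  | h0 => simp
  | ha v w hv hw => rw [map_add, map_add, map_add, ← hv, ← hw]; rfl
  | h1 f r =>
    rw [toHilbert_single, comp_tmul]
    by_cases h : r = s
    · subst h; simp
    · rw [lp.single_apply_ne _ _ _ (Ne.symm h), Finsupp.single_apply, if_neg h, zero_smul, map_zero]

/-- The density 1/(2p⁺) is positive on the open half space, so equality almost everywhere is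
equality for continuous functions there; outside the half space test functions vanish. -/
theorem toL2_injective (D : ℕ) : Function.Injective (TestFn.toL2 D) := by
  rw [← LinearMap.ker_eq_bot, LinearMap.ker_eq_bot']
  intro f hf
  have h1 : (f : Mom D → ℂ) =ᵐ[lcMeasure D] 0 := (MeasureTheory.MemLp.toLp_eq_toLp_iff f.memLp MeasureTheory.MemLp.zero).1
    (hf.trans (MeasureTheory.MemLp.toLp_zero _).symm)
  have h2 : (f : Mom D → ℂ) =ᵐ[MeasureTheory.volume.restrict {p : Mom D | 0 < p.1}] 0 := by
    rw [Filter.EventuallyEq, lcMeasure, MeasureTheory.ae_withDensity_iff (by fun_prop)] at h1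
    have hm : MeasurableSet {p : Mom D | 0 < p.1} := (halfSpace D).isOpen.measurableSet
    filter_upwards [h1, MeasureTheory.ae_restrict_mem hm] with p hp hp'
    refine hp ?_
    have : 0 < p.1 := hp'
    simpa using this
  have h3 := MeasureTheory.Measure.eqOn_open_of_ae_eq h2 (halfSpace D).isOpen
    f.continuous.continuousOn continuousOn_const
  ext p
  by_cases hp : 0 < p.1
  · exact h3 hp
  · have : p ∉ tsupport f := fun h => hp (f.tsupport_subset h)
    exact image_eq_zero_of_notMem_tsupport this

/-- H acts on the component of each occupation number state by a natural number, and the embedding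
into the Hilbert space is injective on components. Hence the weak eigenvalue equation is an equation
for each component separately. -/
theorem mem_statesIn_energySpace {D : ℕ} {ℓ : ℝ} {Ψ : Dom D} :
    Ψ ∈ statesIn (energySpace D ℓ) ↔ ham D Ψ = (ℓ : ℂ) • Ψ := by
  have key : ∀ s : FockIndex D, ∃ n : ℕ, (∀ v, comp s (ham D v) = (n : ℂ) • comp s v) ∧
      ∀ f : TestFn D, ham D (f ⊗ₜ[ℂ] (Finsupp.single s 1 : Fock D)) =
        (n : ℂ) • f ⊗ₜ[ℂ] (Finsupp.single s 1 : Fock D) := by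
    intro s
    obtain ⟨n, hn⟩ := exists_ham_tmul_single D s
    refine ⟨n, fun v => ?_, hn⟩
    induction v using dom_induction with
    | h0 => simp
    | ha v w hv hw => rw [map_add, map_add, hv, hw, map_add, smul_add]
    | h1 f r =>
      by_cases h : r = s
      · subst h; rw [hn, map_smul]
      · obtain ⟨m, hm⟩ := exists_ham_tmul_single D r
        rw [hm, map_smul, comp_tmul, Finsupp.single_apply, if_neg h, zero_smul, smul_zero, smul_zero]
  change (∀ Φ : Dom D, inner ℂ (toHilbert D (ham D Φ)) (toHilbert D Ψ) =
    (ℓ : ℂ) * inner ℂ (toHilbert D Φ) (toHilbert D Ψ)) ↔ _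
  constructor
  · intro h
    refine ext_comp fun s => ?_
    obtain ⟨n, h1, h2⟩ := key s
    -- Testing against the component itself gives (n - ℓ) times its squared norm.
    have h3 := h ((comp s Ψ) ⊗ₜ[ℂ] (Finsupp.single s 1 : Fock D))
    rw [h2, map_smul, inner_smul_left, toHilbert_single, lp.inner_single_left, toHilbert_apply,
      Complex.conj_natCast, ← sub_eq_zero, ← sub_mul, mul_eq_zero, inner_self_eq_zero] at h3
    rw [h1, map_smul]
    rcases h3 with h3 | h3
    · rw [sub_eq_zero.1 h3]
    · rw [toL2_injective D (h3.trans (map_zero _).symm), smul_zero, smul_zero]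
  · intro h Φ
    induction Φ using dom_induction with
    | h0 => simp
    | ha v w hv hw => simp only [map_add, inner_add_left, hv, hw, mul_add]
    | h1 f s =>
      obtain ⟨n, h1, h2⟩ := key s
      rw [h2, map_smul, inner_smul_left, toHilbert_single, lp.inner_single_left, toHilbert_apply,
        Complex.conj_natCast, ← inner_smul_right, ← inner_smul_right, ← map_smul, ← h1, h,
        map_smul, map_smul]

/-! ### The Poincaré algebra on a subspace -/

section
variable {D : ℕ} (μ a : ℝ)

theorem lie_eq_gcomm (x y : Module.End ℂ (Dom D)) : ⁅x, y⁆ = gcomm 1 x y := by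
  rw [gcomm, one_smul]; rfl

theorem opT_antisymm (k l : Fin (D - 2)) : opT D k l = -opT D l k := by
  rw [opT, opT, opR_antisymm D k l]
  abel

theorem lie_smul_smul (b c : ℂ) (x y : Module.End ℂ (Dom D)) (v : Dom D) :
    ⁅b • x, c • y⁆ v = (b * c) • gcomm 1 x y v := by
  rw [lie_eq_gcomm, gcomm_smul_left, gcomm_smul_right, smul_smul, LinearMap.smul_apply]

theorem lie_smul_right (c : ℂ) (x y : Module.End ℂ (Dom D)) (v : Dom D) :
    ⁅x, c • y⁆ v = c • gcomm 1 x y v := by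
  rw [lie_eq_gcomm, gcomm_smul_right, LinearMap.smul_apply]

theorem hasWeight_opC (k : Fin (D - 2)) : HasWeight (opC D μ a k) 0 := by
  refine HasWeight.sub (HasWeight.add ?_ ?_) ?_
  · exact ((hasWeight_onMom _).mul (hasWeight_onMom _)).congr (zero_add _)
  · exact ((hasWeight_onMom _).mul (hasWeight_onMom _)).congr (zero_add _)
  · exact ((hasWeight_onMom _).mul (hasWeight_opY _ _ _)).congr (zero_add _)

theorem preserves_energy (ℓ : ℝ) : (ramond D μ a).Preserves (statesIn (energySpace D ℓ)) := by
  have key : ∀ {x : Module.End ℂ (Dom D)}, HasWeight x 0 → ∀ Ψ ∈ statesIn (energySpace D ℓ),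
      x Ψ ∈ statesIn (energySpace D ℓ) := fun hx Ψ hΨ => by
    rw [mem_statesIn_energySpace] at hΨ ⊢
    rw [hx.apply hΨ, sub_zero]
  refine ⟨fun e => ?_, fun j => key (hasWeight_onMom _), fun j k => ?_, fun j e => ?_,
    key (hasWeight_onMom _)⟩
  · rcases Int.units_eq_one_or e with rfl | rfl
    · exact key (hasWeight_onMom _)
    · exact key (hasWeight_onMom _)
  · rw [ramond_J]
    exact key ((hasWeight_opT D j k).smul _)
  · rcases Int.units_eq_one_or e with rfl | rfl
    · exact key (hasWeight_onMom _)
    · rw [ramond_Jpm_neg_one]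
      exact key ((hasWeight_opC μ a j).smul _)

/-- All other brackets are operator identities on the full domain, so S matters only for the bracket
of two generators J^{j-}. -/
theorem bracketsOn_iff (S : Submodule ℂ (Dom D)) : (ramond D μ a).BracketsOn S ↔
    ∀ j k, ∀ Ψ ∈ S, gcomm 1 (opC D μ a j) (opC D μ a k) Ψ = 0 := by
  have hP : ∀ j, (ramond D μ a).P j = onMom (pTr D j) := fun j => rfl
  have I2 : Complex.I * Complex.I = -1 := Complex.I_mul_I
  constructor
  · intro h j k Ψ hΨ
    have h1 := h.Jpm_Jpm j (-1) k (-1) Ψ hΨ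
    rw [ramond_Jpm_neg_one, ramond_Jpm_neg_one, lie_smul_smul, I2] at h1
    simpa using h1
  · intro h
    refine ⟨?_, ?_, ?_, ?_, ?_, ?_, ?_, ?_, ?_, ?_, ?_, ?_, ?_, ?_, ?_⟩
    · intro j k Ψ _
      rw [ramond_J, ramond_J, opT_antisymm]
      simp
    · intro e f Ψ _
      rcases Int.units_eq_one_or e with rfl | rfl <;> rcases Int.units_eq_one_or f with rfl | rfl <;>
      simp only [ramond_Ppm_one, ramond_Ppm_neg_one, lie_eq_gcomm, gcomm_mult, LinearMap.zero_apply]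
    · intro e j Ψ _
      rcases Int.units_eq_one_or e with rfl | rfl <;>
      simp only [hP, ramond_Ppm_one, ramond_Ppm_neg_one, lie_eq_gcomm, gcomm_mult, LinearMap.zero_apply]
    · intro j k Ψ _
      simp only [hP, lie_eq_gcomm, gcomm_mult, LinearMap.zero_apply]
    · intro e j k Ψ _
      rcases Int.units_eq_one_or e with rfl | rfl <;>
      simp only [ramond_Ppm_one, ramond_Ppm_neg_one, ramond_J, lie_smul_right, gcomm_one_swap D (onMom _),
        gcomm_opT_pPlus, gcomm_opT_pMinus, neg_zero, LinearMap.zero_apply, smul_zero]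
    · intro j Ψ _
      rw [hP, ramond_JPM, lie_smul_right, gcomm_pTr_opB, LinearMap.zero_apply, smul_zero]
    · intro e Ψ _
      rcases Int.units_eq_one_or e with rfl | rfl
      · rw [ramond_Ppm_one, ramond_JPM, lie_smul_right, gcomm_pPlus_opB]
        simp
      · rw [ramond_Ppm_neg_one, ramond_JPM, lie_smul_right, gcomm_pMinus_opB]
        simp
    · intro e j f Ψ _
      rw [hP]
      rcases Int.units_eq_one_or e with rfl | rfl <;> rcases Int.units_eq_one_or f with rfl | rfl
      · rw [ramond_Ppm_one, ramond_Jpm_one, lie_smul_right, gcomm_pPlus_opA]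
        simp
      · rw [ramond_Ppm_one, ramond_Jpm_neg_one, lie_smul_right, gcomm_pPlus_opC, LinearMap.neg_apply]
        push_cast [Units.val_one, Units.val_neg]
        module
      · rw [ramond_Ppm_neg_one, ramond_Jpm_one, lie_smul_right, gcomm_pMinus_opA, LinearMap.neg_apply]
        push_cast [Units.val_one, Units.val_neg]
        module
      · rw [ramond_Ppm_neg_one, ramond_Jpm_neg_one, lie_smul_right, gcomm_pMinus_opC]
        simp
    · intro j k l Ψ _
      rw [hP, hP, hP, ramond_J, lie_smul_right, gcomm_one_swap, gcomm_opT_pTr, kron_comm j k,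
        kron_comm j l]
      simp only [LinearMap.neg_apply, LinearMap.sub_apply, LinearMap.smul_apply]
      module
    · intro j k e Ψ _
      rw [hP]
      rcases Int.units_eq_one_or e with rfl | rfl
      · rw [ramond_Ppm_one, ramond_Jpm_one, lie_smul_right, gcomm_pTr_opA, LinearMap.neg_apply,
          LinearMap.smul_apply]
        module
      · rw [ramond_Ppm_neg_one, ramond_Jpm_neg_one, lie_smul_right, gcomm_pTr_opC, LinearMap.neg_apply,
          LinearMap.smul_apply]
        module
    · intro j k Ψ _
      rw [ramond_J, ramond_JPM, lie_smul_smul, gcomm_one_swap, gcomm_opT_opB]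
      simp
    · intro j e Ψ _
      rcases Int.units_eq_one_or e with rfl | rfl
      · rw [ramond_JPM, ramond_Jpm_one, lie_smul_smul, gcomm_opB_opA, LinearMap.smul_apply, smul_smul]
        simp
      · rw [ramond_JPM, ramond_Jpm_neg_one, lie_smul_smul, gcomm_opB_opC, LinearMap.smul_apply, smul_smul,
          LinearMap.neg_apply]
        push_cast [Units.val_one, Units.val_neg]
        module
    · intro j e k f Ψ hΨ
      rw [ramond_J, ramond_JPM]
      rcases Int.units_eq_one_or e with rfl | rfl <;> rcases Int.units_eq_one_or f with rfl | rfl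
      · rw [ramond_Jpm_one, ramond_Jpm_one, lie_smul_smul, gcomm_opA_opA]
        simp
      · rw [ramond_Jpm_one, ramond_Jpm_neg_one, lie_smul_smul, gcomm_opA_opC, I2]
        simp only [LinearMap.add_apply, LinearMap.smul_apply, smul_smul]
        push_cast [Units.val_one, Units.val_neg]
        linear_combination (norm := module) -(I2 • opT D j k Ψ) - kron j k • (I2 • opB D Ψ)
      · rw [ramond_Jpm_one, ramond_Jpm_neg_one, lie_smul_smul, gcomm_one_swap, gcomm_opA_opC, I2,
          opT_antisymm k j, kron_comm k j]
        simp only [LinearMap.neg_apply, LinearMap.add_apply, LinearMap.smul_apply, smul_smul]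
        push_cast [Units.val_one, Units.val_neg]
        linear_combination (norm := module) -(I2 • opT D j k Ψ) + kron j k • (I2 • opB D Ψ)
      · rw [ramond_Jpm_neg_one, ramond_Jpm_neg_one, lie_smul_smul, h j k Ψ hΨ]
        simp
    · intro j e k l Ψ _
      rw [ramond_J, kron_comm j k, kron_comm j l]
      rcases Int.units_eq_one_or e with rfl | rfl
      · rw [ramond_Jpm_one, ramond_Jpm_one, ramond_Jpm_one, lie_smul_smul, gcomm_one_swap, gcomm_opT_opA]
        simp only [LinearMap.neg_apply, LinearMap.sub_apply, LinearMap.smul_apply]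
        module
      · rw [ramond_Jpm_neg_one, ramond_Jpm_neg_one, ramond_Jpm_neg_one, lie_smul_smul, gcomm_one_swap,
          gcomm_opT_opC]
        simp only [LinearMap.neg_apply, LinearMap.sub_apply, LinearMap.smul_apply]
        module
    · intro k l p q Ψ _
      simp only [ramond_J]
      rw [lie_smul_smul, gcomm_opT_opT]
      simp only [LinearMap.add_apply, LinearMap.sub_apply, LinearMap.smul_apply]
      module
end

/-! ### The necessary and sufficient condition -/

section
variable {D : ℕ}

theorem onMom_pPlusInv_injective {v : Dom D} (h : onMom (pPlusInv D) v = 0) : v = 0 := by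
  have h1 := LinearMap.congr_fun (onMom_pPlus_mul_pPlusInv D) v
  rw [Module.End.mul_apply, h, map_zero] at h1
  exact h1.symm

/-- R preserves the energy, so H may be replaced by c, and division by p⁺ is injective. -/
theorem bracketsOn_apply_eq_zero_iff (μ a : ℝ) {j k : Fin (D - 2)} (hjk : j ≠ k) {c : ℂ} {Ψ : Dom D}
    (hΨ : ham D Ψ = c • Ψ) : gcomm 1 (opC D μ a j) (opC D μ a k) Ψ = 0 ↔
      opX D a j k Ψ = (2 * c - (μ : ℂ) ^ 2) • opR D j k Ψ := by
  have h1 : ham D (opR D j k Ψ) = c • opR D j k Ψ := by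
    rw [(hasWeight_opR D j k).apply hΨ, sub_zero]
  have h2 : (opX D a j k + (((μ : ℂ) ^ 2) • opR D j k - (2 : ℂ) • (ham D * opR D j k))) Ψ =
      opX D a j k Ψ - (2 * c - (μ : ℂ) ^ 2) • opR D j k Ψ := by
    rw [LinearMap.add_apply, LinearMap.sub_apply, LinearMap.smul_apply, LinearMap.smul_apply,
      Module.End.mul_apply, h1]
    module
  rw [gcomm_opC_opC μ a hjk, Module.End.mul_apply, Module.End.mul_apply, h2, ← sub_eq_zero (b := _ • _)]
  constructor
  · exact fun h => onMom_pPlusInv_injective (onMom_pPlusInv_injective h)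
  · intro h
    rw [h, map_zero, map_zero]

theorem representsOn_energySpace_iff (μ a ℓ : ℝ) :
    (ramond D μ a).RepresentsOn (statesIn (energySpace D ℓ)) ↔
      ∀ j k, j ≠ k → ∀ Ψ, ham D Ψ = (ℓ : ℂ) • Ψ →
        opX D a j k Ψ = (2 * (ℓ : ℂ) - (μ : ℂ) ^ 2) • opR D j k Ψ := by
  rw [LightConeFamily.RepresentsOn, and_iff_right (preserves_energy μ a ℓ), bracketsOn_iff]
  constructor
  · intro h j k hjk Ψ hΨ
    exact (bracketsOn_apply_eq_zero_iff μ a hjk hΨ).1 (h j k Ψ (mem_statesIn_energySpace.2 hΨ))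
  · intro h j k Ψ hΨ
    by_cases hjk : j = k
    · rw [hjk, gcomm_self, LinearMap.zero_apply]
    · have hΨ := mem_statesIn_energySpace.1 hΨ
      exact (bracketsOn_apply_eq_zero_iff μ a hjk hΨ).2 (h j k hjk Ψ hΨ)

theorem exists_testFn_ne_zero (D : ℕ) : ∃ f : TestFn D, f ≠ 0 := by
  have h1 : ({p : Mom D | 0 < p.1} : Set (Mom D)) ∈ nhds ((1, 0) : Mom D) :=
    (halfSpace D).isOpen.mem_nhds (show (0 : ℝ) < 1 from one_pos)
  obtain ⟨f, hf, hc, hs, -, hx⟩ := exists_contDiff_tsupport_subset (n := ⊤) h1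
  have hsub : Function.support (fun p => ((f p : ℝ) : ℂ)) = Function.support f := by
    ext p; simp
  refine ⟨{ toFun := fun p => ((f p : ℝ) : ℂ)
            contDiff' := Complex.ofRealCLM.contDiff.comp hs
            hasCompactSupport' := hc.comp_left (g := fun x : ℝ => (x : ℂ)) Complex.ofReal_zero
            tsupport_subset' := by rw [tsupport, hsub]; exact hf }, fun h => ?_⟩
  have h2 := DFunLike.congr_fun h ((1, 0) : Mom D)
  change ((f (1, 0) : ℝ) : ℂ) = 0 at h2
  rw [hx] at h2
  simp at h2

theorem exists_ground_ne_zero (D : ℕ) : ∃ g : Dom D, AnnFrom 1 g ∧ g ≠ 0 := by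
  obtain ⟨f, hf⟩ := exists_testFn_ne_zero D
  refine ⟨_, annFrom_vacuum f, fun h => hf ?_⟩
  have h1 := congrArg (comp ((0, ∅) : FockIndex D)) h
  rwa [comp_tmul, Finsupp.single_eq_same, one_smul, map_zero] at h1

theorem dOsc_zero_apply_self (j : Fin (D - 2)) (v : Dom D) :
    dOsc D 0 j (dOsc D 0 j v) = (1 / 2 : ℂ) • v := by
  have h := LinearMap.congr_fun (dOsc_dOsc_zero D j j) v
  rw [kron, if_pos rfl, one_smul] at h
  have h' : dOsc D 0 j (dOsc D 0 j v) = v - dOsc D 0 j (dOsc D 0 j v) := h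
  linear_combination (norm := module) (1 / 2 : ℂ) • h'

/-- On ground states R is d_0^j d_0^k, and each d_0 is invertible because its square is 1/2. -/
theorem opR_ground_ne_zero {g : Dom D} (hg : AnnFrom 1 g) (h0 : g ≠ 0) {j k : Fin (D - 2)}
    (hjk : j ≠ k) : opR D j k g ≠ 0 := by
  rw [opR_ground' hg hjk]
  intro h
  have h1 := dOsc_zero_apply_self j (dOsc D 0 k g)
  rw [h, map_zero] at h1
  have h2 : dOsc D 0 k g = 0 := (smul_eq_zero.1 h1.symm).resolve_left (by norm_num)
  have h3 := dOsc_zero_apply_self k g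
  rw [h2, map_zero] at h3
  exact h0 ((smul_eq_zero.1 h3.symm).resolve_left (by norm_num))

/-- Massive ground states violate the bracket in every dimension. This excludes both N = 0 and the
whole domain. -/
theorem opX_ground_ne {μ : ℝ} (hμ : 0 < μ) (a : ℝ) {g : Dom D} (hg : AnnFrom 1 g) (h0 : g ≠ 0)
    {j k : Fin (D - 2)} (hjk : j ≠ k) :
    opX D a j k g ≠ (2 * (0 : ℂ) - (μ : ℂ) ^ 2) • opR D j k g := by
  rw [opX_ground hg a hjk]
  intro h
  have h1 := (smul_eq_zero.1 h.symm).resolve_right (opR_ground_ne_zero hg h0 hjk)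
  simp [hμ.ne'] at h1

/-- The conditions obtained from the states `α^i_{-N} g`, `N = M + 1`, with `g` a ground state. -/
theorem dcomm_opX_of_eigenstate {a : ℝ} {c : ℂ} {M : ℕ} {j k : Fin (D - 2)} (hjk : j ≠ k)
    (h : ∀ Ψ, ham D Ψ = ((M : ℂ) + 1) • Ψ → opX D a j k Ψ = c • opR D j k Ψ) {g : Dom D}
    (hg : AnnFrom 1 g) (i₁ i₂ : Fin (D - 2)) :
    dcomm D (opX D a j k) false (-((M : ℤ) + 1)) i₁ false ((M : ℤ) + 1) i₂ g =
      (-(c * ((M : ℂ) + 1))) • (kron i₁ i₂ • opR D j k g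
        + (kron k i₁ * kron j i₂ - kron j i₁ * kron k i₂) • g) := by
  have hM : (M : ℤ) + 1 ≠ 0 := by omega
  have hM' : -((M : ℤ) + 1) ≠ 0 := by omega
  have hpos : (0 : ℤ) < (M : ℤ) + 1 := by omega
  have hham : ham D (osc D false (-((M : ℤ) + 1)) i₁ g) =
      ((M : ℂ) + 1) • osc D false (-((M : ℤ) + 1)) i₁ g := by
    rw [(hasWeight_osc D false (-((M : ℤ) + 1)) i₁).apply (c := 0) (by rw [ham_ground hg, zero_smul])]
    push_cast
    congr 1
    ring
  have hcomm : ∀ {v : Dom D}, AnnFrom 1 v → ∀ i, osc D false ((M : ℤ) + 1) i₂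
      (osc D false (-((M : ℤ) + 1)) i v) = (((M : ℂ) + 1) * kron i i₂) • v := by
    intro v hv i
    have h1 := LinearMap.congr_fun (gcomm_osc D false false ((M : ℤ) + 1) (-((M : ℤ) + 1)) i₂ i
      (s := 1) rfl) v
    rw [gcomm_apply, hv.osc_apply false hpos, map_zero, smul_zero, sub_zero] at h1
    rw [h1, kron_comm, kron]
    by_cases hi : i₂ = i <;> simp [hi, oscNorm]
  have h1 := LinearMap.congr_fun (gcomm_opR_of_ne D false (-((M : ℤ) + 1)) i₁ j k (Or.inr hM')) g
  rw [gcomm_apply, one_smul, sub_eq_iff_eq_add] at h1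
  rw [dcomm, show exSign false false = 1 from rfl, gcomm_apply, hg.osc_apply false hpos, map_zero, one_smul, zero_sub, gcomm_apply,
    opX_ground hg a hjk, map_zero, smul_zero, sub_zero, h _ hham, h1, map_smul, map_add,
    hcomm (hg.opR D j k), LinearMap.sub_apply, LinearMap.smul_apply, LinearMap.smul_apply, map_sub,
    map_smul, map_smul, hcomm hg, hcomm hg]
  module

/-- The double commutator of X on a ground state is known in two ways: from `dcomm_opX_bose`, and
from the assumed relation X = c R on the states α_{-N} g. Comparing two index choices determines c
and then the dimension. -/
theorem dimension_and_mass {μ : ℝ} {a : ℝ} {M : ℕ} {j k : Fin (D - 2)} (hjk : j ≠ k)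
    (h : ∀ Ψ, ham D Ψ = ((M : ℂ) + 1) • Ψ →
      opX D a j k Ψ = (2 * ((M : ℂ) + 1) - (μ : ℂ) ^ 2) • opR D j k Ψ) :
    D = 10 ∧ μ ^ 2 / 2 = (M : ℝ) + 1 := by
  obtain ⟨g, hg, h0⟩ := exists_ground_ne_zero D
  have hM : (M : ℂ) + 1 ≠ 0 := by exact_mod_cast Nat.succ_ne_zero M
  have hjk' : kron j k = 0 := if_neg hjk
  have hkj : kron k j = 0 := if_neg hjk.symm
  have hs : ∀ i : Fin (D - 2), kron i i = 1 := fun i => if_pos rfl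
  -- With equal indices the antisymmetric left-hand side vanishes and R g ≠ 0 forces c = 0. The
  -- indices j, k then isolate the factor 8 - (D - 2).
  have h1 := dcomm_opX_of_eigenstate hjk h hg j j
  have h2 := dcomm_opX_of_eigenstate hjk h hg j k
  rw [dcomm_opX_bose hg a hjk] at h1 h2
  rw [hkj, hs] at h1
  simp only [mul_zero, zero_mul, sub_self, zero_smul, add_zero, one_smul] at h1
  have hc := (smul_eq_zero.1 h1.symm).resolve_right (opR_ground_ne_zero hg h0 hjk)
  rw [neg_eq_zero, mul_eq_zero, or_iff_left hM] at hc
  rw [hc, hs, hs, hjk', hkj, zero_mul ((M : ℂ) + 1), neg_zero, zero_smul] at h2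
  have h3 := (smul_eq_zero.1 h2).resolve_right h0
  simp only [mul_one, mul_zero, sub_zero, mul_eq_zero, div_eq_zero_iff, pow_eq_zero_iff, hM, ne_eq,
    OfNat.ofNat_ne_zero, not_false_eq_true, or_false] at h3
  constructor
  · have h4 : ((D - 2 : ℕ) : ℂ) = (8 : ℕ) := (sub_eq_zero.1 h3).symm
    have h5 := Nat.cast_injective h4
    omega
  · have h4 : 2 * ((M : ℝ) + 1) - μ ^ 2 = 0 := by exact_mod_cast hc
    linarith

theorem representsOn_energySpace_nat_iff (hD : 4 ≤ D) {μ : ℝ} (hμ : 0 < μ) (a : ℝ) (N : ℕ) :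
    (ramond D μ a).RepresentsOn (statesIn (energySpace D N)) ↔ D = 10 ∧ μ ^ 2 / 2 = (N : ℝ) := by
  rw [representsOn_energySpace_iff]
  have hjk : (⟨0, by omega⟩ : Fin (D - 2)) ≠ ⟨1, by omega⟩ := by simp
  constructor
  · intro h
    cases N with
    | zero =>
      obtain ⟨g, hg, h0⟩ := exists_ground_ne_zero D
      refine absurd (h _ _ hjk g ?_) ?_
      · rw [ham_ground hg]; simp
      · have := opX_ground_ne hμ a hg h0 hjk
        simpa using this
    | succ M =>
      have h1 := dimension_and_mass (μ := μ) (a := a) (M := M) hjk fun Ψ hΨ => by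
        have := h _ _ hjk Ψ (by rw [hΨ]; push_cast; rfl)
        push_cast at this
        exact this
      push_cast
      exact h1
  · rintro ⟨h10, hN⟩ j k hjk Ψ _
    have h1 : 2 * ((N : ℝ) : ℂ) - (μ : ℂ) ^ 2 = 0 := by
      rw [← hN]; push_cast; ring
    rw [opX_eq_zero a hjk h10, h1, zero_smul, LinearMap.zero_apply]

theorem representsOn_physSpace (h10 : D = 10) (μ a : ℝ) :
    (ramond D μ a).RepresentsOn (statesIn (physSpace D μ)) := by
  rw [physSpace, representsOn_energySpace_iff]
  intro j k hjk Ψ _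
  have h1 : 2 * ((μ ^ 2 / 2 : ℝ) : ℂ) - (μ : ℂ) ^ 2 = 0 := by push_cast; ring
  rw [opX_eq_zero a hjk h10, h1, zero_smul, LinearMap.zero_apply]

theorem not_representsOn_top (hD : 4 ≤ D) {μ : ℝ} (hμ : 0 < μ) (a : ℝ) :
    ¬ (ramond D μ a).RepresentsOn ⊤ := by
  intro h
  have hjk : (⟨0, by omega⟩ : Fin (D - 2)) ≠ ⟨1, by omega⟩ := by simp
  obtain ⟨g, hg, h0⟩ := exists_ground_ne_zero D
  have h1 := (bracketsOn_iff μ a ⊤).1 h.2 ⟨0, by omega⟩ ⟨1, by omega⟩ g (Submodule.mem_top (x := g))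
  rw [bracketsOn_apply_eq_zero_iff μ a hjk (c := 0) (by rw [ham_ground hg, zero_smul])] at h1
  exact opX_ground_ne hμ a hg h0 hjk h1
end

end RamondString

end

/-! ### The main theorem -/

theorem mainTheorem3 (D : ℕ) (hD : 4 ≤ D) (μ : ℝ) (hμ : 0 < μ) (a : ℝ) :
    (D = 10 → (RamondString.ramond D μ a).RepresentsOn
      (RamondString.statesIn (RamondString.physSpace D μ))) ∧
    ((∃ N : ℕ, μ ^ 2 / 2 = (N : ℝ)) →
      ((RamondString.ramond D μ a).RepresentsOn
        (RamondString.statesIn (RamondString.physSpace D μ)) ↔ D = 10)) ∧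
    (∀ N : ℕ, (RamondString.ramond D μ a).RepresentsOn
        (RamondString.statesIn (RamondString.energySpace D N)) ↔
      D = 10 ∧ μ ^ 2 / 2 = (N : ℝ)) ∧
    ¬ (RamondString.ramond D μ a).RepresentsOn ⊤ := by
  refine ⟨fun h => RamondString.representsOn_physSpace h μ a, ?_,
    RamondString.representsOn_energySpace_nat_iff hD hμ a, RamondString.not_representsOn_top hD hμ a⟩
  -- If μ²/2 is the natural number N, the physical space is the eigenspace for N and the mass
  -- condition holds automatically.
  rintro ⟨N, hN⟩
  rw [RamondString.physSpace, hN, RamondString.representsOn_energySpace_nat_iff hD hμ a]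
  exact and_iff_left hN
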